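/- Let $(\Omega,\mathcal F,\mathbf P)$ be a complete probability space and let $\{B(t)\}_{t\in\mathbf R}$ be a two-sided standard Brownian motion with $B(0)=0$. Let $\mathcal G_t$ be the $\sigma$-algebra generated by the increments $B(r)-B(q)$, $q,r\le t$, augmented by the $\mathbf P$-null sets (for $t\ge 0$ this is the augmented $\sigma$-algebra generated by $B(r)$, $r\le t$). Let $H\in(1/2,1)$, $$c_H=\sqrt{\frac{2H\,\Gamma(3/2-H)}{\Gamma(1/2+H)\,\Gamma(2-2H)}},$$ and let $B_H$ be the fractional Brownian motion driven by $B$, i.e. for each $t\in\mathbf R$, almost surely $$B_H(t)=c_H\int_{\mathbf R}\big[(t-r)_+^{H-1/2}-(-r)_+^{H-1/2}\big]\,dB(r).$$ Let $s\in\mathbf R$ and $T>s$, and put $$W_H(t)=c_H\int_s^t(t-r)^{H-1/2}\,dB(r),\qquad R_H(t)=c_H\int_{-\infty}^s f(t,r)\,dB(r),\qquad f(t,r)=(t-r)^{H-1/2}-(s-r)^{H-1/2},$$ and, for $\tau\in[s,T]$ and $g\in L_2(s,T)$, $G_H(\tau,s,T,g)=c_H(H-1/2)\int_\tau^T(t-\tau)^{H-3/2}g(t)\,dt$.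 Integrals with respect to $dB$ are Itô integrals, i.e. $L_2$-limits of integrals of simple processes. Then the integrals defining $W_H(t)$ and $R_H(t)$ exist, and $B_H(t)-B_H(s)=W_H(t)+R_H(t)$ a.s. for every $t\ge s$. The processes $\{W_H(t)\}_{t>s}$ and $\{R_H(t)\}_{t>s}$ are independent of each other, Gaussian, $\{\mathcal G_t\}$-adapted and have zero mean, and: (i) The process $\{W_H(t)\}_{t>s}$ is independent of $\mathcal G_s$. For $\gamma\in L_2(\Omega,\mathcal G_s,\mathbf P;L_2(s,T))$, let $\int_s^T\gamma\,dW_H$ denote the $L_2(\Omega)$-limit, the same along all approximating sequences, of the sums $\sum_i\xi_i\,(W_H(b_i)-W_H(a_i))$ for simple processes $\sum_i\xi_i 1_{(a_i,b_i]}$, with $s\le a_i\le b_i\le T$ and $\xi_i$ bounded and $\mathcal G_s$-measurable, that converge to $\gamma$ in $L_2(\Omega\times[s,T])$. For every such $\gamma$ this limit exists, the integral defining $G_H(\tau,s,T,\gamma)$ converges absolutely for almost every $(\tau,\omega)$, the Itô integral below exists, and almost surely $$\int_s^T\gamma(t)\,dW_H(t)=\int_s^T G_H(\tau,s,T,\gamma)\,dB(\tau).$$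 (ii) For every $t>s$, $R_H(t)$ is $\mathcal G_s$-measurable, the integral $\mathcal D R_H(t)=c_H\int_{-\infty}^s f'_t(t,q)\,dB(q)$, $f'_t=\partial f/\partial t$, exists, and $$\lim_{\delta\to0}\mathbf E\left|\frac{R_H(t+\delta)-R_H(t)}{\delta}-\mathcal D R_H(t)\right|=0.$$ Moreover, (a) $\mathcal D R_H(t)$ is $\mathcal G_s$-measurable for all $t>s$; (b) for every $t>s$, $$\mathbf E\,\mathcal D R_H(t)^2=c_H^2\frac{(H-1/2)^2}{2-2H}(t-s)^{2H-2},\qquad \mathbf E\int_s^t\mathcal D R_H(r)^2\,dr=\frac{c_H^2(H-1/2)}{2(2-2H)}(t-s)^{2H-1},$$ where the second identity holds for every jointly measurable version of the process $\mathcal D R_H$, and such a version exists. -/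

import Mathlib

open MeasureTheory ProbabilityTheory Set Filter Topology
open scoped ENNReal

noncomputable section

namespace FBM

variable {Ω : Type*} [mΩ : MeasurableSpace Ω]

/-- Standard Brownian motion indexed by the whole real line, with `B 0 = 0`. -/
structure IsTwoSidedBrownian (B : ℝ → Ω → ℝ) (P : Measure Ω) : Prop where
  measurable : ∀ t, Measurable (B t)
  zero : ∀ᵐ ω ∂P, B 0 ω = 0
  law : ∀ q r, q ≤ r →
    HasLaw (fun ω ↦ B r ω - B q ω) (gaussianReal 0 (r - q).toNNReal) P
  indep : HasIndepIncrements B P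
  cont : ∀ᵐ ω ∂P, Continuous (fun t ↦ B t ω)

/-- The `σ`-algebra generated by the increments of `B` up to time `t`, augmented by the
`P`-null sets. -/
abbrev history (B : ℝ → Ω → ℝ) (P : Measure Ω) (t : ℝ) : MeasurableSpace Ω :=
  eventuallyMeasurableSpace
    (⨆ q : Iic t, ⨆ r : Iic t,
      MeasurableSpace.comap (fun ω ↦ B r ω - B q ω) (borel ℝ)) (ae P)

/-- For `t ≥ 0`, because `B 0 = 0`, the increments of `B` up to time `t` and the values of `B` up
to time `t` generate the same augmented `σ`-algebra. -/
theorem history_eq_of_nonneg {B : ℝ → Ω → ℝ} {P : Measure Ω}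
    (h0 : ∀ᵐ ω ∂P, B 0 ω = 0) {t : ℝ} (ht : 0 ≤ t) :
    history B P t = eventuallyMeasurableSpace
      (⨆ r : Iic t, MeasurableSpace.comap (B r) (borel ℝ)) (ae P) := by
  have hb : borel ℝ = (inferInstance : MeasurableSpace ℝ) := (BorelSpace.measurable_eq).symm
  unfold history
  rw [hb]
  apply le_antisymm
  · rintro A ⟨A', hA', hAA'⟩
    refine ⟨A', ?_, hAA'⟩
    refine (iSup_le fun q ↦ iSup_le fun r ↦ ?_ : _ ≤ (_ : MeasurableSpace Ω)) A' hA'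
    rw [← measurable_iff_comap_le]
    have hm (u : Iic t) : Measurable[⨆ r : Iic t,
        MeasurableSpace.comap (B r) (inferInstance : MeasurableSpace ℝ)] (B u) :=
      measurable_iff_comap_le.2 (le_iSup (fun r : Iic t ↦
        MeasurableSpace.comap (B r) (inferInstance : MeasurableSpace ℝ)) u)
    exact (hm r).sub (hm q)
  · rintro A ⟨A', hA', hAA'⟩
    have key : (⨆ r : Iic t,
        MeasurableSpace.comap (B r) (inferInstance : MeasurableSpace ℝ)) ≤
        eventuallyMeasurableSpace (⨆ q : Iic t, ⨆ r : Iic t,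
          MeasurableSpace.comap (fun ω ↦ B r ω - B q ω)
            (inferInstance : MeasurableSpace ℝ)) (ae P) := by
      refine iSup_le fun r ↦ ?_
      rintro _ ⟨C, hC, rfl⟩
      refine ⟨(fun ω ↦ B r ω - B 0 ω) ⁻¹' C, ?_, ?_⟩
      · have h1 : MeasurableSpace.comap (fun ω ↦ B r ω - B 0 ω)
            (inferInstance : MeasurableSpace ℝ) ≤ ⨆ q : Iic t, ⨆ r : Iic t,
            MeasurableSpace.comap (fun ω ↦ B r ω - B q ω)
              (inferInstance : MeasurableSpace ℝ) :=
          le_iSup₂_of_le (f := fun (q r : Iic t) ↦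
            MeasurableSpace.comap (fun ω ↦ B r ω - B q ω)
              (inferInstance : MeasurableSpace ℝ)) ⟨0, ht⟩ r le_rfl
        exact h1 _ ⟨C, hC, rfl⟩
      · filter_upwards [h0] with ω hω
        apply propext
        change B r ω ∈ C ↔ B r ω - B 0 ω ∈ C
        rw [hω, sub_zero]
    obtain ⟨A'', hA'', h⟩ := key A' hA'
    exact ⟨A'', hA'', hAA'.trans h⟩

/-- Simple processes `∑ᵢ ξᵢ 1_{(aᵢ, bᵢ]}` with `aᵢ ≤ bᵢ` in the time set `D` and each `ξᵢ` bounded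
and measurable with respect to `𝓐 aᵢ`. -/
structure SimpleIntegrand (𝓐 : ℝ → MeasurableSpace Ω) (D : Set ℝ) where
  n : ℕ
  left : Fin n → ℝ
  right : Fin n → ℝ
  coef : Fin n → Ω → ℝ
  left_mem : ∀ i, left i ∈ D
  right_mem : ∀ i, right i ∈ D
  left_le_right : ∀ i, left i ≤ right i
  measurable_coef : ∀ i, Measurable[𝓐 (left i)] (coef i)
  bounded_coef : ∀ i, ∃ C : ℝ, ∀ ω, |coef i ω| ≤ C

/-- The simple process as a function of time and `ω`. -/
def SimpleIntegrand.eval {𝓐 : ℝ → MeasurableSpace Ω} {D : Set ℝ} (S : SimpleIntegrand 𝓐 D)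
    (r : ℝ) (ω : Ω) : ℝ :=
  ∑ i, (Ioc (S.left i) (S.right i)).indicator (fun _ ↦ S.coef i ω) r

/-- The elementary integral `∑ᵢ ξᵢ (Z(bᵢ) - Z(aᵢ))`. -/
def SimpleIntegrand.integral {𝓐 : ℝ → MeasurableSpace Ω} {D : Set ℝ} (S : SimpleIntegrand 𝓐 D)
    (Z : ℝ → Ω → ℝ) (ω : Ω) : ℝ :=
  ∑ i, S.coef i ω * (Z (S.right i) ω - Z (S.left i) ω)

/-- The simple processes `S k` converge to `φ` in `L²(D × Ω)`. -/
def Approximates {𝓐 : ℝ → MeasurableSpace Ω} {D : Set ℝ} (P : Measure Ω)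
    (S : ℕ → SimpleIntegrand 𝓐 D) (φ : ℝ → Ω → ℝ) : Prop :=
  Tendsto (fun k ↦ eLpNorm (fun p : ℝ × Ω ↦ (S k).eval p.1 p.2 - φ p.1 p.2) 2
    ((volume.restrict D).prod P)) atTop (𝓝 0)

/-- `X` is the stochastic integral `∫_D φ dZ` of the square integrable process `φ`: the
`L²(P)`-limit of the elementary integrals along simple processes (with coefficients measurable with
respect to `𝓐` at the left endpoint) that approximate `φ` in `L²(D × Ω)`. Approximating sequences
exist and the limit is the same along all of them. -/
structure IsStochIntegral (Z : ℝ → Ω → ℝ) (𝓐 : ℝ → MeasurableSpace Ω) (P : Measure Ω) (D : Set ℝ)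
    (φ : ℝ → Ω → ℝ) (X : Ω → ℝ) : Prop where
  memLp_integrand : MemLp (fun p : ℝ × Ω ↦ φ p.1 p.2) 2 ((volume.restrict D).prod P)
  memLp_integral : MemLp X 2 P
  exists_approx : ∃ S : ℕ → SimpleIntegrand 𝓐 D, Approximates P S φ
  tendsto : ∀ S : ℕ → SimpleIntegrand 𝓐 D, Approximates P S φ →
    Tendsto (fun k ↦ eLpNorm (fun ω ↦ (S k).integral Z ω - X ω) 2 P) atTop (𝓝 0)

/-- The stochastic integral `∫_D φ dZ` exists. -/
def StochIntegrable (Z : ℝ → Ω → ℝ) (𝓐 : ℝ → MeasurableSpace Ω) (P : Measure Ω) (D : Set ℝ)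
    (φ : ℝ → Ω → ℝ) : Prop :=
  ∃ X, IsStochIntegral Z 𝓐 P D φ X

open Classical in
/-- The stochastic integral `∫_D φ dZ` (a version of it; `0` if it does not exist). -/
def stochIntegral (Z : ℝ → Ω → ℝ) (𝓐 : ℝ → MeasurableSpace Ω) (P : Measure Ω) (D : Set ℝ)
    (φ : ℝ → Ω → ℝ) : Ω → ℝ :=
  if h : StochIntegrable Z 𝓐 P D φ then h.choose else 0

/-- Existence of the Itô integral `∫_D φ dB`. -/
def ItoIntegrable (B : ℝ → Ω → ℝ) (P : Measure Ω) (D : Set ℝ) (φ : ℝ → Ω → ℝ) : Prop :=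
  StochIntegrable B (history B P) P D φ

/-- The Itô integral `∫_D φ dB`. -/
def itoIntegral (B : ℝ → Ω → ℝ) (P : Measure Ω) (D : Set ℝ) (φ : ℝ → Ω → ℝ) : Ω → ℝ :=
  stochIntegral B (history B P) P D φ

/-- The constant `c_H`. -/
def cH (H : ℝ) : ℝ :=
  √(2 * H * Real.Gamma (3 / 2 - H) / (Real.Gamma (1 / 2 + H) * Real.Gamma (2 - 2 * H)))

/-- `(t - r)₊^{H - 1/2} - (-r)₊^{H - 1/2}`. -/
def mvnKernel (H t r : ℝ) : ℝ :=
  (max (t - r) 0) ^ (H - 1 / 2) - (max (-r) 0) ^ (H - 1 / 2)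

/-- `BH` is the fractional Brownian motion with Hurst parameter `H` driven by `B`
(Mandelbrot–Van Ness): `B_H(t) = c_H ∫_ℝ [(t - r)₊^{H - 1/2} - (-r)₊^{H - 1/2}] dB(r)` a.s. -/
def IsFractionalBrownian (BH B : ℝ → Ω → ℝ) (P : Measure Ω) (H : ℝ) : Prop :=
  ∀ t, BH t =ᵐ[P] fun ω ↦ cH H * itoIntegral B P univ (fun r _ ↦ mvnKernel H t r) ω

/-- `f(t, r) = (t - r)^{H - 1/2} - (s - r)^{H - 1/2}`. -/
def fKernel (H s t r : ℝ) : ℝ :=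
  (t - r) ^ (H - 1 / 2) - (s - r) ^ (H - 1 / 2)

/-- `W_H(t) = c_H ∫_s^t (t - r)^{H - 1/2} dB(r)`. -/
def WH (B : ℝ → Ω → ℝ) (P : Measure Ω) (H s t : ℝ) (ω : Ω) : ℝ :=
  cH H * itoIntegral B P (Icc s t) (fun r _ ↦ (t - r) ^ (H - 1 / 2)) ω

/-- `R_H(t) = c_H ∫_{-∞}^s f(t, r) dB(r)`. -/
def RH (B : ℝ → Ω → ℝ) (P : Measure Ω) (H s t : ℝ) (ω : Ω) : ℝ :=
  cH H * itoIntegral B P (Iic s) (fun r _ ↦ fKernel H s t r) ω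

/-- `𝒟R_H(t) = c_H ∫_{-∞}^s f'_t(t, r) dB(r)`. -/
def DRH (B : ℝ → Ω → ℝ) (P : Measure Ω) (H s t : ℝ) (ω : Ω) : ℝ :=
  cH H * itoIntegral B P (Iic s) (fun r _ ↦ deriv (fun u ↦ fKernel H s u r) t) ω

/-- `G_H(τ, s, T, g) = c_H (H - 1/2) ∫_τ^T (t - τ)^{H - 3/2} g(t) dt`; the value does not depend
on `s`. -/
def GH (H T : ℝ) (g : ℝ → ℝ) (τ : ℝ) : ℝ :=
  cH H * (H - 1 / 2) * ∫ t in τ..T, (t - τ) ^ (H - 3 / 2) * g t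

end FBM

end

/-!
The increments of `B` form a Gaussian process in which the increments before a time `t` are
uncorrelated with those after `t`, so the two families are independent
(`IsTwoSidedBrownian.indep_history_future`). Independence survives the passage to null sets, and
this makes the elementary integral of simple processes an isometry of `L²(D × Ω)` into `L²(P)`
(`SimpleIntegrand.eLpNorm_integral`). A π-λ argument shows that the simple processes are dense among
the adapted square integrable processes that occur here (`approximable_of_memLp`), so their Itô
integrals exist, and every identity between Itô integrals is an almost everywhere identity between
integrands. As `L²`-limits of increments, integrals of deterministic functions are Gaussian, have
mean zero, and are measurable with respect to the increments over the time set of integration.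

For `t ≥ s` the Mandelbrot–Van Ness kernels satisfy, for almost every `r`,
`(t - r)₊^{H - 1/2} - (s - r)₊^{H - 1/2} = (t - r)^{H - 1/2} 1_{[s, t]} + f(t, r) 1_{(-∞, s]}`,
which splits the increment into `W_H`, a functional of the increments after `s`, and
`R_H`, a functional of those before `s`. Square integrability of `f(t, ·)` near `-∞` comes from the
mean value bound `|f(t, r)| ≤ C (s - r)^{H - 3/2}`.

For the integral against `W_H`, a direct computation with
`c_H (H - 1/2) ∫_τ^b (t - τ)^{H - 3/2} dt = c_H (b - τ)^{H - 1/2}` gives the identity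
`∫ γ dW_H = ∫ G_H γ dB` for simple `γ` (`isItoIntegral_integral_WH`): the coefficients are
`𝒢_s`-measurable and can be moved under the Itô integral. The operator `γ ↦ G_H γ` is convolution
with an integrable kernel, so it is bounded on `L²([s, T] × Ω)` by the Schur test (`GH_bound`). Both
sides are then continuous in `γ`, and density of simple processes finishes the argument.

For `R_H`, the difference quotients of `f(·, q)` are dominated in `L²(-∞, s)`, so they converge
there, and the isometry carries this to `L²(P)`, hence to `L¹(P)`. The second moment of `𝒟R_H(t)` is
`c_H² (H - 1/2)² ∫_{-∞}^s (t - r)^{2H - 3} dr`. Since `t ↦ 𝒟R_H(t)` is locally Lipschitz from the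
right into `L²(P)`, its dyadic discretizations converge almost surely for each `t`, which yields a
jointly measurable version; for any such version Tonelli's theorem gives the energy.
-/

namespace FBM

/-! ### Increments of Brownian motion -/

section Increments

variable {Ω : Type*} [mΩ : MeasurableSpace Ω] {B : ℝ → Ω → ℝ} {P : Measure Ω}

/-- The increment of `B` over the pair of times `p`. -/
def increment (B : ℝ → Ω → ℝ) (p : ℝ × ℝ) (ω : Ω) : ℝ := B p.2 ω - B p.1 ω

lemma IsTwoSidedBrownian.isGaussianProcess_sub (hB : IsTwoSidedBrownian B P) (m : ℝ) :
    IsGaussianProcess (fun (t : Ici m) ω ↦ B t ω - B m ω) P := by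
  refine HasIndepIncrements.isGaussianProcess (fun t ↦ (hB.law m t t.2).hasGaussianLaw) ?_ ?_
  · exact Eventually.of_forall fun ω ↦ sub_self _
  · intro n t ht
    convert hB.indep n (fun i ↦ (t i : ℝ)) (fun i j hij ↦ ht hij) using 3
    ring

/-- The increments of `B` over all pairs of times form a Gaussian process. -/
lemma IsTwoSidedBrownian.isGaussianProcess_increment (hB : IsTwoSidedBrownian B P) :
    IsGaussianProcess (increment B) P where
  hasGaussianLaw I := by
    classical
    obtain ⟨m, hm⟩ : ∃ m : ℝ, ∀ p ∈ I, m ≤ p.1 ∧ m ≤ p.2 := by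
      obtain ⟨m, hm⟩ := ((I.image Prod.fst) ∪ (I.image Prod.snd)).bddBelow
      refine ⟨m, fun p hp ↦ ⟨hm ?_, hm ?_⟩⟩
      · simp only [Finset.coe_union, Finset.coe_image, mem_union, mem_image]
        exact Or.inl ⟨p, hp, rfl⟩
      · simp only [Finset.coe_union, Finset.coe_image, mem_union, mem_image]
        exact Or.inr ⟨p, hp, rfl⟩
    let u : ℝ → Ici m := fun x ↦ ⟨max x m, mem_Ici.2 (le_max_right _ _)⟩
    have hY : IsGaussianProcess (fun (p : ℝ × ℝ) ω ↦
        (B (u p.2) ω - B m ω) - (B (u p.1) ω - B m ω)) P := by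
      refine IsGaussianProcess.of_isGaussianProcess (hB.isGaussianProcess_sub m) fun p ↦
        ⟨{u p.1, u p.2},
        { toFun x := x ⟨u p.2, by simp⟩ - x ⟨u p.1, by simp⟩
          map_add' x y := by simp; ring
          map_smul' c x := by simp; ring }, fun ω ↦ ?_⟩
      simp
    convert hY.hasGaussianLaw I using 2 with ω
    ext ⟨p, hp⟩
    simp only [Finset.restrict, increment, u]
    rw [max_eq_left (hm p hp).1, max_eq_left (hm p hp).2]
    ring

lemma IsTwoSidedBrownian.memLp_incr (hB : IsTwoSidedBrownian B P) (q r : ℝ) :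
    MemLp (fun ω ↦ B r ω - B q ω) 2 P :=
  (hB.isGaussianProcess_increment.hasGaussianLaw_eval (q, r)).memLp_two

lemma IsTwoSidedBrownian.integral_incr (hB : IsTwoSidedBrownian B P) (q r : ℝ) :
    ∫ ω, (B r ω - B q ω) ∂P = 0 := by
  have key : ∀ q r, q ≤ r → ∫ ω, (B r ω - B q ω) ∂P = 0 := fun q r h ↦ by
    rw [(hB.law q r h).integral_eq, integral_id_gaussianReal]
  rcases le_total q r with h | h
  · exact key q r h
  · have := key r q h
    rw [← neg_eq_zero, ← integral_neg]
    simpa using this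

lemma IsTwoSidedBrownian.integral_incr_sq (hB : IsTwoSidedBrownian B P) {q r : ℝ} (h : q ≤ r) :
    ∫ ω, (B r ω - B q ω) ^ 2 ∂P = r - q := by
  have h1 := (hB.law q r h).variance_eq
  rw [variance_id_gaussianReal, variance_of_integral_eq_zero (hB.memLp_incr q r).aemeasurable
    (hB.integral_incr q r)] at h1
  rw [h1]; simp [h]

/-- Two increments over adjacent intervals are orthogonal. -/
lemma IsTwoSidedBrownian.integral_incr_mul_incr (hB : IsTwoSidedBrownian B P) {q r u : ℝ}
    (hqr : q ≤ r) (hru : r ≤ u) :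
    ∫ ω, (B r ω - B q ω) * (B u ω - B r ω) ∂P = 0 := by
  have h := hB.indep.indepFun_sub_sub hqr hru
  have := h.integral_mul_eq_mul_integral (hB.memLp_incr q r).aestronglyMeasurable
    (hB.memLp_incr r u).aestronglyMeasurable
  simp only [Pi.mul_apply, Pi.sub_apply] at this
  rw [this, hB.integral_incr, zero_mul]

/-- The second moment of two increments that start at the same time. -/
lemma IsTwoSidedBrownian.integral_incr_mul_incr_of_left_eq (hB : IsTwoSidedBrownian B P) {a b c : ℝ}
    (hb : a ≤ b) (hc : a ≤ c) :
    ∫ ω, (B b ω - B a ω) * (B c ω - B a ω) ∂P = min b c - a := by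
  wlog hbc : b ≤ c generalizing b c
  · rw [min_comm, ← this hc hb (le_of_not_ge hbc)]
    simp_rw [mul_comm]
  have e : ∀ ω, (B b ω - B a ω) * (B c ω - B a ω) =
      (B b ω - B a ω) ^ 2 + (B b ω - B a ω) * (B c ω - B b ω) := fun ω ↦ by ring
  simp_rw [e]
  have hi : Integrable (fun ω ↦ (B b ω - B a ω) * (B c ω - B b ω)) P :=
    (hB.memLp_incr a b).integrable_mul (hB.memLp_incr b c)
  rw [integral_add (hB.memLp_incr a b).integrable_sq hi,
    hB.integral_incr_sq hb, hB.integral_incr_mul_incr hb hbc, min_eq_left hbc, add_zero]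

/-- The augmented `σ`-algebra generated by the increments of `B` after time `t`. -/
abbrev future (B : ℝ → Ω → ℝ) (P : Measure Ω) (t : ℝ) : MeasurableSpace Ω :=
  eventuallyMeasurableSpace
    (⨆ q : Ici t, ⨆ r : Ici t,
      MeasurableSpace.comap (fun ω ↦ B r ω - B q ω) (borel ℝ)) (ae P)

/-- Augmenting by null sets preserves independence. -/
lemma indep_eventuallyMeasurableSpace {m₁ m₂ : MeasurableSpace Ω} (h : Indep m₁ m₂ P) :
    Indep (eventuallyMeasurableSpace m₁ (ae P)) (eventuallyMeasurableSpace m₂ (ae P)) P := by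
  rw [Indep_iff] at h ⊢
  rintro s t ⟨s', hs', hss⟩ ⟨t', ht', htt⟩
  rw [measure_congr hss, measure_congr htt, measure_congr (hss.inter htt), h s' t' hs' ht']

/-- The increments before and after time `s` are independent, since together they form a Gaussian
process in which the two families are uncorrelated. -/
lemma IsTwoSidedBrownian.indep_history_future [IsProbabilityMeasure P]
    (hB : IsTwoSidedBrownian B P) (s : ℝ) :
    Indep (history B P s) (future B P s) P := by
  refine indep_eventuallyMeasurableSpace ?_
  have hb : borel ℝ = (inferInstance : MeasurableSpace ℝ) := (BorelSpace.measurable_eq).symm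
  rw [hb]
  let f : (Iic s × Iic s) ⊕ (Ici s × Ici s) → ℝ × ℝ :=
    Sum.elim (fun p ↦ (p.1, p.2)) (fun p ↦ (p.1, p.2))
  have hG : IsGaussianProcess
      (Sum.elim (fun (p : Iic s × Iic s) ω ↦ B p.2 ω - B p.1 ω)
        (fun (p : Ici s × Ici s) ω ↦ B p.2 ω - B p.1 ω)) P := by
    have h := hB.isGaussianProcess_increment.comp_right f
    have e : increment B ∘ f = Sum.elim (fun (p : Iic s × Iic s) ω ↦ B p.2 ω - B p.1 ω)
        (fun (p : Ici s × Ici s) ω ↦ B p.2 ω - B p.1 ω) := by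
      ext (p | p) <;> rfl
    rwa [e] at h
  have hind := hG.indepFun_of_covariance_eq_zero
    (fun p ↦ (hB.memLp_incr _ _).aemeasurable) (fun p ↦ (hB.memLp_incr _ _).aemeasurable) ?_
  · rw [IndepFun_iff_Indep] at hind
    convert hind using 1
    · rw [MeasurableSpace.pi, MeasurableSpace.comap_iSup, iSup_prod']
      refine iSup_congr fun p ↦ ?_
      rw [MeasurableSpace.comap_comp]; rfl
    · rw [MeasurableSpace.pi, MeasurableSpace.comap_iSup, iSup_prod']
      refine iSup_congr fun p ↦ ?_
      rw [MeasurableSpace.comap_comp]; rfl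
  · rintro ⟨⟨q, hq⟩, ⟨r, hr⟩⟩ ⟨⟨u, hu⟩, ⟨v, hv⟩⟩
    have key : ∀ q u, q ≤ s → s ≤ u →
        Integrable (fun ω ↦ (B s ω - B q ω) * (B u ω - B s ω)) P ∧
        ∫ ω, (B s ω - B q ω) * (B u ω - B s ω) ∂P = 0 := fun q u hq hu ↦
      ⟨(hB.memLp_incr q s).integrable_mul (hB.memLp_incr s u), hB.integral_incr_mul_incr hq hu⟩
    rw [covariance_eq_sub (hB.memLp_incr _ _) (hB.memLp_incr _ _), hB.integral_incr, zero_mul,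
      sub_zero]
    have e : (fun ω ↦ B r ω - B q ω) * (fun ω ↦ B v ω - B u ω) = fun ω ↦
        ((B s ω - B q ω) * (B v ω - B s ω) - (B s ω - B q ω) * (B u ω - B s ω)) -
        ((B s ω - B r ω) * (B v ω - B s ω) - (B s ω - B r ω) * (B u ω - B s ω)) := by
      ext ω; simp only [Pi.mul_apply]; ring
    change ∫ ω, ((fun ω ↦ B r ω - B q ω) * (fun ω ↦ B v ω - B u ω)) ω ∂P = 0
    rw [e, integral_sub, integral_sub, integral_sub, (key q v hq hv).2, (key q u hq hu).2,
      (key r v hr hv).2, (key r u hr hu).2]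
    · simp
    · exact (key r v hr hv).1
    · exact (key r u hr hu).1
    · exact (key q v hq hv).1
    · exact (key q u hq hu).1
    · exact (key q v hq hv).1.sub (key q u hq hu).1
    · exact (key r v hr hv).1.sub (key r u hr hu).1

lemma history_mono (B : ℝ → Ω → ℝ) (P : Measure Ω) {s t : ℝ} (h : s ≤ t) :
    history B P s ≤ history B P t := by
  rintro A ⟨A', hA', hAA'⟩
  refine ⟨A', ?_, hAA'⟩
  refine (iSup_le fun q ↦ iSup_le fun r ↦ ?_ : _ ≤ (_ : MeasurableSpace Ω)) A' hA'
  exact le_iSup₂_of_le (f := fun (q r : Iic t) ↦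
    MeasurableSpace.comap (fun ω ↦ B r ω - B q ω) (borel ℝ))
    ⟨q, q.2.trans h⟩ ⟨r, r.2.trans h⟩ le_rfl

lemma eventuallyMeasurableSpace_ae_le [P.IsComplete] {m : MeasurableSpace Ω} (hm : m ≤ mΩ) :
    eventuallyMeasurableSpace m (ae P) ≤ mΩ := by
  rintro A ⟨A', hA', hAA'⟩
  exact (NullMeasurableSet.congr (hm _ hA').nullMeasurableSet hAA'.symm).measurable_of_complete

lemma IsTwoSidedBrownian.history_le [P.IsComplete] (hB : IsTwoSidedBrownian B P) (t : ℝ) :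
    history B P t ≤ mΩ := by
  refine eventuallyMeasurableSpace_ae_le (iSup₂_le fun q r ↦ ?_)
  rw [← BorelSpace.measurable_eq (α := ℝ), ← measurable_iff_comap_le]
  exact (hB.measurable _).sub (hB.measurable _)

lemma measurable_history_sub {q r t : ℝ} (hq : q ≤ t) (hr : r ≤ t) :
    Measurable[history B P t] (fun ω ↦ B r ω - B q ω) := by
  refine Measurable.mono (measurable_iff_comap_le.2 ?_) le_eventuallyMeasurableSpace
    (BorelSpace.measurable_eq (α := ℝ)).le
  exact le_iSup₂_of_le (f := fun (q r : Iic t) ↦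
    MeasurableSpace.comap (fun ω ↦ B r ω - B q ω) (borel ℝ)) ⟨q, hq⟩ ⟨r, hr⟩ le_rfl

lemma measurable_future_sub {q r t : ℝ} (hq : t ≤ q) (hr : t ≤ r) :
    Measurable[future B P t] (fun ω ↦ B r ω - B q ω) := by
  refine Measurable.mono (measurable_iff_comap_le.2 ?_) le_eventuallyMeasurableSpace
    (BorelSpace.measurable_eq (α := ℝ)).le
  exact le_iSup₂_of_le (f := fun (q r : Ici t) ↦
    MeasurableSpace.comap (fun ω ↦ B r ω - B q ω) (borel ℝ)) ⟨q, hq⟩ ⟨r, hr⟩ le_rfl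

end Increments

/-! ### Simple processes and the Itô isometry -/

section Simple

variable {Ω : Type*}

namespace SimpleIntegrand

variable {𝓐 𝓐' : ℝ → MeasurableSpace Ω} {D D' : Set ℝ}

/-- The simple process `0`. -/
def zero (𝓐 : ℝ → MeasurableSpace Ω) (D : Set ℝ) : SimpleIntegrand 𝓐 D where
  n := 0
  left := Fin.elim0
  right := Fin.elim0
  coef := Fin.elim0
  left_mem i := i.elim0
  right_mem i := i.elim0
  left_le_right i := i.elim0
  measurable_coef i := i.elim0
  bounded_coef i := i.elim0

/-- The simple process `ξ 1_{(a, b]}`. -/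
def single {a b : ℝ} (ha : a ∈ D) (hb : b ∈ D) (hab : a ≤ b) {ξ : Ω → ℝ}
    (hξ : Measurable[𝓐 a] ξ) (hC : ∃ C : ℝ, ∀ ω, |ξ ω| ≤ C) : SimpleIntegrand 𝓐 D where
  n := 1
  left _ := a
  right _ := b
  coef _ := ξ
  left_mem _ := ha
  right_mem _ := hb
  left_le_right _ := hab
  measurable_coef _ := hξ
  bounded_coef _ := hC

/-- The sum of two simple processes, obtained by juxtaposing their terms. -/
def add (S S' : SimpleIntegrand 𝓐 D) : SimpleIntegrand 𝓐 D where
  n := S.n + S'.n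
  left := Fin.append S.left S'.left
  right := Fin.append S.right S'.right
  coef := Fin.append S.coef S'.coef
  left_mem i := by
    refine Fin.addCases (fun i ↦ ?_) (fun i ↦ ?_) i
    · simpa using S.left_mem i
    · simpa using S'.left_mem i
  right_mem i := by
    refine Fin.addCases (fun i ↦ ?_) (fun i ↦ ?_) i
    · simpa using S.right_mem i
    · simpa using S'.right_mem i
  left_le_right i := by
    refine Fin.addCases (fun i ↦ ?_) (fun i ↦ ?_) i
    · simpa using S.left_le_right i
    · simpa using S'.left_le_right i
  measurable_coef i := by
    refine Fin.addCases (fun i ↦ ?_) (fun i ↦ ?_) i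
    · rw [Fin.append_left, Fin.append_left]; exact S.measurable_coef i
    · rw [Fin.append_right, Fin.append_right]; exact S'.measurable_coef i
  bounded_coef i := by
    refine Fin.addCases (fun i ↦ ?_) (fun i ↦ ?_) i
    · simpa using S.bounded_coef i
    · simpa using S'.bounded_coef i

/-- The product of a simple process with a bounded random variable that is known at all times
of `D`. -/
def mul {ξ : Ω → ℝ} (hξ : ∀ a ∈ D, Measurable[𝓐 a] ξ) (hC : ∃ C : ℝ, ∀ ω, |ξ ω| ≤ C)
    (S : SimpleIntegrand 𝓐 D) : SimpleIntegrand 𝓐 D where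
  n := S.n
  left := S.left
  right := S.right
  coef i ω := ξ ω * S.coef i ω
  left_mem := S.left_mem
  right_mem := S.right_mem
  left_le_right := S.left_le_right
  measurable_coef i := (hξ _ (S.left_mem i)).mul (S.measurable_coef i)
  bounded_coef i := by
    obtain ⟨C, hC⟩ := hC
    obtain ⟨C', hC'⟩ := S.bounded_coef i
    refine ⟨C * C', fun ω ↦ ?_⟩
    rw [abs_mul]
    exact mul_le_mul (hC ω) (hC' ω) (abs_nonneg _) ((abs_nonneg _).trans (hC ω))

/-- Multiplication of a simple process by a constant. -/
def smul (c : ℝ) (S : SimpleIntegrand 𝓐 D) : SimpleIntegrand 𝓐 D :=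
  S.mul (ξ := fun _ ↦ c) (fun _ _ ↦ measurable_const) ⟨|c|, fun _ ↦ le_rfl⟩

/-- A simple process seen with a larger filtration and a larger time set. -/
def mono (hD : D ⊆ D') (h𝓐 : ∀ a ∈ D, 𝓐 a ≤ 𝓐' a) (S : SimpleIntegrand 𝓐 D) :
    SimpleIntegrand 𝓐' D' where
  n := S.n
  left := S.left
  right := S.right
  coef := S.coef
  left_mem i := hD (S.left_mem i)
  right_mem i := hD (S.right_mem i)
  left_le_right := S.left_le_right
  measurable_coef i := (S.measurable_coef i).mono (h𝓐 _ (S.left_mem i)) le_rfl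
  bounded_coef := S.bounded_coef

@[simp] lemma zero_eval (r : ℝ) (ω : Ω) : (zero 𝓐 D).eval r ω = 0 := by
  simp only [eval]; exact Finset.sum_eq_zero fun i ↦ i.elim0

@[simp] lemma single_eval {a b : ℝ} (ha : a ∈ D) (hb : b ∈ D) (hab : a ≤ b) {ξ : Ω → ℝ}
    (hξ : Measurable[𝓐 a] ξ) (hC : ∃ C : ℝ, ∀ ω, |ξ ω| ≤ C) (r : ℝ) (ω : Ω) :
    (single ha hb hab hξ hC).eval r ω = (Ioc a b).indicator (fun _ ↦ ξ ω) r := by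
  exact Fin.sum_univ_one _

@[simp] lemma add_eval (S S' : SimpleIntegrand 𝓐 D) (r : ℝ) (ω : Ω) :
    (S.add S').eval r ω = S.eval r ω + S'.eval r ω := by
  have h := Fin.sum_univ_add (fun i ↦
    (Ioc ((S.add S').left i) ((S.add S').right i)).indicator (fun _ ↦ (S.add S').coef i ω) r)
  refine h.trans ?_
  simp [eval, add]

@[simp] lemma add_integral (S S' : SimpleIntegrand 𝓐 D) (Z : ℝ → Ω → ℝ) (ω : Ω) :
    (S.add S').integral Z ω = S.integral Z ω + S'.integral Z ω := by
  have h := Fin.sum_univ_add (fun i ↦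
    (S.add S').coef i ω * (Z ((S.add S').right i) ω - Z ((S.add S').left i) ω))
  refine h.trans ?_
  simp [integral, add]

@[simp] lemma mul_eval {ξ : Ω → ℝ} (hξ : ∀ a ∈ D, Measurable[𝓐 a] ξ)
    (hC : ∃ C : ℝ, ∀ ω, |ξ ω| ≤ C) (S : SimpleIntegrand 𝓐 D) (r : ℝ) (ω : Ω) :
    (S.mul hξ hC).eval r ω = ξ ω * S.eval r ω := by
  simp only [eval, mul, Finset.mul_sum]
  refine Finset.sum_congr rfl fun i _ ↦ ?_
  by_cases h : r ∈ Ioc (S.left i) (S.right i) <;> simp [h]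

@[simp] lemma mul_integral {ξ : Ω → ℝ} (hξ : ∀ a ∈ D, Measurable[𝓐 a] ξ)
    (hC : ∃ C : ℝ, ∀ ω, |ξ ω| ≤ C) (S : SimpleIntegrand 𝓐 D) (Z : ℝ → Ω → ℝ) (ω : Ω) :
    (S.mul hξ hC).integral Z ω = ξ ω * S.integral Z ω := by
  simp only [integral, mul, Finset.mul_sum, mul_assoc]
  rfl

@[simp] lemma smul_eval (c : ℝ) (S : SimpleIntegrand 𝓐 D) (r : ℝ) (ω : Ω) :
    (S.smul c).eval r ω = c * S.eval r ω := mul_eval _ _ _ _ _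

@[simp] lemma smul_integral (c : ℝ) (S : SimpleIntegrand 𝓐 D) (Z : ℝ → Ω → ℝ) (ω : Ω) :
    (S.smul c).integral Z ω = c * S.integral Z ω := mul_integral _ _ _ _ _

@[simp] lemma mono_eval (hD : D ⊆ D') (h𝓐 : ∀ a ∈ D, 𝓐 a ≤ 𝓐' a) (S : SimpleIntegrand 𝓐 D)
    (r : ℝ) (ω : Ω) : (S.mono hD h𝓐).eval r ω = S.eval r ω := rfl

lemma Ioc_subset [D.OrdConnected] (S : SimpleIntegrand 𝓐 D) (i : Fin S.n) :
    Ioc (S.left i) (S.right i) ⊆ D :=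
  Ioc_subset_Icc_self.trans (Set.OrdConnected.out ‹_› (S.left_mem i) (S.right_mem i))

lemma eval_of_notMem [D.OrdConnected] (S : SimpleIntegrand 𝓐 D) {r : ℝ} (hr : r ∉ D) (ω : Ω) :
    S.eval r ω = 0 :=
  Finset.sum_eq_zero fun i _ ↦ indicator_of_notMem (fun h ↦ hr (S.Ioc_subset i h)) _

variable [mΩ : MeasurableSpace Ω]

lemma memLp_coef (h𝓐 : ∀ a ∈ D, 𝓐 a ≤ mΩ) {P : Measure Ω} [IsFiniteMeasure P]
    (S : SimpleIntegrand 𝓐 D) (i : Fin S.n) (p : ℝ≥0∞) : MemLp (S.coef i) p P := by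
  obtain ⟨C, hC⟩ := S.bounded_coef i
  exact MemLp.of_bound ((S.measurable_coef i).mono (h𝓐 _ (S.left_mem i)) le_rfl
    |>.aestronglyMeasurable) C (Eventually.of_forall hC)

lemma measurable_eval (h𝓐 : ∀ a ∈ D, 𝓐 a ≤ mΩ) (S : SimpleIntegrand 𝓐 D) :
    Measurable (fun p : ℝ × Ω ↦ S.eval p.1 p.2) := by
  unfold eval
  refine Finset.measurable_fun_sum _ fun i _ ↦ ?_
  have hm := (S.measurable_coef i).mono (h𝓐 _ (S.left_mem i)) le_rfl
  exact (hm.comp measurable_snd).indicator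
    (s := (Prod.fst : ℝ × Ω → ℝ) ⁻¹' Ioc (S.left i) (S.right i))
    (measurable_fst measurableSet_Ioc)

lemma memLp_eval (h𝓐 : ∀ a ∈ D, 𝓐 a ≤ mΩ) {P : Measure Ω} [IsFiniteMeasure P]
    (S : SimpleIntegrand 𝓐 D) :
    MemLp (fun p : ℝ × Ω ↦ S.eval p.1 p.2) 2 ((volume.restrict D).prod P) := by
  unfold eval
  refine memLp_finsetSum _ fun i _ ↦ ?_
  have hm := (S.measurable_coef i).mono (h𝓐 _ (S.left_mem i)) le_rfl
  obtain ⟨C, hC⟩ := S.bounded_coef i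
  have hms : MeasurableSet ((Prod.fst : ℝ × Ω → ℝ) ⁻¹' Ioc (S.left i) (S.right i)) :=
    measurable_fst measurableSet_Ioc
  have hfin : ((volume.restrict D).prod P)
      ((Prod.fst : ℝ × Ω → ℝ) ⁻¹' Ioc (S.left i) (S.right i)) ≠ ∞ := by
    rw [← prod_univ, Measure.prod_prod]
    refine ENNReal.mul_ne_top ?_ (measure_ne_top _ _)
    exact ((Measure.restrict_apply_le _ _).trans_lt measure_Ioc_lt_top).ne
  refine (memLp_indicator_const 2 hms C (Or.inr hfin)).mono
    (Measurable.aestronglyMeasurable ?_) (Eventually.of_forall fun p ↦ ?_)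
  · exact (hm.comp measurable_snd).indicator
      (s := (Prod.fst : ℝ × Ω → ℝ) ⁻¹' Ioc (S.left i) (S.right i)) hms
  · by_cases h : p.1 ∈ Ioc (S.left i) (S.right i)
    · simpa [indicator, mem_Ioc.1 h] using (hC p.2).trans (le_abs_self C)
    · rw [indicator_of_notMem h]; simp

end SimpleIntegrand

variable [mΩ : MeasurableSpace Ω] {B : ℝ → Ω → ℝ} {P : Measure Ω}

/-- The mean of a product of a past and a future variable factorizes. -/
lemma IsTwoSidedBrownian.integral_mul_of_history_future [IsProbabilityMeasure P] [P.IsComplete]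
    (hB : IsTwoSidedBrownian B P) {c : ℝ} {X Y : Ω → ℝ} (hX : Measurable[history B P c] X)
    (hY : Measurable[future B P c] Y) (hY' : AEStronglyMeasurable Y P) :
    ∫ ω, X ω * Y ω ∂P = (∫ ω, X ω ∂P) * ∫ ω, Y ω ∂P := by
  have h : IndepFun X Y P := by
    rw [IndepFun_iff_Indep]
    exact indep_of_indep_of_le_left (indep_of_indep_of_le_right (hB.indep_history_future c)
      (measurable_iff_comap_le.1 hY)) (measurable_iff_comap_le.1 hX)
  exact h.integral_mul_eq_mul_integral
    (hX.mono (hB.history_le c) le_rfl).aestronglyMeasurable hY'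

/-- The Itô isometry for two terms of a simple process, the first of which starts earlier. -/
lemma IsTwoSidedBrownian.integral_coef_mul_incr [IsProbabilityMeasure P] [P.IsComplete]
    (hB : IsTwoSidedBrownian B P) {a b c d : ℝ} (hac : a ≤ c) (hab : a ≤ b) (hcd : c ≤ d)
    {ζ : Ω → ℝ} (hζ : Measurable[history B P c] ζ) {C : ℝ} (hC : ∀ ω, |ζ ω| ≤ C) :
    ∫ ω, ζ ω * ((B b ω - B a ω) * (B d ω - B c ω)) ∂P =
      (∫ ω, ζ ω ∂P) * volume.real (Ioc a b ∩ Ioc c d) := by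
  have hζm := hζ.mono (hB.history_le c) le_rfl
  have hζ2 : ∀ u v, MemLp (fun ω ↦ ζ ω * (B v ω - B u ω)) 2 P := fun u v ↦ by
    refine (hB.memLp_incr u v).of_le_mul (c := C) (hζm.aestronglyMeasurable.mul
      (hB.memLp_incr u v).aestronglyMeasurable) (Eventually.of_forall fun ω ↦ ?_)
    rw [norm_mul]
    exact mul_le_mul_of_nonneg_right (hC ω) (norm_nonneg _)
  have key : ∀ e, a ≤ e → e ≤ c → ∫ ω, ζ ω * ((B e ω - B a ω) * (B d ω - B c ω)) ∂P = 0 := by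
    intro e _ he
    simp_rw [← mul_assoc]
    rw [hB.integral_mul_of_history_future (X := fun ω ↦ ζ ω * (B e ω - B a ω))
      (hζ.mul (measurable_history_sub hac he))
      (measurable_future_sub le_rfl hcd) (hB.memLp_incr c d).aestronglyMeasurable,
      hB.integral_incr, mul_zero]
  rw [Ioc_inter_Ioc, sup_eq_right.2 hac, Real.volume_real_Ioc]
  rcases le_total b c with hbc | hcb
  · rw [key b hab hbc, max_eq_right, mul_zero]
    have := inf_le_left (a := b) (b := d)
    linarith
  · have e : ∀ ω, ζ ω * ((B b ω - B a ω) * (B d ω - B c ω)) =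
        ζ ω * ((B b ω - B c ω) * (B d ω - B c ω)) +
        ζ ω * ((B c ω - B a ω) * (B d ω - B c ω)) := fun ω ↦ by ring
    have hi : ∀ u v, Integrable (fun ω ↦ ζ ω * ((B v ω - B u ω) * (B d ω - B c ω))) P :=
      fun u v ↦ by
        have : Integrable (fun ω ↦ ζ ω * (B v ω - B u ω) * (B d ω - B c ω)) P :=
          (hζ2 u v).integrable_mul (hB.memLp_incr c d)
        simpa only [mul_assoc] using this
    simp_rw [e]
    rw [integral_add (hi _ _) (hi _ _), key c hac le_rfl, add_zero,
      hB.integral_mul_of_history_future (Y := fun ω ↦ (B b ω - B c ω) * (B d ω - B c ω)) hζ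
        ((measurable_future_sub le_rfl hcb).mul (measurable_future_sub le_rfl hcd))
        ((hB.memLp_incr _ _).aestronglyMeasurable.mul (hB.memLp_incr _ _).aestronglyMeasurable),
      hB.integral_incr_mul_incr_of_left_eq hcb hcd, max_eq_left]
    have := le_inf hcb hcd
    linarith

lemma eLpNorm_two_eq {α : Type*} {m : MeasurableSpace α} {μ : Measure α} {f : α → ℝ}
    (hf : MemLp f 2 μ) : eLpNorm f 2 μ = ENNReal.ofReal (√(∫ x, f x ^ 2 ∂μ)) := by
  rw [hf.eLpNorm_eq_integral_rpow_norm two_ne_zero ENNReal.ofNat_ne_top, Real.sqrt_eq_rpow]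
  simp

namespace SimpleIntegrand

variable {D : Set ℝ}

lemma memLp_integral [IsProbabilityMeasure P] [P.IsComplete] (hB : IsTwoSidedBrownian B P)
    (S : SimpleIntegrand (history B P) D) : MemLp (S.integral B) 2 P := by
  unfold integral
  refine memLp_finsetSum _ fun i _ ↦ ?_
  obtain ⟨C, hC⟩ := S.bounded_coef i
  refine (hB.memLp_incr (S.left i) (S.right i)).of_le_mul (c := C)
    ((S.memLp_coef (fun a _ ↦ hB.history_le a) i 2).aestronglyMeasurable.mul
      (hB.memLp_incr _ _).aestronglyMeasurable) (Eventually.of_forall fun ω ↦ ?_)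
  rw [norm_mul]
  exact mul_le_mul_of_nonneg_right (hC ω) (norm_nonneg _)

lemma integral_integral [IsProbabilityMeasure P] [P.IsComplete] (hB : IsTwoSidedBrownian B P)
    (S : SimpleIntegrand (history B P) D) : ∫ ω, S.integral B ω ∂P = 0 := by
  unfold integral
  rw [integral_finsetSum]
  · refine Finset.sum_eq_zero fun i _ ↦ ?_
    rw [hB.integral_mul_of_history_future (S.measurable_coef i)
      (measurable_future_sub le_rfl (S.left_le_right i)) (hB.memLp_incr _ _).aestronglyMeasurable,
      hB.integral_incr, mul_zero]
  · intro i _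
    exact (S.memLp_coef (fun a _ ↦ hB.history_le a) i 2).integrable_mul (hB.memLp_incr _ _)

lemma integral_coef_mul_coef [IsProbabilityMeasure P] [P.IsComplete]
    (hB : IsTwoSidedBrownian B P) (S : SimpleIntegrand (history B P) D) (i j : Fin S.n) :
    ∫ ω, (S.coef i ω * (B (S.right i) ω - B (S.left i) ω)) *
      (S.coef j ω * (B (S.right j) ω - B (S.left j) ω)) ∂P =
    (∫ ω, S.coef i ω * S.coef j ω ∂P) *
      volume.real (Ioc (S.left i) (S.right i) ∩ Ioc (S.left j) (S.right j)) := by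
  wlog hij : S.left i ≤ S.left j generalizing i j
  · rw [inter_comm]
    simp_rw [mul_comm (S.coef i _) (S.coef j _)]
    rw [← this j i (le_of_not_ge hij)]
    simp_rw [mul_comm]
  obtain ⟨C, hC⟩ := S.bounded_coef i
  obtain ⟨C', hC'⟩ := S.bounded_coef j
  rw [← hB.integral_coef_mul_incr hij (S.left_le_right i) (S.left_le_right j)
    (ζ := fun ω ↦ S.coef i ω * S.coef j ω) (C := C * C')
    (((S.measurable_coef i).mono (history_mono B P hij) le_rfl).mul (S.measurable_coef j))]
  · congr 1; ext ω; ring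
  · intro ω
    rw [abs_mul]
    exact mul_le_mul (hC ω) (hC' ω) (abs_nonneg _) ((abs_nonneg _).trans (hC ω))

lemma integral_eval_sq [IsFiniteMeasure P] {𝓐 : ℝ → MeasurableSpace Ω}
    (h𝓐 : ∀ a ∈ D, 𝓐 a ≤ mΩ) [D.OrdConnected] (S : SimpleIntegrand 𝓐 D) :
    ∫ p, S.eval p.1 p.2 ^ 2 ∂((volume.restrict D).prod P) =
      ∑ i, ∑ j, (∫ ω, S.coef i ω * S.coef j ω ∂P) *
        volume.real (Ioc (S.left i) (S.right i) ∩ Ioc (S.left j) (S.right j)) := by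
  have e : ∀ p : ℝ × Ω, S.eval p.1 p.2 ^ 2 = ∑ i, ∑ j,
      (Ioc (S.left i) (S.right i) ∩ Ioc (S.left j) (S.right j)).indicator 1 p.1 *
        (S.coef i p.2 * S.coef j p.2) := by
    intro p
    rw [sq, eval, Finset.sum_mul_sum]
    refine Finset.sum_congr rfl fun i _ ↦ Finset.sum_congr rfl fun j _ ↦ ?_
    by_cases h : p.1 ∈ Ioc (S.left i) (S.right i) <;>
    by_cases h' : p.1 ∈ Ioc (S.left j) (S.right j) <;> simp [h, h', indicator]
  have hi : ∀ i j, Integrable (fun p : ℝ × Ω ↦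
      (Ioc (S.left i) (S.right i) ∩ Ioc (S.left j) (S.right j)).indicator (1 : ℝ → ℝ) p.1 *
        (S.coef i p.2 * S.coef j p.2)) ((volume.restrict D).prod P) := by
    intro i j
    refine Integrable.mul_prod (f := (Ioc (S.left i) (S.right i) ∩
      Ioc (S.left j) (S.right j)).indicator (1 : ℝ → ℝ))
      (g := fun ω ↦ S.coef i ω * S.coef j ω) ?_
      ((S.memLp_coef h𝓐 i 2).integrable_mul (S.memLp_coef h𝓐 j 2))
    rw [integrable_indicator_iff (measurableSet_Ioc.inter measurableSet_Ioc)]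
    refine integrableOn_const ?_ (by simp)
    exact ((measure_mono inter_subset_left).trans_lt
      ((Measure.restrict_apply_le _ _).trans_lt measure_Ioc_lt_top)).ne
  simp_rw [e]
  rw [integral_finsetSum _ fun i _ ↦ integrable_finsetSum _ fun j _ ↦ hi i j]
  refine Finset.sum_congr rfl fun i _ ↦ ?_
  rw [integral_finsetSum _ fun j _ ↦ hi i j]
  refine Finset.sum_congr rfl fun j _ ↦ ?_
  rw [integral_prod_mul (f := (Ioc (S.left i) (S.right i) ∩
      Ioc (S.left j) (S.right j)).indicator (1 : ℝ → ℝ))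
      (g := fun ω ↦ S.coef i ω * S.coef j ω), mul_comm,
      integral_indicator_one (measurableSet_Ioc.inter measurableSet_Ioc), measureReal_def,
      Measure.restrict_eq_self _ (inter_subset_left.trans (S.Ioc_subset i)), measureReal_def]

/-- The **Itô isometry** for simple processes. -/
lemma eLpNorm_integral [IsProbabilityMeasure P] [P.IsComplete] [D.OrdConnected]
    (hB : IsTwoSidedBrownian B P) (S : SimpleIntegrand (history B P) D) :
    eLpNorm (S.integral B) 2 P =
      eLpNorm (fun p : ℝ × Ω ↦ S.eval p.1 p.2) 2 ((volume.restrict D).prod P) := by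
  have h𝓐 : ∀ a ∈ D, history B P a ≤ mΩ := fun a _ ↦ hB.history_le a
  rw [eLpNorm_two_eq (S.memLp_integral hB), eLpNorm_two_eq (S.memLp_eval h𝓐),
    S.integral_eval_sq h𝓐]
  congr 2
  simp_rw [integral, sq, Finset.sum_mul_sum]
  have hm : ∀ i, MemLp (fun ω ↦ S.coef i ω * (B (S.right i) ω - B (S.left i) ω)) 2 P := by
    intro i
    obtain ⟨C, hC⟩ := S.bounded_coef i
    refine (hB.memLp_incr (S.left i) (S.right i)).of_le_mul (c := C)
      ((S.memLp_coef h𝓐 i 2).aestronglyMeasurable.mul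
        (hB.memLp_incr _ _).aestronglyMeasurable) (Eventually.of_forall fun ω ↦ ?_)
    rw [norm_mul]
    exact mul_le_mul_of_nonneg_right (hC ω) (norm_nonneg _)
  have hi : ∀ i j, Integrable (fun ω ↦ (S.coef i ω * (B (S.right i) ω - B (S.left i) ω)) *
      (S.coef j ω * (B (S.right j) ω - B (S.left j) ω))) P :=
    fun i j ↦ (hm i).integrable_mul (hm j)
  rw [integral_finsetSum _ fun i _ ↦ integrable_finsetSum _ fun j _ ↦ hi i j]
  refine Finset.sum_congr rfl fun i _ ↦ ?_
  rw [integral_finsetSum _ fun j _ ↦ hi i j]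
  exact Finset.sum_congr rfl fun j _ ↦ S.integral_coef_mul_coef hB i j

end SimpleIntegrand

end Simple

/-! ### Density of simple processes -/

section Density

variable {Ω : Type*} [mΩ : MeasurableSpace Ω]

/-- Dominated convergence in `L²`. -/
lemma tendsto_eLpNorm_two_of_dominated {α ι : Type*} {m : MeasurableSpace α} {μ : Measure α}
    {l : Filter ι} [l.IsCountablyGenerated] {F : ι → α → ℝ} {g : α → ℝ} (hg : MemLp g 2 μ)
    (hF : ∀ᶠ i in l, AEStronglyMeasurable (F i) μ) (hb : ∀ᶠ i in l, ∀ᵐ x ∂μ, |F i x| ≤ g x)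
    (hlim : ∀ᵐ x ∂μ, Tendsto (fun i ↦ F i x) l (𝓝 0)) :
    Tendsto (fun i ↦ eLpNorm (F i) 2 μ) l (𝓝 0) := by
  have h : Tendsto (fun i ↦ ∫⁻ x, ‖F i x‖ₑ ^ (2 : ℝ) ∂μ) l (𝓝 (∫⁻ _, 0 ∂μ)) := by
    refine tendsto_lintegral_filter_of_dominated_convergence' (fun x ↦ ‖g x‖ₑ ^ (2 : ℝ)) ?_ ?_
      ?_ ?_
    · filter_upwards [hF] with i hi using hi.enorm.pow_const _
    · filter_upwards [hb] with i hi
      filter_upwards [hi] with x hx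
      refine ENNReal.rpow_le_rpow ?_ zero_le_two
      exact enorm_le_iff_norm_le.2 (hx.trans (le_abs_self _))
    · exact (lintegral_rpow_enorm_lt_top_of_eLpNorm_lt_top two_ne_zero ENNReal.ofNat_ne_top
        hg.2).ne
    · filter_upwards [hlim] with x hx
      have h0 : Tendsto (fun i ↦ ‖F i x‖ₑ) l (𝓝 0) := by
        simpa [Function.comp_def] using (continuous_enorm.tendsto (0 : ℝ)).comp hx
      simpa [Function.comp_def] using
        (ENNReal.continuous_rpow_const (y := (2 : ℝ))).tendsto 0 |>.comp h0
  have h2 := ((ENNReal.continuous_rpow_const (y := (1 / 2 : ℝ))).tendsto _).comp h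
  simp only [lintegral_zero, one_div, inv_pos, Nat.ofNat_pos, ENNReal.zero_rpow_of_pos] at h2
  refine h2.congr fun i ↦ ?_
  rw [eLpNorm_eq_lintegral_rpow_enorm_toReal two_ne_zero ENNReal.ofNat_ne_top]
  simp

/-- The process `φ` belongs to the `L²(D × Ω)`-closure of the simple processes. -/
def Approximable (𝓐 : ℝ → MeasurableSpace Ω) (D : Set ℝ) (P : Measure Ω) (φ : ℝ × Ω → ℝ) : Prop :=
  ∀ ε : ℝ≥0∞, ε ≠ 0 → ∃ S : SimpleIntegrand 𝓐 D,
    eLpNorm (fun p ↦ S.eval p.1 p.2 - φ p) 2 ((volume.restrict D).prod P) ≤ ε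

variable {𝓐 : ℝ → MeasurableSpace Ω} {D : Set ℝ} {P : Measure Ω} {φ ψ : ℝ × Ω → ℝ}

lemma Approximable.exists_approximates {φ : ℝ → Ω → ℝ}
    (h : Approximable 𝓐 D P (fun p ↦ φ p.1 p.2)) :
    ∃ S : ℕ → SimpleIntegrand 𝓐 D, Approximates P S φ := by
  choose S hS using fun n : ℕ ↦ h ((n : ℝ≥0∞) + 1)⁻¹ (by simp)
  refine ⟨S, tendsto_of_tendsto_of_tendsto_of_le_of_le tendsto_const_nhds ?_
    (fun _ ↦ zero_le) hS⟩
  have := ENNReal.tendsto_inv_nat_nhds_zero.comp (tendsto_add_atTop_nat 1)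
  refine this.congr fun n ↦ ?_
  simp

lemma Approximable.congr (h : Approximable 𝓐 D P φ) (e : φ =ᵐ[(volume.restrict D).prod P] ψ) :
    Approximable 𝓐 D P ψ := by
  intro ε hε
  obtain ⟨S, hS⟩ := h ε hε
  refine ⟨S, (eLpNorm_congr_ae ?_).symm.le.trans hS⟩
  filter_upwards [e] with p hp
  rw [hp]

lemma Approximable.of_eval (S : SimpleIntegrand 𝓐 D) :
    Approximable 𝓐 D P (fun p ↦ S.eval p.1 p.2) :=
  fun ε _ ↦ ⟨S, by simp⟩

lemma Approximable.add (h𝓐 : ∀ a ∈ D, 𝓐 a ≤ mΩ)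
    (hφm : AEStronglyMeasurable φ ((volume.restrict D).prod P))
    (hψm : AEStronglyMeasurable ψ ((volume.restrict D).prod P))
    (h : Approximable 𝓐 D P φ) (h' : Approximable 𝓐 D P ψ) :
    Approximable 𝓐 D P (φ + ψ) := by
  intro ε hε
  obtain ⟨S, hS⟩ := h (ε / 2) (by simpa using hε)
  obtain ⟨S', hS'⟩ := h' (ε / 2) (by simpa using hε)
  refine ⟨S.add S', ?_⟩
  rw [← ENNReal.add_halves ε]
  refine le_trans (le_of_eq ?_) ((eLpNorm_add_le
    ((S.measurable_eval h𝓐).aestronglyMeasurable.sub hφm)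
    ((S'.measurable_eval h𝓐).aestronglyMeasurable.sub hψm) one_le_two).trans (add_le_add hS hS'))
  congr 1
  ext p
  simp only [SimpleIntegrand.add_eval, Pi.add_apply, Pi.sub_apply]
  ring

lemma Approximable.const_mul (c : ℝ) (h : Approximable 𝓐 D P φ) :
    Approximable 𝓐 D P (fun p ↦ c * φ p) := by
  intro ε hε
  obtain ⟨S, hS⟩ := h (ε / (‖c‖ₑ + 1)) (by simp [hε])
  refine ⟨S.smul c, ?_⟩
  have e : (fun p : ℝ × Ω ↦ (S.smul c).eval p.1 p.2 - c * φ p) =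
      c • fun p : ℝ × Ω ↦ S.eval p.1 p.2 - φ p := by
    ext p
    simp only [SimpleIntegrand.smul_eval, Pi.smul_apply, smul_eq_mul]
    ring
  rw [e, eLpNorm_const_smul]
  calc ‖c‖ₑ * _ ≤ (‖c‖ₑ + 1) * (ε / (‖c‖ₑ + 1)) := mul_le_mul' le_self_add hS
    _ = ε := ENNReal.mul_div_cancel (by simp) (by simp)

lemma Approximable.of_limit (h𝓐 : ∀ a ∈ D, 𝓐 a ≤ mΩ)
    (hφm : AEStronglyMeasurable φ ((volume.restrict D).prod P))
    (h : ∀ ε : ℝ≥0∞, ε ≠ 0 → ∃ ψ : ℝ × Ω → ℝ,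
      AEStronglyMeasurable ψ ((volume.restrict D).prod P) ∧ Approximable 𝓐 D P ψ ∧
      eLpNorm (ψ - φ) 2 ((volume.restrict D).prod P) ≤ ε) : Approximable 𝓐 D P φ := by
  intro ε hε
  obtain ⟨ψ, hψm, hψ, hle⟩ := h (ε / 2) (by simpa using hε)
  obtain ⟨S, hS⟩ := hψ (ε / 2) (by simpa using hε)
  refine ⟨S, ?_⟩
  rw [← ENNReal.add_halves ε]
  refine le_trans (le_of_eq ?_) ((eLpNorm_add_le
    ((S.measurable_eval h𝓐).aestronglyMeasurable.sub hψm)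
    (hψm.sub hφm) one_le_two).trans (add_le_add hS hle))
  congr 1
  ext p
  simp

lemma Approximable.of_tendsto (h𝓐 : ∀ a ∈ D, 𝓐 a ≤ mΩ)
    (hφm : AEStronglyMeasurable φ ((volume.restrict D).prod P)) {ψ : ℕ → ℝ × Ω → ℝ}
    (hψm : ∀ n, AEStronglyMeasurable (ψ n) ((volume.restrict D).prod P))
    (hψ : ∀ n, Approximable 𝓐 D P (ψ n))
    (hlim : Tendsto (fun n ↦ eLpNorm (ψ n - φ) 2 ((volume.restrict D).prod P)) atTop (𝓝 0)) :
    Approximable 𝓐 D P φ := by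
  refine .of_limit h𝓐 hφm fun ε hε ↦ ?_
  obtain ⟨n, hn⟩ := (hlim.eventually (gt_mem_nhds (pos_iff_ne_zero.2 hε))).exists
  exact ⟨ψ n, hψm n, hψ n, hn.le⟩

lemma measurable_indicator_one {α : Type*} {m : MeasurableSpace α} {E : Set α}
    (hE : MeasurableSet E) : Measurable (E.indicator (1 : α → ℝ)) :=
  measurable_one.indicator hE

lemma abs_indicator_sub_indicator_le {α : Type*} {S T W : Set α} (hS : S ⊆ W) (hT : T ⊆ W)
    (x : α) : |S.indicator (1 : α → ℝ) x - T.indicator 1 x| ≤ W.indicator (fun _ ↦ 1) x := by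
  have h0 : ∀ U : Set α, 0 ≤ U.indicator (1 : α → ℝ) x :=
    fun U ↦ indicator_nonneg (fun _ _ ↦ zero_le_one) x
  have h1 : ∀ U ⊆ W, U.indicator (1 : α → ℝ) x ≤ W.indicator (fun _ ↦ 1) x :=
    fun U hU ↦ indicator_le_indicator_of_subset hU (fun _ ↦ zero_le_one) x
  rw [abs_le]
  constructor <;> linarith [h0 S, h0 T, h1 S hS, h1 T hT]

/-- Indicators of measurable sets inside a bounded window are approximable: the sets with this
property form a `λ`-system that contains the rectangles `(a, b] × E`. -/
lemma approximable_indicator_window {Ω : Type*} {m mΩ : MeasurableSpace Ω}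
    {𝓐 : ℝ → MeasurableSpace Ω} {D : Set ℝ} {P : Measure Ω} [IsFiniteMeasure P] (hm : m ≤ mΩ)
    (hm𝓐 : ∀ a ∈ D, m ≤ 𝓐 a) (h𝓐 : ∀ a ∈ D, 𝓐 a ≤ mΩ) {c d : ℝ} (hcd : Icc c d ⊆ D)
    (A : Set (ℝ × Ω)) (hA : MeasurableSet[(borel ℝ).prod m] A) :
    Approximable 𝓐 D P ((A ∩ Ioc c d ×ˢ univ).indicator 1) := by
  have hle : (borel ℝ).prod m ≤ (borel ℝ).prod mΩ :=
    sup_le_sup le_rfl (MeasurableSpace.comap_mono hm)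
  have hW : MeasurableSet (Ioc c d ×ˢ (univ : Set Ω)) := measurableSet_Ioc.prod .univ
  have hWfin : ((volume.restrict D).prod P) (Ioc c d ×ˢ (univ : Set Ω)) ≠ ∞ := by
    rw [Measure.prod_prod]
    refine ENNReal.mul_ne_top ?_ (measure_ne_top _ _)
    exact ((Measure.restrict_apply_le _ _).trans_lt measure_Ioc_lt_top).ne
  have hrect : ∀ a b : ℝ, ∀ E : Set Ω, MeasurableSet[m] E →
      Approximable 𝓐 D P ((Ioc a b ×ˢ E ∩ Ioc c d ×ˢ univ).indicator 1) := by
    intro a b E hE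
    rw [prod_inter_prod, inter_univ, Ioc_inter_Ioc]
    rcases lt_or_ge (a ⊔ c) (b ⊓ d) with hlt | hge
    · have h1 : a ⊔ c ∈ Icc c d := ⟨le_sup_right, hlt.le.trans inf_le_right⟩
      have h2 : b ⊓ d ∈ Icc c d := ⟨le_sup_right.trans hlt.le, inf_le_right⟩
      refine (Approximable.of_eval (SimpleIntegrand.single (hcd h1) (hcd h2) hlt.le
        (ξ := E.indicator 1) (measurable_indicator_one (hm𝓐 _ (hcd h1) _ hE))
        ⟨1, fun ω ↦ ?_⟩)).congr (Eventually.of_forall fun p ↦ ?_)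
      · by_cases h : ω ∈ E <;> simp [h]
      · refine (SimpleIntegrand.single_eval _ _ _ _ _ _ _).trans ?_
        rw [← Prod.mk.eta (p := p), indicator_prod_one]
        by_cases h1 : p.1 ∈ Ioc (a ⊔ c) (b ⊓ d)
        · rw [indicator_of_mem h1, indicator_of_mem h1, Pi.one_apply, one_mul]
        · rw [indicator_of_notMem h1, indicator_of_notMem h1, zero_mul]
    · rw [Ioc_eq_empty (not_lt.2 hge), empty_prod]
      exact (Approximable.of_eval (SimpleIntegrand.zero 𝓐 D)).congr
        (Eventually.of_forall fun p ↦ by simp)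
  have hgen : (borel ℝ).prod m = MeasurableSpace.generateFrom
      (image2 (· ×ˢ ·) {S : Set ℝ | ∃ l u, l < u ∧ Ioc l u = S} {E | MeasurableSet[m] E}) := by
    refine (@generateFrom_eq_prod _ _ (borel ℝ) m _ _ (borel_eq_generateFrom_Ioc ℝ).symm
      (@MeasurableSpace.generateFrom_measurableSet _ m) ?_
      (@isCountablySpanning_measurableSet _ m)).symm
    refine ⟨fun n : ℕ ↦ Ioc (-(n : ℝ) - 1) (n + 1), fun n ↦ ⟨_, _, ?_, rfl⟩, ?_⟩
    · have : (0 : ℝ) ≤ n := n.cast_nonneg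
      linarith
    · refine eq_univ_of_forall fun x ↦ mem_iUnion.2 ?_
      obtain ⟨n, hn⟩ := exists_nat_gt |x|
      have := abs_lt.1 hn
      exact ⟨n, by constructor <;> linarith⟩
  have hpi : IsPiSystem (image2 (· ×ˢ ·) {S : Set ℝ | ∃ l u, l < u ∧ Ioc l u = S}
      {E : Set Ω | MeasurableSet[m] E}) :=
    (isPiSystem_Ioc id id).prod (fun _ hs _ ht _ ↦ @MeasurableSet.inter _ m _ _ hs ht)
  have hms : ∀ A : Set (ℝ × Ω), MeasurableSet[(borel ℝ).prod m] A →
      AEStronglyMeasurable ((A ∩ Ioc c d ×ˢ univ).indicator (1 : ℝ × Ω → ℝ))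
        ((volume.restrict D).prod P) := fun A hA ↦
    (measurable_one.indicator ((hle _ hA).inter hW)).aestronglyMeasurable
  refine MeasurableSpace.induction_on_inter
    (C := fun A _ ↦ Approximable 𝓐 D P ((A ∩ Ioc c d ×ˢ univ).indicator 1)) hgen hpi
    ?_ ?_ ?_ ?_ A hA
  · simpa using hrect c c ∅ (@MeasurableSet.empty _ m)
  · intro A hA
    obtain ⟨_, ⟨l, u, _, rfl⟩, E, hE, rfl⟩ := hA
    exact hrect l u E hE
  · intro A hA ih
    have h1 := hrect c d univ (@MeasurableSet.univ _ m)
    rw [inter_self] at h1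
    have h2 := h1.add h𝓐 ((measurable_one.indicator hW).aestronglyMeasurable)
      ((hms A hA).const_mul (-1)) (ih.const_mul (-1))
    refine h2.congr (Eventually.of_forall fun p ↦ ?_)
    rw [inter_comm A, inter_comm Aᶜ, ← indicator_indicator, ← indicator_indicator]
    by_cases h2 : p ∈ Ioc c d ×ˢ (univ : Set Ω)
    · simp only [Pi.add_apply, indicator_of_mem h2]
      by_cases h1 : p ∈ A
      · rw [indicator_of_mem h1, indicator_of_notMem (notMem_compl_iff.2 h1)]; simp
      · rw [indicator_of_notMem h1, indicator_of_mem (mem_compl h1)]; simp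
    · simp only [Pi.add_apply, indicator_of_notMem h2]; simp
  · intro f hdisj hf ih
    have hpart : ∀ n : ℕ, AEStronglyMeasurable
        (∑ i ∈ Finset.range n, (f i ∩ Ioc c d ×ˢ univ).indicator (1 : ℝ × Ω → ℝ))
        ((volume.restrict D).prod P) ∧ Approximable 𝓐 D P
        (∑ i ∈ Finset.range n, (f i ∩ Ioc c d ×ˢ univ).indicator 1) := by
      intro n
      induction n with
      | zero =>
        simp only [Finset.range_zero, Finset.sum_empty]
        exact ⟨aestronglyMeasurable_zero, (Approximable.of_eval (SimpleIntegrand.zero 𝓐 D)).congr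
          (Eventually.of_forall fun p ↦ by simp)⟩
      | succ n ihn =>
        rw [Finset.sum_range_succ]
        exact ⟨ihn.1.add (hms _ (hf n)), ihn.2.add h𝓐 ihn.1 (hms _ (hf n)) (ih n)⟩
    -- the partial sums of a disjoint union agree with the indicator of the union from some
    -- index on
    have hsum : ∀ (p : ℝ × Ω) (n : ℕ),
        (∑ i ∈ Finset.range n, (f i ∩ Ioc c d ×ˢ univ).indicator (1 : ℝ × Ω → ℝ)) p =
        ((⋃ i ∈ Finset.range n, f i) ∩ Ioc c d ×ˢ univ).indicator 1 p := by
      intro p n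
      rw [iUnion₂_inter, Finset.sum_apply]
      exact (Finset.indicator_biUnion_apply (Finset.range n) (fun i ↦ f i ∩ Ioc c d ×ˢ univ)
        (fun i _ j _ hij ↦ (hdisj hij).mono inter_subset_left inter_subset_left) p).symm
    have hU := hms _ (@MeasurableSet.iUnion _ _ ((borel ℝ).prod m) _ _ hf)
    refine .of_tendsto h𝓐 hU (fun n ↦ (hpart n).1)
      (fun n ↦ (hpart n).2) ?_
    refine tendsto_eLpNorm_two_of_dominated
      (g := (Ioc c d ×ˢ (univ : Set Ω)).indicator fun _ ↦ (1 : ℝ))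
      (memLp_indicator_const 2 hW _ (Or.inr hWfin))
      (Eventually.of_forall fun n ↦ (hpart n).1.sub hU)
      (Eventually.of_forall fun n ↦ Eventually.of_forall fun p ↦ ?_)
      (Eventually.of_forall fun p ↦ ?_)
    · rw [Pi.sub_apply, hsum]
      exact abs_indicator_sub_indicator_le inter_subset_right inter_subset_right p
    · by_cases hp : ∃ i, p ∈ f i
      · obtain ⟨i, hi⟩ := hp
        refine tendsto_const_nhds.congr' ?_
        filter_upwards [eventually_gt_atTop i] with n hn
        rw [Pi.sub_apply, hsum]
        have h1 : p ∈ ⋃ i ∈ Finset.range n, f i :=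
          mem_iUnion₂.2 ⟨i, Finset.mem_range.2 hn, hi⟩
        have h2 : p ∈ ⋃ i, f i := mem_iUnion.2 ⟨i, hi⟩
        rw [inter_comm, inter_comm (⋃ i, f i), ← indicator_indicator, ← indicator_indicator]
        simp only [indicator, h1, h2, if_true, sub_self]
      · refine tendsto_const_nhds.congr fun n ↦ ?_
        rw [Pi.sub_apply, hsum]
        push Not at hp
        have h1 : p ∉ ⋃ i ∈ Finset.range n, f i := by simpa using fun i _ ↦ hp i
        have h2 : p ∉ ⋃ i, f i := by simpa using hp
        rw [indicator_of_notMem (fun h ↦ h1 h.1), indicator_of_notMem (fun h ↦ h2 h.1), sub_self]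

/-- The time set `D` is, up to a null set, an increasing union of bounded intervals with endpoints
in `D`. -/
def Exhausted (D : Set ℝ) : Prop :=
  ∃ c d : ℕ → ℝ, (∀ n, Icc (c n) (d n) ⊆ D) ∧
    ∀ᵐ r ∂volume.restrict D, ∀ᶠ n in atTop, r ∈ Ioc (c n) (d n)

lemma exhausted_Icc (a b : ℝ) : Exhausted (Icc a b) := by
  refine ⟨fun _ ↦ a, fun _ ↦ b, fun _ ↦ subset_rfl, ?_⟩
  rw [← restrict_Ioc_eq_restrict_Icc]
  filter_upwards [ae_restrict_mem measurableSet_Ioc] with r hr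
  exact Eventually.of_forall fun _ ↦ hr

lemma exhausted_Iic (s : ℝ) : Exhausted (Iic s) := by
  refine ⟨fun n ↦ s - n, fun _ ↦ s, fun _ ↦ Icc_subset_Iic_self, ?_⟩
  filter_upwards [ae_restrict_mem measurableSet_Iic] with r hr
  obtain ⟨N, hN⟩ := exists_nat_gt (s - r)
  filter_upwards [eventually_ge_atTop N] with n hn
  have : (N : ℝ) ≤ n := by exact_mod_cast hn
  exact ⟨by linarith, hr⟩

lemma exhausted_univ : Exhausted univ := by
  refine ⟨fun n ↦ -n, fun n ↦ n, fun _ ↦ subset_univ _, Eventually.of_forall fun r ↦ ?_⟩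
  obtain ⟨N, hN⟩ := exists_nat_gt |r|
  filter_upwards [eventually_ge_atTop N] with n hn
  have : (N : ℝ) ≤ n := by exact_mod_cast hn
  have := abs_lt.1 hN
  constructor <;> linarith

/-- A square integrable process that is jointly measurable with respect to a `σ`-algebra known at
all times of `D` is an `L²`-limit of simple processes. -/
theorem approximable_of_memLp {Ω : Type*} {m mΩ : MeasurableSpace Ω}
    {𝓐 : ℝ → MeasurableSpace Ω} {D : Set ℝ} {P : Measure Ω} [IsFiniteMeasure P]
    {φ : ℝ × Ω → ℝ} (hm : m ≤ mΩ)
    (hm𝓐 : ∀ a ∈ D, m ≤ 𝓐 a) (h𝓐 : ∀ a ∈ D, 𝓐 a ≤ mΩ) (hD : Exhausted D)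
    (hφ : MemLp φ 2 ((volume.restrict D).prod P))
    (hφm : AEStronglyMeasurable[(borel ℝ).prod m] φ ((volume.restrict D).prod P)) :
    Approximable 𝓐 D P φ := by
  have hle : (borel ℝ).prod m ≤ (borel ℝ).prod mΩ :=
    sup_le_sup le_rfl (MeasurableSpace.comap_mono hm)
  refine MemLp.induction_stronglyMeasurable hle ENNReal.ofNat_ne_top (Approximable 𝓐 D P)
    ?_ ?_ ?_ ?_ hφ hφm
  · intro x A hA hfin
    obtain ⟨c, d, hcd, hev⟩ := hD
    have hW : ∀ n, MeasurableSet (Ioc (c n) (d n) ×ˢ (univ : Set Ω)) :=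
      fun n ↦ measurableSet_Ioc.prod .univ
    have hms : AEStronglyMeasurable (A.indicator (1 : ℝ × Ω → ℝ)) ((volume.restrict D).prod P) :=
      (measurable_one.indicator (hle _ hA)).aestronglyMeasurable
    have hms' : ∀ n, AEStronglyMeasurable
        ((A ∩ Ioc (c n) (d n) ×ˢ univ).indicator (1 : ℝ × Ω → ℝ)) ((volume.restrict D).prod P) :=
      fun n ↦ (measurable_one.indicator ((hle _ hA).inter (hW n))).aestronglyMeasurable
    have h1 : Approximable 𝓐 D P (A.indicator 1) := by
      refine .of_tendsto h𝓐 hms hms'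
        (fun n ↦ approximable_indicator_window hm hm𝓐 h𝓐 (hcd n) A hA) ?_
      refine tendsto_eLpNorm_two_of_dominated (g := A.indicator fun _ ↦ (1 : ℝ))
        (memLp_indicator_const 2 (hle _ hA) _ (Or.inr hfin.ne))
        (Eventually.of_forall fun n ↦ (hms' n).sub hms)
        (Eventually.of_forall fun n ↦ Eventually.of_forall fun p ↦ ?_) ?_
      · exact abs_indicator_sub_indicator_le inter_subset_left subset_rfl p
      · have hev' := Measure.quasiMeasurePreserving_fst (μ := volume.restrict D) (ν := P) |>.ae hev
        filter_upwards [hev'] with p hp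
        refine tendsto_const_nhds.congr' ?_
        filter_upwards [hp] with n hn
        have h2 : p ∈ Ioc (c n) (d n) ×ˢ (univ : Set Ω) := ⟨hn, mem_univ _⟩
        by_cases hA : p ∈ A
        · rw [Pi.sub_apply, indicator_of_mem (mem_inter hA h2), indicator_of_mem hA, sub_self]
        · rw [Pi.sub_apply, indicator_of_notMem (fun h ↦ hA h.1), indicator_of_notMem hA, sub_self]
    refine (h1.const_mul x).congr (Eventually.of_forall fun p ↦ ?_)
    by_cases h : p ∈ A <;> simp [h]
  · intro f g _ hf hg _ _ hf' hg'
    exact hf'.add h𝓐 hf.1 hg.1 hg'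
  · refine isClosed_of_closure_subset fun f hf ↦ ?_
    refine .of_limit h𝓐 (Lp.memLp (f : Lp ℝ 2 ((volume.restrict D).prod P))).1 fun ε hε ↦ ?_
    obtain ⟨g, hg, hgf⟩ := EMetric.mem_closure_iff.1 hf ε (pos_iff_ne_zero.2 hε)
    refine ⟨_, (Lp.memLp (g : Lp ℝ 2 ((volume.restrict D).prod P))).1, hg, ?_⟩
    rw [edist_comm, Subtype.edist_eq, Lp.edist_def] at hgf
    exact hgf.le
  · intro f g e _ hf
    exact hf.congr e

end Density

/-! ### Limits in `L²` -/

section Limits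

variable {Ω : Type*} [mΩ : MeasurableSpace Ω] {P : Measure Ω}

lemma tendsto_eLpNorm_of_tendsto_sub {α : Type*} {m : MeasurableSpace α} {μ : Measure α}
    {F : ℕ → α → ℝ} {f : α → ℝ} (hF : ∀ n, MemLp (F n) 2 μ) (hf : MemLp f 2 μ)
    (h : Tendsto (fun n ↦ eLpNorm (fun x ↦ F n x - f x) 2 μ) atTop (𝓝 0)) :
    Tendsto (fun n ↦ eLpNorm (F n) 2 μ) atTop (𝓝 (eLpNorm f 2 μ)) := by
  have h1 := ((Lp.tendsto_Lp_iff_tendsto_eLpNorm'' F hF f hf).2 h).enorm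
  simpa only [Lp.enorm_toLp] using h1

lemma tendsto_eLpNorm_add_zero {α : Type*} {m : MeasurableSpace α} {μ : Measure α}
    {F G : ℕ → α → ℝ} (hF : ∀ n, AEStronglyMeasurable (F n) μ)
    (hG : ∀ n, AEStronglyMeasurable (G n) μ)
    (h : Tendsto (fun n ↦ eLpNorm (F n) 2 μ) atTop (𝓝 0))
    (h' : Tendsto (fun n ↦ eLpNorm (G n) 2 μ) atTop (𝓝 0)) :
    Tendsto (fun n ↦ eLpNorm (fun x ↦ F n x + G n x) 2 μ) atTop (𝓝 0) := by
  have h2 := h.add h'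
  rw [add_zero] at h2
  exact tendsto_of_tendsto_of_tendsto_of_le_of_le tendsto_const_nhds h2 (fun _ ↦ zero_le)
    fun n ↦ eLpNorm_add_le (hF n) (hG n) one_le_two

/-- Limits in `L²` are measurable with respect to an augmented `σ`-algebra, without passing to
another version. -/
lemma measurable_of_tendsto_eLpNorm {Ω : Type*} {m mΩ : MeasurableSpace Ω} {P : Measure Ω}
    [P.IsComplete] (hm : m ≤ mΩ)
    {X : ℕ → Ω → ℝ} {Y : Ω → ℝ} (hX : ∀ n, Measurable[eventuallyMeasurableSpace m (ae P)] (X n))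
    (hY : AEStronglyMeasurable Y P)
    (h : Tendsto (fun n ↦ eLpNorm (fun ω ↦ X n ω - Y ω) 2 P) atTop (𝓝 0)) :
    Measurable[eventuallyMeasurableSpace m (ae P)] Y := by
  have hle := eventuallyMeasurableSpace_ae_le (P := P) hm
  obtain ⟨ns, -, hns⟩ := (tendstoInMeasure_of_tendsto_eLpNorm two_ne_zero
    (fun n ↦ ((hX n).mono hle le_rfl).aestronglyMeasurable) hY h).exists_seq_tendsto_ae
  have hl : Measurable[eventuallyMeasurableSpace m (ae P)]
      (fun ω ↦ limsup (fun k ↦ X (ns k) ω) atTop) :=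
    @Measurable.limsup ℝ Ω _ _ _ (eventuallyMeasurableSpace m (ae P)) _ _ _ _
      (fun k ↦ hX (ns k))
  have he : Y =ᵐ[P] fun ω ↦ limsup (fun k ↦ X (ns k) ω) atTop := by
    filter_upwards [hns] with ω hω using hω.limsup_eq.symm
  intro C hC
  obtain ⟨A, hA, hA'⟩ := hl hC
  exact ⟨A, hA, (he.preimage C).trans hA'⟩

/-- Centred Gaussian variables are closed under limits in `L²`. -/
lemma hasGaussianLaw_of_tendsto_eLpNorm [IsProbabilityMeasure P] {X : ℕ → Ω → ℝ} {Y : Ω → ℝ}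
    (hX : ∀ n, HasGaussianLaw (X n) P) (hX0 : ∀ n, ∫ ω, X n ω ∂P = 0) (hY : MemLp Y 2 P)
    (h : Tendsto (fun n ↦ eLpNorm (fun ω ↦ X n ω - Y ω) 2 P) atTop (𝓝 0)) :
    HasGaussianLaw Y P := by
  have hv := tendsto_eLpNorm_of_tendsto_sub (fun n ↦ (hX n).memLp_two) hY h
  obtain ⟨ns, hmono, hns⟩ := (tendstoInMeasure_of_tendsto_eLpNorm two_ne_zero
    (fun n ↦ (hX n).memLp_two.1) hY.1 h).exists_seq_tendsto_ae
  have hvar : ∀ n, Var[X n; P] = (eLpNorm (X n) 2 P).toReal ^ 2 := fun n ↦ by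
    rw [variance_of_integral_eq_zero (hX n).aemeasurable (hX0 n), eLpNorm_two_eq (hX n).memLp_two,
      ENNReal.toReal_ofReal (Real.sqrt_nonneg _),
      Real.sq_sqrt (integral_nonneg fun _ ↦ sq_nonneg _)]
  have hlaw : P.map Y = gaussianReal 0 ((eLpNorm Y 2 P).toReal ^ 2).toNNReal := by
    have : IsProbabilityMeasure (P.map Y) :=
      Measure.isProbabilityMeasure_map hY.1.aemeasurable
    refine Measure.ext_of_charFun (funext fun t ↦ ?_)
    have h1 : Tendsto (fun k ↦ charFun (P.map (X (ns k))) t) atTop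
        (𝓝 (charFun (P.map Y) t)) := by
      have e : ∀ Z : Ω → ℝ, AEMeasurable Z P →
          charFun (P.map Z) t = ∫ ω, Complex.exp (t * Z ω * Complex.I) ∂P := fun Z hZ ↦ by
        rw [charFun_apply_real, integral_map hZ (by fun_prop)]
      rw [e Y hY.1.aemeasurable]
      simp_rw [fun k ↦ e _ (hX (ns k)).aemeasurable]
      refine tendsto_integral_of_dominated_convergence (fun _ ↦ 1) (fun k ↦ ?_)
        (integrable_const _) (fun k ↦ Eventually.of_forall fun ω ↦ ?_) ?_
      · have := (hX (ns k)).aemeasurable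
        exact (by fun_prop : AEMeasurable _ P).aestronglyMeasurable
      · have := Complex.norm_exp_ofReal_mul_I (t * X (ns k) ω)
        push_cast at this
        exact this.le
      · filter_upwards [hns] with ω hω
        have hc : Continuous fun x : ℝ ↦ Complex.exp (t * x * Complex.I) := by fun_prop
        exact (hc.tendsto _).comp hω
    refine tendsto_nhds_unique h1 ?_
    have hc : Tendsto (fun k ↦ (eLpNorm (X (ns k)) 2 P).toReal ^ 2) atTop
        (𝓝 ((eLpNorm Y 2 P).toReal ^ 2)) :=
      (((ENNReal.tendsto_toReal hY.2.ne).comp (hv.comp hmono.tendsto_atTop))).pow 2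
    simp_rw [fun k ↦ (hX (ns k)).map_eq_gaussianReal, hX0, charFun_gaussianReal, hvar,
      Real.coe_toNNReal _ (sq_nonneg _)]
    have hc' : Continuous fun x : ℝ ↦ Complex.exp (t * (0 : ℝ) * Complex.I - x * t ^ 2 / 2) := by
      fun_prop
    exact (hc'.tendsto _).comp hc
  constructor
  rw [hlaw]
  infer_instance

end Limits

/-! ### The Itô integral -/

section Ito

variable {Ω : Type*} [mΩ : MeasurableSpace Ω] {B : ℝ → Ω → ℝ} {P : Measure Ω}
  {D D' : Set ℝ} {φ ψ : ℝ → Ω → ℝ} {X Y : Ω → ℝ}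

/-- `X` is the Itô integral `∫_D φ dB`. -/
abbrev IsItoIntegral (B : ℝ → Ω → ℝ) (P : Measure Ω) (D : Set ℝ) (φ : ℝ → Ω → ℝ) (X : Ω → ℝ) :
    Prop := IsStochIntegral B (history B P) P D φ X

lemma StochIntegrable.isStochIntegral {Z : ℝ → Ω → ℝ} {𝓐 : ℝ → MeasurableSpace Ω}
    (h : StochIntegrable Z 𝓐 P D φ) :
    IsStochIntegral Z 𝓐 P D φ (stochIntegral Z 𝓐 P D φ) := by
  rw [stochIntegral, dif_pos h]
  exact h.choose_spec

lemma ItoIntegrable.isItoIntegral (h : ItoIntegrable B P D φ) :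
    IsItoIntegral B P D φ (itoIntegral B P D φ) := StochIntegrable.isStochIntegral h

lemma memLp_itoIntegral : MemLp (itoIntegral B P D φ) 2 P := by
  by_cases h : StochIntegrable B (history B P) P D φ
  · exact h.isStochIntegral.memLp_integral
  · rw [itoIntegral, stochIntegral, dif_neg h]
    exact MemLp.zero

lemma SimpleIntegrand.memLp_integral_of {𝓐 : ℝ → MeasurableSpace Ω} [IsFiniteMeasure P]
    (h𝓐 : ∀ a ∈ D, 𝓐 a ≤ mΩ) {Z : ℝ → Ω → ℝ} (hZ : ∀ t, MemLp (Z t) 2 P)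
    (S : SimpleIntegrand 𝓐 D) : MemLp (S.integral Z) 2 P := by
  unfold SimpleIntegrand.integral
  refine memLp_finsetSum _ fun i _ ↦ ?_
  obtain ⟨C, hC⟩ := S.bounded_coef i
  have hd := (hZ (S.right i)).sub (hZ (S.left i))
  refine hd.of_le_mul (c := C) ((S.memLp_coef h𝓐 i 2).aestronglyMeasurable.mul
    hd.aestronglyMeasurable) (Eventually.of_forall fun ω ↦ ?_)
  rw [norm_mul]
  exact mul_le_mul_of_nonneg_right (hC ω) (norm_nonneg _)

/-- Stochastic integrals are unique up to null sets. -/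
lemma IsStochIntegral.ae_eq [IsFiniteMeasure P] {𝓐 : ℝ → MeasurableSpace Ω}
    (h𝓐 : ∀ a ∈ D, 𝓐 a ≤ mΩ) {Z : ℝ → Ω → ℝ} (hZ : ∀ t, MemLp (Z t) 2 P)
    (hX : IsStochIntegral Z 𝓐 P D φ X) (hY : IsStochIntegral Z 𝓐 P D φ Y) : X =ᵐ[P] Y := by
  obtain ⟨S, hS⟩ := hX.exists_approx
  have hm : ∀ n, MemLp ((S n).integral Z) 2 P := fun n ↦ (S n).memLp_integral_of h𝓐 hZ
  have h1 := (Lp.tendsto_Lp_iff_tendsto_eLpNorm'' _ hm X hX.memLp_integral).2 (hX.tendsto S hS)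
  have h2 := (Lp.tendsto_Lp_iff_tendsto_eLpNorm'' _ hm Y hY.memLp_integral).2 (hY.tendsto S hS)
  exact (MemLp.toLp_eq_toLp_iff _ _).1 (tendsto_nhds_unique h1 h2)

lemma Approximates.tendsto_sub [IsFiniteMeasure P] {𝓐 : ℝ → MeasurableSpace Ω}
    (h𝓐 : ∀ a ∈ D, 𝓐 a ≤ mΩ)
    (hφ : AEStronglyMeasurable (fun p : ℝ × Ω ↦ φ p.1 p.2) ((volume.restrict D).prod P))
    {S S' : ℕ → SimpleIntegrand 𝓐 D} (hS : Approximates P S φ) (hS' : Approximates P S' φ) :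
    Tendsto (fun n ↦ eLpNorm (fun p : ℝ × Ω ↦ (S n).eval p.1 p.2 - (S' n).eval p.1 p.2) 2
      ((volume.restrict D).prod P)) atTop (𝓝 0) := by
  have h1 : Tendsto (fun n ↦ eLpNorm (fun p : ℝ × Ω ↦ φ p.1 p.2 - (S' n).eval p.1 p.2) 2
      ((volume.restrict D).prod P)) atTop (𝓝 0) := by
    refine Tendsto.congr (fun n ↦ ?_) hS'
    exact eLpNorm_sub_comm _ _ _ _
  refine Tendsto.congr (fun n ↦ ?_) (tendsto_eLpNorm_add_zero
    (fun n ↦ ((S n).measurable_eval h𝓐).aestronglyMeasurable.sub hφ)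
    (fun n ↦ hφ.sub ((S' n).measurable_eval h𝓐).aestronglyMeasurable) hS h1)
  congr 1
  ext p
  simp

lemma IsItoIntegral.congr (hX : IsItoIntegral B P D φ X)
    (hφ : ∀ᵐ p : ℝ × Ω ∂(volume.restrict D).prod P, φ p.1 p.2 = ψ p.1 p.2) (hXY : X =ᵐ[P] Y) :
    IsItoIntegral B P D ψ Y := by
  have h : ∀ S : ℕ → SimpleIntegrand (history B P) D, Approximates P S φ ↔ Approximates P S ψ := by
    intro S
    refine tendsto_congr fun n ↦ eLpNorm_congr_ae ?_
    filter_upwards [hφ] with p hp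
    rw [hp]
  refine ⟨hX.memLp_integrand.ae_eq hφ, hX.memLp_integral.ae_eq hXY,
    hX.exists_approx.imp fun S hS ↦ (h S).1 hS, fun S hS ↦ ?_⟩
  refine (hX.tendsto S ((h S).2 hS)).congr fun n ↦ eLpNorm_congr_ae ?_
  filter_upwards [hXY] with ω hω
  rw [hω]

lemma tendsto_eLpNorm_mul_zero {α : Type*} {m : MeasurableSpace α} {μ : Measure α}
    {F : ℕ → α → ℝ} {ξ : α → ℝ} {C : ℝ} (hC : ∀ x, |ξ x| ≤ C)
    (h : Tendsto (fun n ↦ eLpNorm (F n) 2 μ) atTop (𝓝 0)) :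
    Tendsto (fun n ↦ eLpNorm (fun x ↦ ξ x * F n x) 2 μ) atTop (𝓝 0) := by
  have h2 := ENNReal.Tendsto.const_mul (a := ENNReal.ofReal C) h (Or.inr ENNReal.ofReal_ne_top)
  rw [mul_zero] at h2
  refine tendsto_of_tendsto_of_tendsto_of_le_of_le tendsto_const_nhds h2 (fun _ ↦ zero_le)
    fun n ↦ ?_
  refine eLpNorm_le_mul_eLpNorm_of_ae_le_mul (Eventually.of_forall fun x ↦ ?_) 2
  rw [norm_mul]
  exact mul_le_mul_of_nonneg_right (hC x) (norm_nonneg _)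

lemma IsItoIntegral.measurable_history [P.IsComplete] (hB : IsTwoSidedBrownian B P) {t : ℝ}
    (hD : D ⊆ Iic t) (hX : IsItoIntegral B P D φ X) : Measurable[history B P t] X := by
  obtain ⟨S, hS⟩ := hX.exists_approx
  refine measurable_of_tendsto_eLpNorm (mΩ := mΩ) (iSup₂_le fun q r ↦ ?_) (fun n ↦ ?_)
    hX.memLp_integral.1 (hX.tendsto S hS)
  · rw [← BorelSpace.measurable_eq (α := ℝ), ← measurable_iff_comap_le]
    exact (hB.measurable _).sub (hB.measurable _)
  · unfold SimpleIntegrand.integral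
    refine Finset.measurable_fun_sum _ fun i _ ↦ ?_
    exact (((S n).measurable_coef i).mono (history_mono B P (hD ((S n).left_mem i))) le_rfl).mul
      (measurable_history_sub (hD ((S n).left_mem i)) (hD ((S n).right_mem i)))

variable [IsProbabilityMeasure P] [P.IsComplete]

lemma IsItoIntegral.ae_eq (hB : IsTwoSidedBrownian B P)
    (hX : IsItoIntegral B P D φ X) (hY : IsItoIntegral B P D φ Y) : X =ᵐ[P] Y := by
  obtain ⟨S, hS⟩ := hX.exists_approx
  have hm : ∀ n, MemLp ((S n).integral B) 2 P := fun n ↦ (S n).memLp_integral hB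
  have h1 := (Lp.tendsto_Lp_iff_tendsto_eLpNorm'' _ hm X hX.memLp_integral).2 (hX.tendsto S hS)
  have h2 := (Lp.tendsto_Lp_iff_tendsto_eLpNorm'' _ hm Y hY.memLp_integral).2 (hY.tendsto S hS)
  exact (MemLp.toLp_eq_toLp_iff _ _).1 (tendsto_nhds_unique h1 h2)

/-- The Itô isometry for the difference of two simple processes. -/
lemma eLpNorm_integral_sub [D.OrdConnected] (hB : IsTwoSidedBrownian B P)
    (S S' : SimpleIntegrand (history B P) D) :
    eLpNorm (fun ω ↦ S.integral B ω - S'.integral B ω) 2 P =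
      eLpNorm (fun p : ℝ × Ω ↦ S.eval p.1 p.2 - S'.eval p.1 p.2) 2
        ((volume.restrict D).prod P) := by
  have h := (S.add (S'.smul (-1))).eLpNorm_integral hB
  convert h using 2
  · ext ω; simp [sub_eq_add_neg]
  · ext p; simp [sub_eq_add_neg]

/-- By the isometry, it is enough to find the limit along one approximating sequence. -/
lemma IsItoIntegral.of_tendsto [D.OrdConnected] (hB : IsTwoSidedBrownian B P)
    (hφ : MemLp (fun p : ℝ × Ω ↦ φ p.1 p.2) 2 ((volume.restrict D).prod P)) (hX : MemLp X 2 P)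
    {S : ℕ → SimpleIntegrand (history B P) D} (hS : Approximates P S φ)
    (hlim : Tendsto (fun k ↦ eLpNorm (fun ω ↦ (S k).integral B ω - X ω) 2 P) atTop (𝓝 0)) :
    IsItoIntegral B P D φ X where
  memLp_integrand := hφ
  memLp_integral := hX
  exists_approx := ⟨S, hS⟩
  tendsto S' hS' := by
    have h1 := hS'.tendsto_sub (fun a _ ↦ hB.history_le a) hφ.1 hS
    simp_rw [← eLpNorm_integral_sub hB] at h1
    refine Tendsto.congr (fun n ↦ ?_) (tendsto_eLpNorm_add_zero
      (fun n ↦ ((S' n).memLp_integral hB).1.sub ((S n).memLp_integral hB).1)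
      (fun n ↦ ((S n).memLp_integral hB).1.sub hX.1) h1 hlim)
    congr 1
    ext ω
    simp

/-- Every process in the closure of the simple processes is Itô integrable. -/
theorem itoIntegrable_of_approximable [D.OrdConnected] (hB : IsTwoSidedBrownian B P)
    (hφ : MemLp (fun p : ℝ × Ω ↦ φ p.1 p.2) 2 ((volume.restrict D).prod P))
    (h : Approximable (history B P) D P (fun p ↦ φ p.1 p.2)) : ItoIntegrable B P D φ := by
  obtain ⟨S, hS⟩ := h.exists_approximates
  have h𝓐 : ∀ a ∈ D, history B P a ≤ mΩ := fun a _ ↦ hB.history_le a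
  have hm : ∀ n, MemLp ((S n).integral B) 2 P := fun n ↦ (S n).memLp_integral hB
  have hme : ∀ n, MemLp (fun p : ℝ × Ω ↦ (S n).eval p.1 p.2) 2 ((volume.restrict D).prod P) :=
    fun n ↦ (S n).memLp_eval h𝓐
  have hc := ((Lp.tendsto_Lp_iff_tendsto_eLpNorm'' _ hme _ hφ).2 hS).cauchySeq
  have hc' : CauchySeq (fun n ↦ (hm n).toLp _) := by
    rw [EMetric.cauchySeq_iff] at hc ⊢
    intro ε hε
    obtain ⟨N, hN⟩ := hc ε hε
    refine ⟨N, fun k hk l hl ↦ ?_⟩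
    have h1 := hN k hk l hl
    rw [Lp.edist_toLp_toLp] at h1 ⊢
    exact (eLpNorm_integral_sub hB (S k) (S l)).trans_lt h1
  obtain ⟨X, hX⟩ := cauchySeq_tendsto_of_complete hc'
  refine ⟨X, IsItoIntegral.of_tendsto hB hφ (Lp.memLp X) hS ?_⟩
  rw [← Lp.toLp_coeFn X (Lp.memLp X)] at hX
  exact (Lp.tendsto_Lp_iff_tendsto_eLpNorm'' _ hm _ (Lp.memLp X)).1 hX

lemma IsItoIntegral.add [D.OrdConnected] (hB : IsTwoSidedBrownian B P)
    (hX : IsItoIntegral B P D φ X) (hY : IsItoIntegral B P D ψ Y) :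
    IsItoIntegral B P D (fun r ω ↦ φ r ω + ψ r ω) (fun ω ↦ X ω + Y ω) := by
  obtain ⟨S, hS⟩ := hX.exists_approx
  obtain ⟨S', hS'⟩ := hY.exists_approx
  have h𝓐 : ∀ a ∈ D, history B P a ≤ mΩ := fun a _ ↦ hB.history_le a
  refine IsItoIntegral.of_tendsto hB (hX.memLp_integrand.add hY.memLp_integrand)
    (hX.memLp_integral.add hY.memLp_integral) (S := fun n ↦ (S n).add (S' n)) ?_ ?_
  · refine Tendsto.congr (fun n ↦ ?_) (tendsto_eLpNorm_add_zero
      (fun n ↦ ((S n).memLp_eval h𝓐).1.sub hX.memLp_integrand.1)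
      (fun n ↦ ((S' n).memLp_eval h𝓐).1.sub hY.memLp_integrand.1) hS hS')
    congr 1
    ext p
    simp only [SimpleIntegrand.add_eval, Pi.sub_apply]
    ring
  · refine Tendsto.congr (fun n ↦ ?_) (tendsto_eLpNorm_add_zero
      (fun n ↦ ((S n).memLp_integral hB).1.sub hX.memLp_integral.1)
      (fun n ↦ ((S' n).memLp_integral hB).1.sub hY.memLp_integral.1)
      (hX.tendsto S hS) (hY.tendsto S' hS'))
    congr 1
    ext ω
    simp only [SimpleIntegrand.add_integral, Pi.sub_apply]
    ring

/-- A bounded variable known throughout `D` can be taken out of the integral over `D`. -/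
lemma IsItoIntegral.mul [D.OrdConnected] (hB : IsTwoSidedBrownian B P)
    (hX : IsItoIntegral B P D φ X) {ξ : Ω → ℝ} (hξ : ∀ a ∈ D, Measurable[history B P a] ξ)
    (hξm : Measurable ξ) (hC : ∃ C : ℝ, ∀ ω, |ξ ω| ≤ C) :
    IsItoIntegral B P D (fun r ω ↦ ξ ω * φ r ω) (fun ω ↦ ξ ω * X ω) := by
  obtain ⟨S, hS⟩ := hX.exists_approx
  have hC' := hC
  obtain ⟨C, hC⟩ := hC'
  refine IsItoIntegral.of_tendsto hB ?_ ?_ (S := fun n ↦ (S n).mul hξ ⟨C, hC⟩) ?_ ?_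
  · refine hX.memLp_integrand.of_le_mul (c := C)
      ((hξm.comp measurable_snd).aestronglyMeasurable.mul hX.memLp_integrand.1)
      (Eventually.of_forall fun p ↦ ?_)
    rw [norm_mul]
    exact mul_le_mul_of_nonneg_right (hC p.2) (norm_nonneg _)
  · refine hX.memLp_integral.of_le_mul (c := C)
      (hξm.aestronglyMeasurable.mul hX.memLp_integral.1) (Eventually.of_forall fun ω ↦ ?_)
    rw [norm_mul]
    exact mul_le_mul_of_nonneg_right (hC ω) (norm_nonneg _)
  · refine Tendsto.congr (fun n ↦ ?_)
      (tendsto_eLpNorm_mul_zero (ξ := fun p : ℝ × Ω ↦ ξ p.2) (fun p ↦ hC p.2) hS)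
    congr 1
    ext p
    simp only [SimpleIntegrand.mul_eval]
    ring
  · refine Tendsto.congr (fun n ↦ ?_) (tendsto_eLpNorm_mul_zero hC (hX.tendsto S hS))
    congr 1
    ext ω
    simp only [SimpleIntegrand.mul_integral]
    ring

lemma IsItoIntegral.const_mul [D.OrdConnected] (hB : IsTwoSidedBrownian B P)
    (hX : IsItoIntegral B P D φ X) (c : ℝ) :
    IsItoIntegral B P D (fun r ω ↦ c * φ r ω) (fun ω ↦ c * X ω) :=
  hX.mul hB (fun _ _ ↦ measurable_const) measurable_const ⟨|c|, fun _ ↦ le_rfl⟩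

lemma IsItoIntegral.sub [D.OrdConnected] (hB : IsTwoSidedBrownian B P)
    (hX : IsItoIntegral B P D φ X) (hY : IsItoIntegral B P D ψ Y) :
    IsItoIntegral B P D (fun r ω ↦ φ r ω - ψ r ω) (fun ω ↦ X ω - Y ω) := by
  simpa [sub_eq_add_neg] using hX.add hB (hY.const_mul hB (-1))

lemma isItoIntegral_zero [D.OrdConnected] (hB : IsTwoSidedBrownian B P) :
    IsItoIntegral B P D (fun _ _ ↦ 0) (fun _ ↦ 0) := by
  refine IsItoIntegral.of_tendsto hB MemLp.zero' MemLp.zero' (S := fun _ ↦ .zero _ _) ?_ ?_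
  · simp [Approximates]
  · refine tendsto_const_nhds.congr fun n ↦ ?_
    have : ∀ ω, (SimpleIntegrand.zero (history B P) D).integral B ω = 0 :=
      fun ω ↦ Finset.sum_eq_zero fun i _ ↦ i.elim0
    simp [this]

lemma IsItoIntegral.finsetSum [D.OrdConnected] (hB : IsTwoSidedBrownian B P) {ι : Type*}
    (s : Finset ι) {φ : ι → ℝ → Ω → ℝ} {X : ι → Ω → ℝ}
    (hX : ∀ i ∈ s, IsItoIntegral B P D (φ i) (X i)) :
    IsItoIntegral B P D (fun r ω ↦ ∑ i ∈ s, φ i r ω) (fun ω ↦ ∑ i ∈ s, X i ω) := by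
  classical
  induction s using Finset.induction_on with
  | empty => simpa using isItoIntegral_zero hB
  | insert i s hi ih =>
    simp_rw [Finset.sum_insert hi]
    exact (hX i (Finset.mem_insert_self _ _)).add hB
      (ih fun j hj ↦ hX j (Finset.mem_insert_of_mem hj))

/-- The **Itô isometry**. -/
lemma IsItoIntegral.eLpNorm_eq [D.OrdConnected] (hB : IsTwoSidedBrownian B P)
    (hX : IsItoIntegral B P D φ X) :
    eLpNorm X 2 P = eLpNorm (fun p : ℝ × Ω ↦ φ p.1 p.2) 2 ((volume.restrict D).prod P) := by
  obtain ⟨S, hS⟩ := hX.exists_approx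
  have h1 := tendsto_eLpNorm_of_tendsto_sub (fun n ↦ (S n).memLp_integral hB) hX.memLp_integral
    (hX.tendsto S hS)
  have h2 := tendsto_eLpNorm_of_tendsto_sub
    (fun n ↦ (S n).memLp_eval fun a _ ↦ hB.history_le a) hX.memLp_integrand hS
  simp_rw [← SimpleIntegrand.eLpNorm_integral hB] at h2
  exact tendsto_nhds_unique h1 h2

lemma IsItoIntegral.integral_eq_zero (hB : IsTwoSidedBrownian B P)
    (hX : IsItoIntegral B P D φ X) : ∫ ω, X ω ∂P = 0 := by
  obtain ⟨S, hS⟩ := hX.exists_approx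
  have h1 : Tendsto (fun n ↦ eLpNorm ((S n).integral B - X) 1 P) atTop (𝓝 0) := by
    refine tendsto_of_tendsto_of_tendsto_of_le_of_le tendsto_const_nhds (hX.tendsto S hS)
      (fun _ ↦ zero_le) fun n ↦ ?_
    exact eLpNorm_le_eLpNorm_of_exponent_le one_le_two
      (((S n).memLp_integral hB).1.sub hX.memLp_integral.1)
  have h2 := tendsto_integral_of_L1' X hX.memLp_integral.1
    (Eventually.of_forall fun n ↦ ((S n).memLp_integral hB).integrable one_le_two) h1
  simp_rw [SimpleIntegrand.integral_integral hB] at h2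
  exact tendsto_nhds_unique h2 tendsto_const_nhds

/-- An integral over `D` is the integral over a larger time set of the extension by `0`. -/
lemma IsItoIntegral.mono_set [D.OrdConnected] [D'.OrdConnected] (hB : IsTwoSidedBrownian B P)
    (hD : MeasurableSet D) (hDD : D ⊆ D') (hX : IsItoIntegral B P D φ X) :
    IsItoIntegral B P D' (fun r ω ↦ D.indicator (fun r ↦ φ r ω) r) X := by
  have hμ : ((volume.restrict D').prod P).restrict (D ×ˢ univ) = (volume.restrict D).prod P := by
    have := Measure.prod_restrict (μ := volume.restrict D') (ν := P) D univ
    rw [Measure.restrict_univ, Measure.restrict_restrict hD, inter_eq_left.2 hDD] at this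
    exact this.symm
  have hDm : MeasurableSet (D ×ˢ (univ : Set Ω)) := hD.prod .univ
  have e : ∀ g : ℝ × Ω → ℝ, eLpNorm ((D ×ˢ univ).indicator g) 2 ((volume.restrict D').prod P) =
      eLpNorm g 2 ((volume.restrict D).prod P) := fun g ↦ by
    rw [eLpNorm_indicator_eq_eLpNorm_restrict hDm, hμ]
  have hind : ∀ p : ℝ × Ω, D.indicator (fun r ↦ φ r p.2) p.1 =
      (D ×ˢ univ).indicator (fun p : ℝ × Ω ↦ φ p.1 p.2) p := fun p ↦ by
    by_cases h : p.1 ∈ D <;> simp [indicator, h]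
  obtain ⟨S, hS⟩ := hX.exists_approx
  refine IsItoIntegral.of_tendsto hB ?_ hX.memLp_integral
    (S := fun n ↦ (S n).mono hDD fun _ _ ↦ le_rfl) ?_ ?_
  · simp_rw [hind]
    rw [memLp_indicator_iff_restrict hDm, hμ]
    exact hX.memLp_integrand
  · refine Tendsto.congr (fun n ↦ ?_) hS
    rw [← e]
    congr 1
    ext p
    by_cases h : p.1 ∈ D
    · simp [indicator, h]
    · simp [indicator, h, (S n).eval_of_notMem h]
  · exact hX.tendsto S hS

end Ito

/-! ### Deterministic integrands -/

section Wiener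

variable {Ω : Type*} [mΩ : MeasurableSpace Ω] {B : ℝ → Ω → ℝ} {P : Measure Ω}
  [IsProbabilityMeasure P] {D : Set ℝ} {g : ℝ → ℝ} {X : Ω → ℝ}

/-- Deterministic integrands are approximated by deterministic step functions. -/
lemma exists_approximates_deterministic (hD : Exhausted D) (hg : MemLp g 2 (volume.restrict D)) :
    ∃ S : ℕ → SimpleIntegrand (fun _ ↦ (⊥ : MeasurableSpace Ω)) D,
      Approximates P S (fun r _ ↦ g r) := by
  refine Approximable.exists_approximates (approximable_of_memLp (m := ⊥) bot_le
    (fun _ _ ↦ bot_le) (fun _ _ ↦ bot_le) hD (hg.comp_fst P) ?_)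
  obtain ⟨g', hg', he⟩ := hg.1
  refine ⟨fun p ↦ g' p.1, ?_, Measure.quasiMeasurePreserving_fst.ae he⟩
  exact hg'.comp_measurable (@measurable_fst _ _ _ ⊥)

variable [P.IsComplete]

lemma itoIntegrable_deterministic [D.OrdConnected] (hB : IsTwoSidedBrownian B P)
    (hD : Exhausted D) (hg : MemLp g 2 (volume.restrict D)) :
    ItoIntegrable B P D (fun r _ ↦ g r) := by
  refine itoIntegrable_of_approximable hB (hg.comp_fst P) (approximable_of_memLp (m := ⊥) bot_le
    (fun _ _ ↦ bot_le) (fun a _ ↦ hB.history_le a) hD (hg.comp_fst P) ?_)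
  obtain ⟨g', hg', he⟩ := hg.1
  refine ⟨fun p ↦ g' p.1, ?_, Measure.quasiMeasurePreserving_fst.ae he⟩
  exact hg'.comp_measurable (@measurable_fst _ _ _ ⊥)

lemma IsItoIntegral.eLpNorm_eq_deterministic [D.OrdConnected] (hB : IsTwoSidedBrownian B P)
    (hX : IsItoIntegral B P D (fun r _ ↦ g r) X) (hg : AEStronglyMeasurable g (volume.restrict D)) :
    eLpNorm X 2 P = eLpNorm g 2 (volume.restrict D) := by
  rw [hX.eLpNorm_eq hB]
  have := eLpNorm_comp_measurePreserving (p := 2) hg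
    (measurePreserving_fst (μ := volume.restrict D) (ν := P))
  exact this

lemma IsItoIntegral.measurable_future (hB : IsTwoSidedBrownian B P) {t : ℝ} (hD : D ⊆ Ici t)
    (hDe : Exhausted D) (hg : MemLp g 2 (volume.restrict D))
    (hX : IsItoIntegral B P D (fun r _ ↦ g r) X) : Measurable[future B P t] X := by
  obtain ⟨S, hS⟩ := exists_approximates_deterministic (P := P) hDe hg
  refine measurable_of_tendsto_eLpNorm (mΩ := mΩ) (iSup₂_le fun q r ↦ ?_) (fun n ↦ ?_)
    hX.memLp_integral.1 (hX.tendsto (fun n ↦ (S n).mono subset_rfl fun _ _ ↦ bot_le) hS)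
  · rw [← BorelSpace.measurable_eq (α := ℝ), ← measurable_iff_comap_le]
    exact (hB.measurable _).sub (hB.measurable _)
  · unfold SimpleIntegrand.integral
    refine Finset.measurable_fun_sum _ fun i _ ↦ ?_
    exact (((S n).measurable_coef i).mono bot_le le_rfl).mul
      (measurable_future_sub (hD ((S n).left_mem i)) (hD ((S n).right_mem i)))

/-- The integral of a deterministic function is Gaussian. -/
lemma IsItoIntegral.hasGaussianLaw (hB : IsTwoSidedBrownian B P) (hDe : Exhausted D)
    (hg : MemLp g 2 (volume.restrict D)) (hX : IsItoIntegral B P D (fun r _ ↦ g r) X) :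
    HasGaussianLaw X P := by
  obtain ⟨S, hS⟩ := exists_approximates_deterministic (P := P) hDe hg
  refine hasGaussianLaw_of_tendsto_eLpNorm (fun n ↦ ?_)
    (fun n ↦ SimpleIntegrand.integral_integral hB _) hX.memLp_integral
    (hX.tendsto (fun n ↦ (S n).mono subset_rfl fun _ _ ↦ bot_le) hS)
  classical
  -- the coefficients are measurable with respect to the trivial `σ`-algebra, hence constant
  have hconst : ∀ i, ∃ c : ℝ, ∀ ω, (S n).coef i ω = c := fun i ↦ by
    have : Nonempty Ω := P.nonempty_of_neZero
    let ω₀ := Classical.arbitrary Ω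
    refine ⟨(S n).coef i ω₀, fun ω ↦ ?_⟩
    rcases MeasurableSpace.measurableSet_bot_iff.1
      ((S n).measurable_coef i (measurableSet_singleton ((S n).coef i ω₀))) with h | h
    · have : ω₀ ∈ (S n).coef i ⁻¹' {(S n).coef i ω₀} := rfl
      rw [h] at this
      exact this.elim
    · have : ω ∈ (S n).coef i ⁻¹' {(S n).coef i ω₀} := h ▸ mem_univ ω
      exact this
  choose c hc using hconst
  let I : Finset (ℝ × ℝ) := Finset.univ.image fun i ↦ ((S n).left i, (S n).right i)
  let L : (I → ℝ) →L[ℝ] ℝ := ∑ i, c i • ContinuousLinearMap.proj (R := ℝ) (φ := fun _ : I ↦ ℝ)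
    ⟨((S n).left i, (S n).right i), Finset.mem_image_of_mem _ (Finset.mem_univ i)⟩
  have e : ((S n).mono (𝓐' := history B P) subset_rfl fun _ _ ↦ bot_le).integral B =
      fun ω ↦ L (I.restrict (increment B · ω)) := by
    ext ω
    simp only [SimpleIntegrand.integral, L, increment, _root_.sum_apply,
      _root_.smul_apply, ContinuousLinearMap.proj_apply, Finset.restrict, smul_eq_mul]
    exact Finset.sum_congr rfl fun i _ ↦ by rw [← hc i ω]; rfl
  rw [e]
  exact (hB.isGaussianProcess_increment.hasGaussianLaw I).map_fun L

end Wiener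

/-! ### The kernels -/

section Kernels

variable {H s t : ℝ}

lemma integral_rpow_sub_Iic {β : ℝ} (hβ : β < -1) (hst : s < t) :
    IntegrableOn (fun r ↦ (t - r) ^ β) (Iic s) ∧
      ∫ r in Iic s, (t - r) ^ β = -(t - s) ^ (β + 1) / (β + 1) := by
  have hpre : (fun r ↦ t - r) ⁻¹' (Ici (t - s)) = Iic s := by
    ext r; simp
  have hmp := Measure.measurePreserving_sub_left (volume : Measure ℝ) t
  have hme : MeasurableEmbedding (fun r : ℝ ↦ t - r) :=
    (MeasurableEquiv.subLeft t).measurableEmbedding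
  constructor
  · have h := (integrableOn_Ioi_rpow_of_lt hβ (sub_pos.2 hst))
    rw [← integrableOn_Ici_iff_integrableOn_Ioi] at h
    have := (hmp.integrableOn_comp_preimage hme).2 h
    rwa [hpre] at this
  · rw [← integral_Ioi_rpow_of_lt hβ (sub_pos.2 hst), ← integral_Ici_eq_integral_Ioi, ← hpre]
    exact hmp.setIntegral_preimage_emb hme (fun u ↦ u ^ β) (Ici (t - s))

/-- On `[m, ∞)` a power function with exponent at most `1` is Lipschitz. -/
lemma abs_rpow_sub_rpow_le {p m x y : ℝ} (hp : p ≤ 1) (hm : 0 < m) (hx : m ≤ x) (hy : m ≤ y) :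
    |y ^ p - x ^ p| ≤ |p| * m ^ (p - 1) * |y - x| := by
  have h := Convex.norm_image_sub_le_of_norm_hasDerivWithin_le (s := Ici m)
    (f := fun x ↦ x ^ p) (f' := fun x ↦ p * x ^ (p - 1)) (C := |p| * m ^ (p - 1))
    (fun z hz ↦ (Real.hasDerivAt_rpow_const (Or.inl (hm.trans_le hz).ne')).hasDerivWithinAt)
    (fun z hz ↦ ?_) (convex_Ici m) hx hy
  · simpa using h
  · rw [norm_mul, Real.norm_eq_abs, Real.norm_eq_abs,
      abs_of_nonneg (Real.rpow_nonneg (hm.trans_le hz).le _)]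
    exact mul_le_mul_of_nonneg_left (Real.rpow_le_rpow_of_nonpos hm hz (by linarith))
      (abs_nonneg _)

lemma measurable_sub_rpow (t p : ℝ) : Measurable fun r : ℝ ↦ (t - r) ^ p := by fun_prop

lemma memLp_rpow_sub_Iic {p : ℝ} (hp : p < -1 / 2) (hst : s < t) :
    MemLp (fun r ↦ (t - r) ^ p) 2 (volume.restrict (Iic s)) := by
  rw [memLp_two_iff_integrable_sq (measurable_sub_rpow _ _).aestronglyMeasurable]
  have h := (integral_rpow_sub_Iic (s := s) (t := t) (β := 2 * p) (by linarith) hst).1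
  refine h.congr_fun (fun r hr ↦ ?_) measurableSet_Iic
  have : 0 < t - r := by linarith [mem_Iic.1 hr]
  change _ = ((t - r) ^ p) ^ 2
  rw [← Real.rpow_natCast, ← Real.rpow_mul this.le]
  push_cast
  ring_nf

lemma integral_rpow_sub_sq_Iic (hH : H ∈ Ioo (1 / 2 : ℝ) 1) (hst : s < t) :
    ∫ r in Iic s, ((t - r) ^ (H - 3 / 2)) ^ 2 = (t - s) ^ (2 * H - 2) / (2 - 2 * H) := by
  have h := (integral_rpow_sub_Iic (s := s) (t := t) (β := 2 * H - 3) (by linarith [hH.2]) hst).2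
  have e : ∫ r in Iic s, ((t - r) ^ (H - 3 / 2)) ^ 2 = ∫ r in Iic s, (t - r) ^ (2 * H - 3) := by
    refine setIntegral_congr_fun measurableSet_Iic fun r hr ↦ ?_
    have : 0 < t - r := by linarith [mem_Iic.1 hr]
    change ((t - r) ^ (H - 3 / 2)) ^ 2 = _
    rw [← Real.rpow_natCast, ← Real.rpow_mul this.le]
    congr 1
    push_cast
    ring
  rw [e, h, show 2 * H - 3 + 1 = 2 * H - 2 by ring, show 2 - 2 * H = -(2 * H - 2) by ring, div_neg,
    neg_div]

lemma memLp_rpow_sub_Icc (hH : H ∈ Ioo (1 / 2 : ℝ) 1) (s t : ℝ) :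
    MemLp (fun r ↦ (t - r) ^ (H - 1 / 2)) 2 (volume.restrict (Icc s t)) := by
  refine MemLp.of_bound (measurable_sub_rpow _ _).aestronglyMeasurable ((t - s) ^ (H - 1 / 2)) ?_
  filter_upwards [ae_restrict_mem measurableSet_Icc] with r hr
  have h0 : 0 ≤ t - r := sub_nonneg.2 hr.2
  rw [Real.norm_eq_abs, abs_of_nonneg (Real.rpow_nonneg h0 _)]
  exact Real.rpow_le_rpow h0 (by linarith [hr.1]) (by linarith [hH.1])

lemma measurable_fKernel (H s t : ℝ) : Measurable (fKernel H s t) :=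
  (measurable_sub_rpow _ _).sub (measurable_sub_rpow _ _)

/-- Near `s` the kernel `f(t, ·)` is bounded, and at `-∞` it decays like `(s - r)^{H - 3/2}`. -/
lemma memLp_fKernel (hH : H ∈ Ioo (1 / 2 : ℝ) 1) (hst : s ≤ t) :
    MemLp (fKernel H s t) 2 (volume.restrict (Iic s)) := by
  have h0 := sub_pos.2 hH.1
  have e : Iic s = Iic (s - 1) ∪ Icc (s - 1) s := by
    ext r
    simp only [mem_Iic, mem_union, mem_Icc]
    constructor
    · intro h
      rcases le_total r (s - 1) with h' | h'
      exacts [Or.inl h', Or.inr ⟨h', h⟩]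
    · rintro (h | h)
      exacts [by linarith, h.2]
  have h1 : MemLp (fKernel H s t) 2 (volume.restrict (Iic (s - 1))) := by
    refine (memLp_rpow_sub_Iic (p := H - 3 / 2) (by linarith [hH.2]) (sub_one_lt s)).of_le_mul
      (c := |H - 1 / 2| * |t - s|) (measurable_fKernel H s t).aestronglyMeasurable ?_
    filter_upwards [ae_restrict_mem measurableSet_Iic] with r hr
    have hr' : 0 < s - r := by linarith [mem_Iic.1 hr]
    have := abs_rpow_sub_rpow_le (p := H - 1 / 2) (by linarith [hH.2]) hr' le_rfl
      (by linarith : s - r ≤ t - r)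
    rw [Real.norm_eq_abs, Real.norm_eq_abs, abs_of_nonneg (Real.rpow_nonneg hr'.le _)]
    refine this.trans (le_of_eq ?_)
    rw [show t - r - (s - r) = t - s by ring, show H - 1 / 2 - 1 = H - 3 / 2 by ring]
    ring
  have h2 : MemLp (fKernel H s t) 2 (volume.restrict (Icc (s - 1) s)) := by
    refine MemLp.of_bound (measurable_fKernel H s t).aestronglyMeasurable
      ((t - (s - 1)) ^ (H - 1 / 2)) ?_
    filter_upwards [ae_restrict_mem measurableSet_Icc] with r hr
    have hr0 : 0 ≤ s - r := sub_nonneg.2 hr.2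
    have h3 : (s - r) ^ (H - 1 / 2) ≤ (t - r) ^ (H - 1 / 2) :=
      Real.rpow_le_rpow hr0 (by linarith) h0.le
    have h4 : (t - r) ^ (H - 1 / 2) ≤ (t - (s - 1)) ^ (H - 1 / 2) :=
      Real.rpow_le_rpow (by linarith) (by linarith [hr.1]) h0.le
    rw [fKernel, Real.norm_eq_abs, abs_of_nonneg (sub_nonneg.2 h3)]
    linarith [Real.rpow_nonneg hr0 (H - 1 / 2)]
  rw [e]
  have h3 := memLp_indicator_iff_restrict (μ := volume) (p := 2) (f := fKernel H s t)
    (measurableSet_Iic (a := s - 1)) |>.2 h1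
  have h4 := memLp_indicator_iff_restrict (μ := volume) (p := 2) (f := fKernel H s t)
    (measurableSet_Icc (a := s - 1) (b := s)) |>.2 h2
  refine (h3.norm.add h4.norm).restrict _ |>.mono (measurable_fKernel H s t).aestronglyMeasurable ?_
  filter_upwards [ae_restrict_mem (measurableSet_Iic.union measurableSet_Icc)] with r hr
  rw [Pi.add_apply, Real.norm_of_nonneg (add_nonneg (norm_nonneg _) (norm_nonneg _))]
  rcases hr with hr | hr
  · rw [indicator_of_mem hr]
    exact le_add_of_nonneg_right (norm_nonneg _)
  · rw [indicator_of_mem hr]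
    exact le_add_of_nonneg_left (norm_nonneg _)

lemma hasDerivAt_fKernel {r : ℝ} (hr : r < t) :
    HasDerivAt (fun u ↦ fKernel H s u r) ((H - 1 / 2) * (t - r) ^ (H - 3 / 2)) t := by
  have h := ((hasDerivAt_id t).sub_const r).rpow_const (p := H - 1 / 2)
    (Or.inl (sub_pos.2 hr).ne')
  have h2 := h.sub_const ((s - r) ^ (H - 1 / 2))
  rwa [show H - 1 / 2 - 1 = H - 3 / 2 by ring, one_mul] at h2

lemma deriv_fKernel_ae (H : ℝ) (hst : s < t) :
    (fun r ↦ deriv (fun u ↦ fKernel H s u r) t) =ᵐ[volume.restrict (Iic s)]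
      fun r ↦ (H - 1 / 2) * (t - r) ^ (H - 3 / 2) := by
  filter_upwards [ae_restrict_mem measurableSet_Iic] with r hr
  exact (hasDerivAt_fKernel (lt_of_le_of_lt hr hst)).deriv

/-- The difference quotients of the kernel converge in `L²` to the derivative. -/
lemma tendsto_fKernel_slope (hH : H ∈ Ioo (1 / 2 : ℝ) 1) (hst : s < t) :
    Tendsto (fun δ : ℝ ↦ eLpNorm (fun r ↦ (fKernel H s (t + δ) r - fKernel H s t r) / δ -
      (H - 1 / 2) * (t - r) ^ (H - 3 / 2)) 2 (volume.restrict (Iic s))) (𝓝[≠] 0) (𝓝 0) := by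
  have h0 := sub_pos.2 hH.1
  have hsu : s < (s + t) / 2 := by linarith
  have hev : ∀ᶠ δ : ℝ in 𝓝[≠] 0, |δ| < (t - s) / 2 ∧ δ ≠ 0 := by
    refine (eventually_nhdsWithin_of_eventually_nhds ?_).and
      (eventually_mem_nhdsWithin.mono fun δ hδ ↦ hδ)
    have := Metric.ball_mem_nhds (0 : ℝ) (show 0 < (t - s) / 2 by linarith)
    filter_upwards [this] with δ hδ
    simpa using hδ
  refine tendsto_eLpNorm_two_of_dominated
    (g := fun r ↦ 2 * (H - 1 / 2) * ((s + t) / 2 - r) ^ (H - 3 / 2))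
    ((memLp_rpow_sub_Iic (p := H - 3 / 2) (by linarith [hH.2]) hsu).const_mul _)
    (Eventually.of_forall fun δ ↦ ?_) ?_ ?_
  · exact ((((measurable_fKernel _ _ _).sub (measurable_fKernel _ _ _)).div_const _).sub
      ((measurable_sub_rpow _ _).const_mul _)).aestronglyMeasurable
  · filter_upwards [hev] with δ hδ
    filter_upwards [ae_restrict_mem measurableSet_Iic] with r hr
    have hr' : r ≤ s := hr
    have hm : 0 < (s + t) / 2 - r := by linarith
    have hδ' := abs_lt.1 hδ.1
    have h1 := abs_rpow_sub_rpow_le (p := H - 1 / 2) (x := t - r) (y := t + δ - r)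
      (by linarith [hH.2]) hm (by linarith) (by linarith)
    rw [show t + δ - r - (t - r) = δ by ring, abs_of_pos h0,
      show H - 1 / 2 - 1 = H - 3 / 2 by ring] at h1
    have h2 : |(fKernel H s (t + δ) r - fKernel H s t r) / δ| ≤
        (H - 1 / 2) * ((s + t) / 2 - r) ^ (H - 3 / 2) := by
      rw [abs_div, div_le_iff₀ (abs_pos.2 hδ.2)]
      simpa [fKernel] using h1
    have h3 : |(H - 1 / 2) * (t - r) ^ (H - 3 / 2)| ≤
        (H - 1 / 2) * ((s + t) / 2 - r) ^ (H - 3 / 2) := by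
      rw [abs_mul, abs_of_pos h0, abs_of_nonneg (Real.rpow_nonneg (by linarith) _)]
      exact mul_le_mul_of_nonneg_left
        (Real.rpow_le_rpow_of_nonpos hm (by linarith) (by linarith [hH.2])) h0.le
    calc _ ≤ _ := abs_sub _ _
      _ ≤ _ := add_le_add h2 h3
      _ = _ := by ring
  · filter_upwards [ae_restrict_mem measurableSet_Iic] with r hr
    have h := (hasDerivAt_fKernel (H := H) (s := s) (lt_of_le_of_lt hr hst)).tendsto_slope_zero
    have h2 := h.sub_const ((H - 1 / 2) * (t - r) ^ (H - 3 / 2))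
    rw [sub_self] at h2
    refine h2.congr fun δ ↦ ?_
    simp only [smul_eq_mul, div_eq_inv_mul]

/-- The derivative of the kernel is locally Lipschitz in time, as a function with values in `L²`. -/
lemma eLpNorm_rpow_sub_sub_le (hH : H ∈ Ioo (1 / 2 : ℝ) 1) (hst : s < t) :
    ∃ C : ℝ≥0∞, C ≠ ∞ ∧ ∀ u, t ≤ u →
      eLpNorm (fun r ↦ (u - r) ^ (H - 3 / 2) - (t - r) ^ (H - 3 / 2)) 2 (volume.restrict (Iic s)) ≤
        C * ENNReal.ofReal (u - t) := by
  have hm := memLp_rpow_sub_Iic (p := H - 3 / 2 - 1) (by linarith [hH.2]) hst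
  refine ⟨ENNReal.ofReal |H - 3 / 2| * eLpNorm (fun r ↦ (t - r) ^ (H - 3 / 2 - 1)) 2
    (volume.restrict (Iic s)), ENNReal.mul_ne_top ENNReal.ofReal_ne_top hm.2.ne, fun u hu ↦ ?_⟩
  have h := eLpNorm_le_mul_eLpNorm_of_ae_le_mul (μ := volume.restrict (Iic s)) (p := 2)
    (f := fun r ↦ (u - r) ^ (H - 3 / 2) - (t - r) ^ (H - 3 / 2))
    (g := fun r ↦ (t - r) ^ (H - 3 / 2 - 1)) (c := |H - 3 / 2| * (u - t)) ?_
  · rw [ENNReal.ofReal_mul (abs_nonneg _)] at h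
    refine h.trans_eq ?_
    ring
  · filter_upwards [ae_restrict_mem measurableSet_Iic] with r hr
    have hr' : 0 < t - r := by linarith [mem_Iic.1 hr]
    have h1 := abs_rpow_sub_rpow_le (p := H - 3 / 2) (x := t - r) (y := u - r)
      (by linarith [hH.2]) hr' le_rfl (by linarith)
    rw [Real.norm_eq_abs, Real.norm_eq_abs, abs_of_nonneg (Real.rpow_nonneg hr'.le _)]
    refine h1.trans_eq ?_
    rw [show u - r - (t - r) = u - t by ring, abs_of_nonneg (sub_nonneg.2 hu)]
    ring

/-- `(t - r)₊^{H - 1/2} - (s - r)₊^{H - 1/2}` splits into its parts on `(-∞, s]` and `[s, t]`. -/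
lemma posPart_rpow_sub_ae (hH : H ∈ Ioo (1 / 2 : ℝ) 1) (hst : s ≤ t) :
    (fun r ↦ (max (t - r) 0) ^ (H - 1 / 2) - (max (s - r) 0) ^ (H - 1 / 2)) =ᵐ[volume]
      fun r ↦ (Icc s t).indicator (fun r ↦ (t - r) ^ (H - 1 / 2)) r +
        (Iic s).indicator (fKernel H s t) r := by
  have hne : ∀ᵐ r ∂(volume : Measure ℝ), r ≠ s := Measure.ae_ne volume s
  have h0 : H - 1 / 2 ≠ 0 := (sub_pos.2 hH.1).ne'
  filter_upwards [hne] with r hr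
  rcases lt_or_gt_of_ne hr with h | h
  · rw [indicator_of_notMem (fun h' ↦ absurd h'.1 (not_le.2 h)), indicator_of_mem (mem_Iic.2 h.le),
      max_eq_left (by linarith), max_eq_left (by linarith), fKernel, zero_add]
  · rw [indicator_of_notMem (s := Iic s) (fun h' ↦ absurd h' (not_le.2 h)),
      max_eq_right (a := s - r) (by linarith), Real.zero_rpow h0]
    by_cases h' : r ≤ t
    · rw [indicator_of_mem (mem_Icc.2 ⟨h.le, h'⟩), max_eq_left (by linarith)]; ring
    · rw [indicator_of_notMem (fun h'' ↦ h' h''.2), max_eq_right (by linarith),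
        Real.zero_rpow h0]; ring

lemma memLp_posPart_rpow_sub (hH : H ∈ Ioo (1 / 2 : ℝ) 1) (hst : s ≤ t) :
    MemLp (fun r ↦ (max (t - r) 0) ^ (H - 1 / 2) - (max (s - r) 0) ^ (H - 1 / 2)) 2 volume := by
  refine MemLp.ae_eq (posPart_rpow_sub_ae hH hst).symm (MemLp.add ?_ ?_)
  · exact (memLp_indicator_iff_restrict measurableSet_Icc).2 (memLp_rpow_sub_Icc hH s t)
  · exact (memLp_indicator_iff_restrict measurableSet_Iic).2 (memLp_fKernel hH hst)

lemma memLp_mvnKernel (hH : H ∈ Ioo (1 / 2 : ℝ) 1) (t : ℝ) :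
    MemLp (mvnKernel H t) 2 volume := by
  rcases le_total 0 t with h | h
  · have := memLp_posPart_rpow_sub hH h
    simp only [zero_sub] at this
    exact this
  · have := (memLp_posPart_rpow_sub hH h).neg
    convert this using 1
    ext r
    simp [mvnKernel]

end Kernels

/-! ### The fractional integral operator -/

section Fractional

/-- **Schur's test** in `L²`, for nonnegative kernels whose two marginals are at most `K`. -/
lemma lintegral_schur_le {α β : Type*} {mα : MeasurableSpace α} {mβ : MeasurableSpace β}
    {μ : Measure α} {ν : Measure β} [SFinite μ] [SFinite ν] {k : α → β → ℝ≥0∞}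
    (hk : Measurable fun p : α × β ↦ k p.1 p.2) {K : ℝ≥0∞} (h1 : ∀ x, ∫⁻ y, k x y ∂ν ≤ K)
    (h2 : ∀ y, ∫⁻ x, k x y ∂μ ≤ K) {h : β → ℝ≥0∞} (hh : Measurable h) :
    ∫⁻ x, (∫⁻ y, k x y * h y ∂ν) ^ (2 : ℝ) ∂μ ≤ K ^ (2 : ℝ) * ∫⁻ y, h y ^ (2 : ℝ) ∂ν := by
  have hkx : ∀ x, Measurable (k x) := fun x ↦ hk.comp measurable_prodMk_left
  have hroot : ∀ a : ℝ≥0∞, (a ^ (1 / 2 : ℝ)) ^ (2 : ℝ) = a := fun a ↦ by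
    rw [← ENNReal.rpow_mul]; simp
  have hcs : ∀ x, (∫⁻ y, k x y * h y ∂ν) ^ (2 : ℝ) ≤ K * ∫⁻ y, k x y * h y ^ (2 : ℝ) ∂ν := by
    intro x
    have h3 := ENNReal.lintegral_mul_le_Lp_mul_Lq ν Real.HolderConjugate.two_two
      (f := fun y ↦ k x y ^ (1 / 2 : ℝ)) (g := fun y ↦ k x y ^ (1 / 2 : ℝ) * h y)
      ((hkx x).pow_const _).aemeasurable (((hkx x).pow_const _).mul hh).aemeasurable
    have e1 : ∀ y, ((fun y ↦ k x y ^ (1 / 2 : ℝ)) * fun y ↦ k x y ^ (1 / 2 : ℝ) * h y) y =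
        k x y * h y := fun y ↦ by
      rw [Pi.mul_apply, ← mul_assoc, ← sq, ← ENNReal.rpow_natCast]
      exact congrArg (· * h y) (hroot _)
    simp_rw [e1, ENNReal.mul_rpow_of_nonneg _ _ zero_le_two, hroot] at h3
    calc _ ≤ _ := ENNReal.rpow_le_rpow h3 zero_le_two
      _ = (∫⁻ y, k x y ∂ν) * ∫⁻ y, k x y * h y ^ (2 : ℝ) ∂ν := by
        rw [ENNReal.mul_rpow_of_nonneg _ _ zero_le_two, hroot, hroot]
      _ ≤ _ := mul_le_mul' (h1 x) le_rfl
  calc _ ≤ ∫⁻ x, K * ∫⁻ y, k x y * h y ^ (2 : ℝ) ∂ν ∂μ := lintegral_mono hcs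
    _ = K * ∫⁻ x, ∫⁻ y, k x y * h y ^ (2 : ℝ) ∂ν ∂μ := by
      refine lintegral_const_mul _ (Measurable.lintegral_prod_right' (f := fun p : α × β ↦
        k p.1 p.2 * h p.2 ^ (2 : ℝ)) ?_)
      exact hk.mul ((hh.comp measurable_snd).pow_const _)
    _ = K * ∫⁻ y, ∫⁻ x, k x y * h y ^ (2 : ℝ) ∂μ ∂ν := by
      rw [lintegral_lintegral_swap]
      exact (hk.mul ((hh.comp measurable_snd).pow_const _)).aemeasurable
    _ = K * ∫⁻ y, (∫⁻ x, k x y ∂μ) * h y ^ (2 : ℝ) ∂ν := by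
      congr 1
      refine lintegral_congr fun y ↦ ?_
      exact lintegral_mul_const _ (hk.comp measurable_prodMk_right)
    _ ≤ K * ∫⁻ y, K * h y ^ (2 : ℝ) ∂ν := by
      gcongr with y
      exact h2 y
    _ = _ := by
      rw [lintegral_const_mul _ (hh.pow_const _), ← mul_assoc, ← sq, ← ENNReal.rpow_natCast]
      simp

/-- The kernel `u^{H - 3/2}` cut off outside `(0, ℓ]`. -/
noncomputable def cutKernel (H ℓ u : ℝ) : ℝ≥0∞ :=
  (Ioc 0 ℓ).indicator (fun u ↦ ENNReal.ofReal (u ^ (H - 3 / 2))) u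

lemma measurable_cutKernel (H ℓ : ℝ) : Measurable (cutKernel H ℓ) :=
  Measurable.indicator (by fun_prop) measurableSet_Ioc

variable {H s T : ℝ}

lemma lintegral_cutKernel_lt_top (hH : H ∈ Ioo (1 / 2 : ℝ) 1) (ℓ : ℝ) :
    ∫⁻ u, cutKernel H ℓ u < ∞ := by
  unfold cutKernel
  rw [lintegral_indicator measurableSet_Ioc]
  rcases le_total 0 ℓ with h | h
  · have hi := (intervalIntegral.intervalIntegrable_rpow' (a := 0) (b := ℓ)
      (by linarith [hH.1] : -1 < H - 3 / 2))
    rw [intervalIntegrable_iff_integrableOn_Ioc_of_le h] at hi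
    refine lt_of_le_of_lt (lintegral_mono fun u ↦ ?_) hi.2
    exact Real.ofReal_le_enorm _
  · simp [Ioc_eq_empty (not_lt.2 h)]

/-- The operator norm bound for the fractional integral. -/
lemma lintegral_cutKernel_mul_le {h : ℝ → ℝ≥0∞} (hh : Measurable h) (ℓ : ℝ) (D : Set ℝ) :
    ∫⁻ τ in D, (∫⁻ t in D, cutKernel H ℓ (t - τ) * h t) ^ (2 : ℝ) ≤
      (∫⁻ u, cutKernel H ℓ u) ^ (2 : ℝ) * ∫⁻ t in D, h t ^ (2 : ℝ) := by
  refine lintegral_schur_le (k := fun τ t ↦ cutKernel H ℓ (t - τ))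
    ((measurable_cutKernel H ℓ).comp (measurable_snd.sub measurable_fst)) (fun τ ↦ ?_)
    (fun t ↦ ?_) hh
  · refine (setLIntegral_le_lintegral _ _).trans_eq ?_
    exact lintegral_sub_right_eq_self (cutKernel H ℓ) τ
  · refine (setLIntegral_le_lintegral _ _).trans_eq ?_
    exact lintegral_sub_left_eq_self (cutKernel H ℓ) t

lemma cutKernel_mul_enorm {τ t : ℝ} (hτ : s ≤ τ) (ht : t ≤ T) (x : ℝ) :
    cutKernel H (T - s) (t - τ) * ‖x‖ₑ =
      (Ioc τ T).indicator (fun t ↦ ‖(t - τ) ^ (H - 3 / 2) * x‖ₑ) t := by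
  unfold cutKernel
  by_cases h : τ < t
  · rw [indicator_of_mem (mem_Ioc.2 ⟨by linarith, by linarith⟩),
      indicator_of_mem (mem_Ioc.2 ⟨h, ht⟩), enorm_mul,
      Real.enorm_of_nonneg (Real.rpow_nonneg (sub_nonneg.2 h.le) _)]
  · rw [indicator_of_notMem (fun h' ↦ h (by linarith [h'.1])),
      indicator_of_notMem (fun h' ↦ h h'.1), zero_mul]

/-- The cut-off kernel expresses the absolute integral behind `G_H`. -/
lemma lintegral_cutKernel_eq {τ : ℝ} (hτ : τ ∈ Icc s T) (g : ℝ → ℝ) :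
    ∫⁻ t in Icc s T, cutKernel H (T - s) (t - τ) * ‖g t‖ₑ =
      ∫⁻ t in Ioc τ T, ‖(t - τ) ^ (H - 3 / 2) * g t‖ₑ := by
  rw [setLIntegral_congr_fun measurableSet_Icc (g := (Ioc τ T).indicator
    fun t ↦ ‖(t - τ) ^ (H - 3 / 2) * g t‖ₑ)
    fun t ht ↦ (cutKernel_mul_enorm hτ.1 ht.2 (g t)).trans (by simp [indicator]),
    setLIntegral_indicator measurableSet_Ioc, inter_eq_left.2]
  exact fun t ht ↦ ⟨hτ.1.trans ht.1.le, ht.2⟩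

lemma intervalIntegrable_of_lintegral {τ : ℝ} (hτ : τ ∈ Icc s T) {g : ℝ → ℝ} (hg : Measurable g)
    (h : ∫⁻ t in Icc s T, cutKernel H (T - s) (t - τ) * ‖g t‖ₑ < ∞) :
    IntervalIntegrable (fun t ↦ (t - τ) ^ (H - 3 / 2) * g t) volume τ T := by
  rw [intervalIntegrable_iff_integrableOn_Ioc_of_le hτ.2]
  refine ⟨(Measurable.mul (by fun_prop) hg).aestronglyMeasurable, ?_⟩
  rw [HasFiniteIntegral, ← lintegral_cutKernel_eq hτ]
  exact h

lemma enorm_GH_le {τ : ℝ} (hτ : τ ∈ Icc s T) (g : ℝ → ℝ) :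
    ‖GH H T g τ‖ₑ ≤ ‖cH H * (H - 1 / 2)‖ₑ *
      ∫⁻ t in Icc s T, cutKernel H (T - s) (t - τ) * ‖g t‖ₑ := by
  rw [lintegral_cutKernel_eq hτ, GH, enorm_mul, intervalIntegral.integral_of_le hτ.2]
  gcongr
  exact enorm_integral_le_lintegral_enorm _

variable {Ω : Type*} [mΩ : MeasurableSpace Ω] {P : Measure Ω} [IsProbabilityMeasure P]

/-- Processes that agree almost everywhere have the same fractional integrals. -/
lemma GH_congr_ae {γ γ' : ℝ → Ω → ℝ}
    (h : ∀ᵐ p : ℝ × Ω ∂(volume.restrict (Icc s T)).prod P, γ p.1 p.2 = γ' p.1 p.2) :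
    ∀ᵐ p : ℝ × Ω ∂(volume.restrict (Icc s T)).prod P,
      GH H T (fun t ↦ γ t p.2) p.1 = GH H T (fun t ↦ γ' t p.2) p.1 ∧
      (IntervalIntegrable (fun t ↦ (t - p.1) ^ (H - 3 / 2) * γ t p.2) volume p.1 T ↔
        IntervalIntegrable (fun t ↦ (t - p.1) ^ (H - 3 / 2) * γ' t p.2) volume p.1 T) := by
  have h1 : ∀ᵐ ω ∂P, ∀ᵐ t ∂volume.restrict (Icc s T), γ t ω = γ' t ω :=
    Measure.ae_ae_of_ae_prod (Measure.measurePreserving_swap (μ := P)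
      (ν := volume.restrict (Icc s T)) |>.quasiMeasurePreserving.ae h)
  have h2 := (Measure.quasiMeasurePreserving_snd (μ := volume.restrict (Icc s T)) (ν := P)).ae h1
  have h3 := (Measure.quasiMeasurePreserving_fst (μ := volume.restrict (Icc s T)) (ν := P)).ae
    (ae_restrict_mem measurableSet_Icc)
  filter_upwards [h2, h3] with p hp hpm
  have h4 : (fun t ↦ (t - p.1) ^ (H - 3 / 2) * γ t p.2) =ᵐ[volume.restrict (uIoc p.1 T)]
      fun t ↦ (t - p.1) ^ (H - 3 / 2) * γ' t p.2 := by
    rw [uIoc_of_le hpm.2]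
    have hsub : Ioc p.1 T ⊆ Icc s T := fun t ht ↦ ⟨hpm.1.trans ht.1.le, ht.2⟩
    filter_upwards [ae_restrict_of_ae_restrict_of_subset hsub hp] with t ht
    rw [ht]
  constructor
  · rw [GH, GH, intervalIntegral.integral_congr_ae_restrict h4]
  · exact intervalIntegrable_congr_ae h4

/-- For almost every `(τ, ω)` the integral that defines `G_H` converges, and `G_H` is a bounded
operator in `L²`. -/
lemma GH_bound (hH : H ∈ Ioo (1 / 2 : ℝ) 1) {γ : ℝ → Ω → ℝ}
    (hγ : MemLp (fun p : ℝ × Ω ↦ γ p.1 p.2) 2 ((volume.restrict (Icc s T)).prod P)) :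
    (∀ᵐ p : ℝ × Ω ∂(volume.restrict (Icc s T)).prod P,
      IntervalIntegrable (fun t ↦ (t - p.1) ^ (H - 3 / 2) * γ t p.2) volume p.1 T) ∧
    eLpNorm (fun p : ℝ × Ω ↦ GH H T (fun t ↦ γ t p.2) p.1) 2
      ((volume.restrict (Icc s T)).prod P) ≤
      ‖cH H * (H - 1 / 2)‖ₑ * (∫⁻ u, cutKernel H (T - s) u) *
        eLpNorm (fun p : ℝ × Ω ↦ γ p.1 p.2) 2 ((volume.restrict (Icc s T)).prod P) := by
  set μ := volume.restrict (Icc s T) with hμ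
  wlog hm : Measurable (fun p : ℝ × Ω ↦ γ p.1 p.2) generalizing γ
  · obtain ⟨γ', hγ'm, he⟩ := hγ.1.aemeasurable
    have h1 := this (γ := fun t ω ↦ γ' (t, ω)) (hγ.ae_eq he) hγ'm
    have h2 := GH_congr_ae (H := H) (s := s) (T := T) (P := P) (γ := γ)
      (γ' := fun t ω ↦ γ' (t, ω)) he
    refine ⟨?_, ?_⟩
    · filter_upwards [h1.1, h2] with p hp hp2 using hp2.2.2 hp
    · rw [eLpNorm_congr_ae (h2.mono fun p hp ↦ hp.1), eLpNorm_congr_ae he]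
      exact h1.2
  set K := ∫⁻ u, cutKernel H (T - s) u with hK
  have hKfin : K < ∞ := lintegral_cutKernel_lt_top hH _
  let N : ℝ × Ω → ℝ≥0∞ := fun p ↦ ∫⁻ t, cutKernel H (T - s) (t - p.1) * ‖γ t p.2‖ₑ ∂μ
  have hN : Measurable N := by
    refine Measurable.lintegral_prod_right' (f := fun q : (ℝ × Ω) × ℝ ↦
      cutKernel H (T - s) (q.2 - q.1.1) * ‖γ q.2 q.1.2‖ₑ) ?_
    refine ((measurable_cutKernel _ _).comp (by fun_prop)).mul (Measurable.enorm ?_)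
    exact hm.comp (measurable_snd.prodMk (measurable_snd.comp measurable_fst))
  have hN2 : ∫⁻ p, N p ^ (2 : ℝ) ∂μ.prod P ≤
      K ^ (2 : ℝ) * ∫⁻ p : ℝ × Ω, ‖γ p.1 p.2‖ₑ ^ (2 : ℝ) ∂μ.prod P := by
    rw [lintegral_prod_symm _ (hN.pow_const _).aemeasurable,
      lintegral_prod_symm _ (hm.enorm.pow_const _).aemeasurable,
      ← lintegral_const_mul _ (Measurable.lintegral_prod_left' (hm.enorm.pow_const _))]
    exact lintegral_mono fun ω ↦ lintegral_cutKernel_mul_le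
      (hm.comp measurable_prodMk_right).enorm _ _
  have hγfin : ∫⁻ p : ℝ × Ω, ‖γ p.1 p.2‖ₑ ^ (2 : ℝ) ∂μ.prod P < ∞ :=
    lintegral_rpow_enorm_lt_top_of_eLpNorm_lt_top two_ne_zero ENNReal.ofNat_ne_top hγ.2
  have hNfin : ∀ᵐ p ∂μ.prod P, N p < ∞ := by
    have hlt := hN2.trans_lt (ENNReal.mul_lt_top
      (ENNReal.rpow_lt_top_of_nonneg zero_le_two hKfin.ne) hγfin)
    filter_upwards [ae_lt_top (hN.pow_const _) hlt.ne] with p hp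
    exact (ENNReal.rpow_lt_top_iff_of_pos zero_lt_two).1 hp
  have hmem := (Measure.quasiMeasurePreserving_fst (μ := μ) (ν := P)).ae
    (ae_restrict_mem measurableSet_Icc)
  constructor
  · filter_upwards [hNfin, hmem] with p hp hpm
    exact intervalIntegrable_of_lintegral hpm (hm.comp measurable_prodMk_right) hp
  · have hnorm : ∀ f : ℝ × Ω → ℝ, eLpNorm f 2 (μ.prod P) =
        (∫⁻ p, ‖f p‖ₑ ^ (2 : ℝ) ∂μ.prod P) ^ (1 / 2 : ℝ) := fun f ↦ by
      rw [eLpNorm_eq_lintegral_rpow_enorm_toReal two_ne_zero ENNReal.ofNat_ne_top]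
      simp
    have hroot : ∀ a : ℝ≥0∞, (a ^ (2 : ℝ)) ^ (1 / 2 : ℝ) = a := fun a ↦ by
      rw [← ENNReal.rpow_mul]; simp
    rw [hnorm, hnorm]
    calc _ ≤ (∫⁻ p, (‖cH H * (H - 1 / 2)‖ₑ * N p) ^ (2 : ℝ) ∂μ.prod P) ^ (1 / 2 : ℝ) := by
          refine ENNReal.rpow_le_rpow (lintegral_mono_ae ?_) (by norm_num)
          filter_upwards [hmem] with p hpm
          exact ENNReal.rpow_le_rpow (enorm_GH_le hpm _) zero_le_two
      _ = ‖cH H * (H - 1 / 2)‖ₑ * (∫⁻ p, N p ^ (2 : ℝ) ∂μ.prod P) ^ (1 / 2 : ℝ) := by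
          simp_rw [ENNReal.mul_rpow_of_nonneg _ _ (zero_le_two (α := ℝ))]
          rw [lintegral_const_mul _ (hN.pow_const _),
            ENNReal.mul_rpow_of_nonneg _ _ (by norm_num), hroot]
      _ ≤ ‖cH H * (H - 1 / 2)‖ₑ * (K ^ (2 : ℝ) *
          ∫⁻ p : ℝ × Ω, ‖γ p.1 p.2‖ₑ ^ (2 : ℝ) ∂μ.prod P) ^ (1 / 2 : ℝ) := by
          gcongr
      _ = _ := by
          rw [ENNReal.mul_rpow_of_nonneg _ _ (by norm_num), hroot, mul_assoc]

/-- `G_H` preserves joint measurability with respect to a sub-`σ`-algebra of events. -/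
lemma aestronglyMeasurable_GH {Ω : Type*} {m mΩ : MeasurableSpace Ω} {P : Measure Ω}
    [IsProbabilityMeasure P] {γ : ℝ → Ω → ℝ}
    (hγ : AEStronglyMeasurable[(borel ℝ).prod m] (fun p : ℝ × Ω ↦ γ p.1 p.2)
      ((volume.restrict (Icc s T)).prod P)) :
    AEStronglyMeasurable[(borel ℝ).prod m] (fun p : ℝ × Ω ↦ GH H T (fun t ↦ γ t p.2) p.1)
      ((volume.restrict (Icc s T)).prod P) := by
  obtain ⟨γ', hγ'm, he⟩ := hγ
  have h2 := GH_congr_ae (H := H) (s := s) (T := T) (P := P) (γ := γ)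
    (γ' := fun t ω ↦ γ' (t, ω)) he
  have hmem := (Measure.quasiMeasurePreserving_fst (μ := volume.restrict (Icc s T)) (ν := P)).ae
    (ae_restrict_mem measurableSet_Icc)
  refine ⟨fun p ↦ cH H * (H - 1 / 2) * ∫ t, (Ioc p.1 T).indicator
    (fun t ↦ (t - p.1) ^ (H - 3 / 2) * γ' (t, p.2)) t, ?_, ?_⟩
  · refine StronglyMeasurable.const_mul ?_ _
    let _ : MeasurableSpace Ω := m
    refine StronglyMeasurable.integral_prod_right' (f := fun q : (ℝ × Ω) × ℝ ↦
      (Ioc q.1.1 T).indicator (fun t ↦ (t - q.1.1) ^ (H - 3 / 2) * γ' (t, q.1.2)) q.2) ?_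
    refine Measurable.stronglyMeasurable ?_
    have hs : MeasurableSet {q : (ℝ × Ω) × ℝ | q.1.1 < q.2 ∧ q.2 ≤ T} := by
      have h1 : Measurable fun q : (ℝ × Ω) × ℝ ↦ q.1.1 := measurable_fst.comp measurable_fst
      exact (measurableSet_lt h1 measurable_snd).inter
        (measurableSet_le measurable_snd measurable_const)
    have hf : Measurable fun q : (ℝ × Ω) × ℝ ↦
        (q.2 - q.1.1) ^ (H - 3 / 2) * γ' (q.2, q.1.2) :=
      Measurable.mul (by fun_prop) (hγ'm.measurable.comp
        (measurable_snd.prodMk (measurable_snd.comp measurable_fst)))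
    exact hf.indicator hs
  · filter_upwards [h2, hmem] with p hp hpm
    rw [hp.1, GH, intervalIntegral.integral_of_le hpm.2, integral_indicator measurableSet_Ioc]

/-- `G_H` is linear wherever the integrals converge. -/
lemma GH_sub {τ : ℝ} {g g' : ℝ → ℝ}
    (hg : IntervalIntegrable (fun t ↦ (t - τ) ^ (H - 3 / 2) * g t) volume τ T)
    (hg' : IntervalIntegrable (fun t ↦ (t - τ) ^ (H - 3 / 2) * g' t) volume τ T) :
    GH H T (fun t ↦ g t - g' t) τ = GH H T g τ - GH H T g' τ := by
  simp_rw [GH, mul_sub]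
  rw [intervalIntegral.integral_sub hg hg', mul_sub]

lemma integral_rpow_mul_indicator (hH : H ∈ Ioo (1 / 2 : ℝ) 1) {τ a b : ℝ} (hτ : τ ≤ T)
    (hab : a ≤ b) (hb : b ≤ T) :
    IntervalIntegrable (fun t ↦ (t - τ) ^ (H - 3 / 2) * (Ioc a b).indicator (fun _ ↦ 1) t)
      volume τ T ∧
    (H - 1 / 2) * ∫ t in τ..T, (t - τ) ^ (H - 3 / 2) * (Ioc a b).indicator (fun _ ↦ 1) t =
      (max (b - τ) 0) ^ (H - 1 / 2) - (max (a - τ) 0) ^ (H - 1 / 2) := by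
  have h0 := sub_pos.2 hH.1
  have hexp : -1 < H - 3 / 2 := by linarith
  have hi : ∀ c d : ℝ, IntervalIntegrable (fun t ↦ (t - τ) ^ (H - 3 / 2)) volume c d := by
    intro c d
    have := (intervalIntegral.intervalIntegrable_rpow' (a := c - τ) (b := d - τ)
      hexp).comp_sub_right τ
    simpa using this
  have e : (fun t ↦ (t - τ) ^ (H - 3 / 2) * (Ioc a b).indicator (fun _ ↦ (1 : ℝ)) t) =
      (Ioc a b).indicator fun t ↦ (t - τ) ^ (H - 3 / 2) := by
    ext t
    by_cases h : t ∈ Ioc a b <;> simp [h]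
  have hset : Ioc τ T ∩ Ioc a b = Ioc (max a τ) (max b τ) := by
    ext t
    simp only [mem_inter_iff, mem_Ioc, max_lt_iff, le_max_iff]
    constructor
    · rintro ⟨⟨h1, _⟩, h3, h4⟩
      exact ⟨⟨h3, h1⟩, Or.inl h4⟩
    · rintro ⟨⟨h1, h2⟩, h3 | h3⟩
      · exact ⟨⟨h2, h3.trans hb⟩, h1, h3⟩
      · exact absurd h2 (not_lt.2 h3)
  rw [e]
  constructor
  · rw [intervalIntegrable_iff_integrableOn_Ioc_of_le hτ]
    exact ((intervalIntegrable_iff_integrableOn_Ioc_of_le hτ).1 (hi τ T)).indicator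
      measurableSet_Ioc
  · rw [intervalIntegral.integral_of_le hτ, setIntegral_indicator measurableSet_Ioc, hset,
      ← intervalIntegral.integral_of_le (max_le_max_right τ hab),
      intervalIntegral.integral_comp_sub_right (fun u ↦ u ^ (H - 3 / 2)) τ,
      integral_rpow (Or.inl hexp), show H - 3 / 2 + 1 = H - 1 / 2 by ring,
      mul_div_cancel₀ _ h0.ne', ← max_sub_sub_right,
      ← max_sub_sub_right, sub_self]

end Fractional

/-! ### The processes `W_H`, `R_H` and `𝒟R_H` -/

section Processes

variable {Ω : Type*} [mΩ : MeasurableSpace Ω] {B : ℝ → Ω → ℝ} {P : Measure Ω}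
  [IsProbabilityMeasure P] [P.IsComplete] {H s t T : ℝ}

lemma itoIntegrable_WH (hB : IsTwoSidedBrownian B P) (hH : H ∈ Ioo (1 / 2 : ℝ) 1) (s t : ℝ) :
    ItoIntegrable B P (Icc s t) (fun r _ ↦ (t - r) ^ (H - 1 / 2)) :=
  itoIntegrable_deterministic hB (exhausted_Icc s t) (memLp_rpow_sub_Icc hH s t)

lemma itoIntegrable_RH (hB : IsTwoSidedBrownian B P) (hH : H ∈ Ioo (1 / 2 : ℝ) 1) (hst : s ≤ t) :
    ItoIntegrable B P (Iic s) (fun r _ ↦ fKernel H s t r) :=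
  itoIntegrable_deterministic hB (exhausted_Iic s) (memLp_fKernel hH hst)

lemma memLp_deriv_fKernel (hH : H ∈ Ioo (1 / 2 : ℝ) 1) (hst : s < t) :
    MemLp (fun r ↦ deriv (fun u ↦ fKernel H s u r) t) 2 (volume.restrict (Iic s)) :=
  ((memLp_rpow_sub_Iic (by linarith [hH.2]) hst).const_mul _).ae_eq (deriv_fKernel_ae H hst).symm

lemma itoIntegrable_DRH (hB : IsTwoSidedBrownian B P) (hH : H ∈ Ioo (1 / 2 : ℝ) 1) (hst : s < t) :
    ItoIntegrable B P (Iic s) (fun r _ ↦ deriv (fun u ↦ fKernel H s u r) t) :=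
  itoIntegrable_deterministic hB (exhausted_Iic s) (memLp_deriv_fKernel hH hst)

lemma isItoIntegral_WH (hB : IsTwoSidedBrownian B P) (hH : H ∈ Ioo (1 / 2 : ℝ) 1) (s t : ℝ) :
    IsItoIntegral B P (Icc s t) (fun r _ ↦ cH H * (t - r) ^ (H - 1 / 2)) (WH B P H s t) :=
  (itoIntegrable_WH hB hH s t).isItoIntegral.const_mul hB _

lemma isItoIntegral_RH (hB : IsTwoSidedBrownian B P) (hH : H ∈ Ioo (1 / 2 : ℝ) 1) (hst : s ≤ t) :
    IsItoIntegral B P (Iic s) (fun r _ ↦ cH H * fKernel H s t r) (RH B P H s t) :=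
  (itoIntegrable_RH hB hH hst).isItoIntegral.const_mul hB _

lemma isItoIntegral_DRH (hB : IsTwoSidedBrownian B P) (hH : H ∈ Ioo (1 / 2 : ℝ) 1)
    (hst : s < t) : IsItoIntegral B P (Iic s)
      (fun r _ ↦ cH H * (H - 1 / 2) * (t - r) ^ (H - 3 / 2)) (DRH B P H s t) := by
  refine ((itoIntegrable_DRH hB hH hst).isItoIntegral.const_mul hB (cH H)).congr ?_ ae_eq_rfl
  filter_upwards [(Measure.quasiMeasurePreserving_fst (μ := volume.restrict (Iic s))
    (ν := P)).ae (deriv_fKernel_ae H hst)] with p hp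
  rw [hp, mul_assoc]

/-- The increment of fractional Brownian motion splits at time `s`. -/
lemma fractional_increment_ae_eq (hB : IsTwoSidedBrownian B P) (hH : H ∈ Ioo (1 / 2 : ℝ) 1)
    {BH : ℝ → Ω → ℝ} (hBH : IsFractionalBrownian BH B P H) (hst : s ≤ t) :
    ∀ᵐ ω ∂P, BH t ω - BH s ω = WH B P H s t ω + RH B P H s t ω := by
  have hm : ∀ u, IsItoIntegral B P univ (fun r _ ↦ cH H * mvnKernel H u r)
      (fun ω ↦ cH H * itoIntegral B P univ (fun r _ ↦ mvnKernel H u r) ω) := fun u ↦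
    (itoIntegrable_deterministic hB exhausted_univ
      (by simpa using memLp_mvnKernel hH u)).isItoIntegral.const_mul hB _
  have h1 := (hm t).sub hB (hm s)
  have h2 := ((isItoIntegral_WH hB hH s t).mono_set hB measurableSet_Icc (subset_univ _)).add hB
    ((isItoIntegral_RH hB hH hst).mono_set hB measurableSet_Iic (subset_univ _))
  have h3 := h1.congr (ψ := fun r ω ↦
    (Icc s t).indicator (fun r ↦ cH H * (t - r) ^ (H - 1 / 2)) r +
      (Iic s).indicator (fun r ↦ cH H * fKernel H s t r) r) ?_ ae_eq_rfl
  · filter_upwards [h3.ae_eq hB h2, hBH t, hBH s] with ω hω ht hs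
    rw [ht, hs]
    exact hω
  · have hae := posPart_rpow_sub_ae hH hst
    rw [← Measure.restrict_univ (μ := volume)] at hae
    filter_upwards [(Measure.quasiMeasurePreserving_fst (μ := volume.restrict univ)
      (ν := P)).ae hae] with p hp
    simp only [mvnKernel, indicator_const_mul] at hp ⊢
    linear_combination cH H * hp

lemma measurable_history_RH (hB : IsTwoSidedBrownian B P) (hH : H ∈ Ioo (1 / 2 : ℝ) 1)
    (hst : s ≤ t) : Measurable[history B P s] (RH B P H s t) :=
  (isItoIntegral_RH hB hH hst).measurable_history hB subset_rfl

lemma measurable_future_WH (hB : IsTwoSidedBrownian B P) (hH : H ∈ Ioo (1 / 2 : ℝ) 1) (s t : ℝ) :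
    Measurable[future B P s] (WH B P H s t) :=
  (isItoIntegral_WH hB hH s t).measurable_future hB Icc_subset_Ici_self (exhausted_Icc s t)
    ((memLp_rpow_sub_Icc hH s t).const_mul _)

/-- Integrals of deterministic functions over a common time set form a Gaussian process. -/
lemma isGaussianProcess_of_isItoIntegral (hB : IsTwoSidedBrownian B P) {D : Set ℝ}
    [D.OrdConnected] (hD : Exhausted D) {ι : Type*} {g : ι → ℝ → ℝ} {X : ι → Ω → ℝ}
    (hg : ∀ i, MemLp (g i) 2 (volume.restrict D))
    (hX : ∀ i, IsItoIntegral B P D (fun r _ ↦ g i r) (X i)) : IsGaussianProcess X P where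
  hasGaussianLaw I := by
    classical
    have hXm : ∀ i, AEMeasurable (X i) P := fun i ↦ (hX i).memLp_integral.1.aemeasurable
    have hm : AEMeasurable (fun ω ↦ I.restrict (X · ω)) P :=
      aemeasurable_pi_lambda _ fun i ↦ hXm i
    constructor
    refine isGaussian_of_isGaussian_map fun L ↦ ?_
    have hsum := IsItoIntegral.finsetSum hB Finset.univ (fun (i : I) _ ↦
      (hX i).const_mul hB (L (Pi.single i 1)))
    have hlaw := IsItoIntegral.hasGaussianLaw hB hD
      (memLp_finsetSum _ fun (i : I) _ ↦ (hg i).const_mul (L (Pi.single i 1))) hsum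
    have e : (L ∘ fun ω ↦ I.restrict (X · ω)) =
        fun ω ↦ ∑ i : I, L (Pi.single i 1) * X i ω := by
      ext ω
      rw [Function.comp_apply, ← Finset.univ_sum_single (I.restrict (X · ω)), map_sum]
      refine Finset.sum_congr rfl fun i _ ↦ ?_
      have h1 : Pi.single i (I.restrict (X · ω) i) =
          (X i ω) • (Pi.single i 1 : I → ℝ) := by
        ext j
        by_cases h : j = i
        · subst h; simp
        · simp [h]
      rw [h1, map_smul, smul_eq_mul, mul_comm]
    rw [AEMeasurable.map_map_of_aemeasurable (by fun_prop) hm, e]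
    exact hlaw.isGaussian_map

/-- `W_H(t)` as an integral over `[s, T]`. -/
lemma isItoIntegral_WH_Icc (hB : IsTwoSidedBrownian B P) (hH : H ∈ Ioo (1 / 2 : ℝ) 1)
    (htT : t ≤ T) : IsItoIntegral B P (Icc s T)
      (fun r _ ↦ cH H * (max (t - r) 0) ^ (H - 1 / 2)) (WH B P H s t) := by
  refine ((isItoIntegral_WH hB hH s t).mono_set hB measurableSet_Icc
    (Icc_subset_Icc_right htT)).congr ?_ ae_eq_rfl
  filter_upwards [(Measure.quasiMeasurePreserving_fst (μ := volume.restrict (Icc s T))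
    (ν := P)).ae (ae_restrict_mem measurableSet_Icc)] with p hp
  by_cases h : p.1 ≤ t
  · rw [indicator_of_mem (mem_Icc.2 ⟨hp.1, h⟩), max_eq_left (sub_nonneg.2 h)]
  · rw [indicator_of_notMem (fun h' ↦ h h'.2), max_eq_right (by linarith),
      Real.zero_rpow (sub_pos.2 hH.1).ne', mul_zero]

lemma isGaussianProcess_WH (hB : IsTwoSidedBrownian B P) (hH : H ∈ Ioo (1 / 2 : ℝ) 1) :
    IsGaussianProcess (fun t : Ioi s ↦ WH B P H s t) P := by
  refine isGaussianProcess_of_isItoIntegral hB exhausted_univ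
    (g := fun t : Ioi s ↦ (Icc s t).indicator fun r ↦ cH H * (t - r) ^ (H - 1 / 2))
    (fun t ↦ ?_) fun t ↦ (isItoIntegral_WH hB hH s t).mono_set hB measurableSet_Icc (subset_univ _)
  rw [Measure.restrict_univ]
  exact (memLp_indicator_iff_restrict measurableSet_Icc).2
    ((memLp_rpow_sub_Icc hH s t).const_mul _)

lemma isGaussianProcess_RH (hB : IsTwoSidedBrownian B P) (hH : H ∈ Ioo (1 / 2 : ℝ) 1) :
    IsGaussianProcess (fun t : Ioi s ↦ RH B P H s t) P :=
  isGaussianProcess_of_isItoIntegral hB (exhausted_Iic s)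
    (fun t : Ioi s ↦ (memLp_fKernel hH (le_of_lt t.2)).const_mul (cH H))
    fun t ↦ isItoIntegral_RH hB hH (le_of_lt t.2)

end Processes

/-! ### Integration with respect to `W_H` -/

section IntegralWH

variable {Ω : Type*} [mΩ : MeasurableSpace Ω] {B : ℝ → Ω → ℝ} {P : Measure Ω}
  [IsProbabilityMeasure P] [P.IsComplete] {H s t T : ℝ}

lemma GH_eval {Ω : Type*} (hH : H ∈ Ioo (1 / 2 : ℝ) 1) {𝓐 : ℝ → MeasurableSpace Ω}
    (S : SimpleIntegrand 𝓐 (Icc s T)) {τ : ℝ} (hτ : τ ≤ T) (ω : Ω) :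
    GH H T (fun t ↦ S.eval t ω) τ = ∑ i, S.coef i ω *
      (cH H * (max (S.right i - τ) 0) ^ (H - 1 / 2) -
        cH H * (max (S.left i - τ) 0) ^ (H - 1 / 2)) := by
  have h := fun i ↦ integral_rpow_mul_indicator hH hτ (S.left_le_right i) (S.right_mem i).2
  have e : ∀ t, (t - τ) ^ (H - 3 / 2) * S.eval t ω = ∑ i, S.coef i ω *
      ((t - τ) ^ (H - 3 / 2) * (Ioc (S.left i) (S.right i)).indicator (fun _ ↦ 1) t) := by
    intro t
    rw [SimpleIntegrand.eval, Finset.mul_sum]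
    refine Finset.sum_congr rfl fun i _ ↦ ?_
    by_cases ht : t ∈ Ioc (S.left i) (S.right i)
    · rw [indicator_of_mem ht, indicator_of_mem ht]; ring
    · rw [indicator_of_notMem ht, indicator_of_notMem ht]; ring
  simp_rw [GH, e]
  rw [intervalIntegral.integral_finsetSum fun i _ ↦ (h i).1.const_mul _, Finset.mul_sum]
  refine Finset.sum_congr rfl fun i _ ↦ ?_
  rw [intervalIntegral.integral_const_mul]
  linear_combination (S.coef i ω * cH H) * (h i).2

/-- For simple processes the integral against `W_H` is an Itô integral. -/
lemma isItoIntegral_integral_WH (hB : IsTwoSidedBrownian B P) (hH : H ∈ Ioo (1 / 2 : ℝ) 1)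
    (S : SimpleIntegrand (fun _ ↦ history B P s) (Icc s T)) :
    IsItoIntegral B P (Icc s T) (fun τ ω ↦ GH H T (fun t ↦ S.eval t ω) τ)
      (S.integral (WH B P H s)) := by
  have h := IsItoIntegral.finsetSum hB Finset.univ fun i _ ↦
    ((isItoIntegral_WH_Icc (s := s) hB hH (S.right_mem i).2).sub hB
      (isItoIntegral_WH_Icc hB hH (S.left_mem i).2)).mul hB (ξ := S.coef i)
      (fun a ha ↦ (S.measurable_coef i).mono (history_mono B P ha.1) le_rfl)
      ((S.measurable_coef i).mono (hB.history_le s) le_rfl) (S.bounded_coef i)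
  refine h.congr ?_ ae_eq_rfl
  filter_upwards [(Measure.quasiMeasurePreserving_fst (μ := volume.restrict (Icc s T))
    (ν := P)).ae (ae_restrict_mem measurableSet_Icc)] with p hp
  rw [GH_eval hH S hp.2]

variable {γ : ℝ → Ω → ℝ}

/-- `G_H` maps square integrable `𝒢_s`-measurable processes to Itô integrable ones. -/
lemma itoIntegrable_GH (hB : IsTwoSidedBrownian B P) (hH : H ∈ Ioo (1 / 2 : ℝ) 1)
    (hγm : AEStronglyMeasurable[(borel ℝ).prod (history B P s)] (fun p : ℝ × Ω ↦ γ p.1 p.2)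
      ((volume.restrict (Icc s T)).prod P))
    (hγ : MemLp (fun p : ℝ × Ω ↦ γ p.1 p.2) 2 ((volume.restrict (Icc s T)).prod P)) :
    ItoIntegrable B P (Icc s T) (fun τ ω ↦ GH H T (fun t ↦ γ t ω) τ) := by
  have hm := aestronglyMeasurable_GH (H := H) hγm
  have hle : (borel ℝ).prod (history B P s) ≤ (borel ℝ).prod mΩ :=
    sup_le_sup le_rfl (MeasurableSpace.comap_mono (hB.history_le s))
  have hL : MemLp (fun p : ℝ × Ω ↦ GH H T (fun t ↦ γ t p.2) p.1) 2
      ((volume.restrict (Icc s T)).prod P) := by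
    refine ⟨hm.mono hle, (GH_bound hH hγ).2.trans_lt ?_⟩
    exact ENNReal.mul_lt_top (ENNReal.mul_lt_top enorm_lt_top
      (lintegral_cutKernel_lt_top hH _)) hγ.2
  exact itoIntegrable_of_approximable hB hL (approximable_of_memLp (hB.history_le s)
    (fun a ha ↦ history_mono B P ha.1) (fun a _ ↦ hB.history_le a) (exhausted_Icc s T) hL hm)

/-- The integral of `γ` against `W_H` is the Itô integral of `G_H γ`: both sides agree on simple
processes and are continuous in `L²`. -/
lemma isStochIntegral_WH (hB : IsTwoSidedBrownian B P) (hH : H ∈ Ioo (1 / 2 : ℝ) 1)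
    (hγm : AEStronglyMeasurable[(borel ℝ).prod (history B P s)] (fun p : ℝ × Ω ↦ γ p.1 p.2)
      ((volume.restrict (Icc s T)).prod P))
    (hγ : MemLp (fun p : ℝ × Ω ↦ γ p.1 p.2) 2 ((volume.restrict (Icc s T)).prod P)) :
    IsStochIntegral (WH B P H s) (fun _ ↦ history B P s) P (Icc s T) γ
      (itoIntegral B P (Icc s T) (fun τ ω ↦ GH H T (fun t ↦ γ t ω) τ)) where
  memLp_integrand := hγ
  memLp_integral := memLp_itoIntegral
  exists_approx := Approximable.exists_approximates (approximable_of_memLp (hB.history_le s)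
    (fun _ _ ↦ le_rfl) (fun _ _ ↦ hB.history_le s) (exhausted_Icc s T) hγ hγm)
  tendsto S hS := by
    have hI := (itoIntegrable_GH hB hH hγm hγ).isItoIntegral
    have hSm := fun k ↦ (S k).memLp_eval (P := P) fun _ _ ↦ hB.history_le s
    have hle : ∀ k, eLpNorm (fun ω ↦ (S k).integral (WH B P H s) ω -
        itoIntegral B P (Icc s T) (fun τ ω ↦ GH H T (fun t ↦ γ t ω) τ) ω) 2 P ≤
        ‖cH H * (H - 1 / 2)‖ₑ * (∫⁻ u, cutKernel H (T - s) u) *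
        eLpNorm (fun p : ℝ × Ω ↦ (S k).eval p.1 p.2 - γ p.1 p.2) 2
          ((volume.restrict (Icc s T)).prod P) := fun k ↦ by
      rw [((isItoIntegral_integral_WH hB hH (S k)).sub hB hI).eLpNorm_eq hB]
      refine le_trans (le_of_eq (eLpNorm_congr_ae ?_))
        (GH_bound hH (γ := fun t ω ↦ (S k).eval t ω - γ t ω) ((hSm k).sub hγ)).2
      filter_upwards [(GH_bound hH (hSm k)).1, (GH_bound hH hγ).1] with p hp hp'
      exact (GH_sub hp hp').symm
    have h2 := ENNReal.Tendsto.const_mul (a := ‖cH H * (H - 1 / 2)‖ₑ *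
      ∫⁻ u, cutKernel H (T - s) u) hS (Or.inr (ENNReal.mul_ne_top enorm_ne_top
        (lintegral_cutKernel_lt_top hH _).ne))
    rw [mul_zero] at h2
    exact tendsto_of_tendsto_of_tendsto_of_le_of_le tendsto_const_nhds h2 (fun _ ↦ zero_le) hle

lemma memLp_WH {Ω : Type*} [MeasurableSpace Ω] {B : ℝ → Ω → ℝ} {P : Measure Ω}
    (H s t : ℝ) : MemLp (WH B P H s t) 2 P := memLp_itoIntegral.const_mul _

end IntegralWH

/-! ### The mean derivative of `R_H` -/

section MeanDerivative

variable {Ω : Type*} [mΩ : MeasurableSpace Ω] {B : ℝ → Ω → ℝ} {P : Measure Ω}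
  [IsProbabilityMeasure P] [P.IsComplete] {H s t T : ℝ}

lemma tendsto_RH_slope (hB : IsTwoSidedBrownian B P) (hH : H ∈ Ioo (1 / 2 : ℝ) 1)
    (hst : s < t) : Tendsto (fun δ : ℝ ↦ eLpNorm (fun ω ↦
      (RH B P H s (t + δ) ω - RH B P H s t ω) / δ - DRH B P H s t ω) 1 P) (𝓝[≠] 0) (𝓝 0) := by
  have h := ENNReal.Tendsto.const_mul (a := ‖cH H‖ₑ) (tendsto_fKernel_slope hH hst)
    (Or.inr enorm_ne_top)
  rw [mul_zero] at h
  refine tendsto_of_tendsto_of_tendsto_of_le_of_le' tendsto_const_nhds h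
    (Eventually.of_forall fun _ ↦ zero_le) ?_
  have hev : ∀ᶠ δ : ℝ in 𝓝[≠] 0, s < t + δ := by
    refine eventually_nhdsWithin_of_eventually_nhds ?_
    have : Tendsto (fun δ : ℝ ↦ t + δ) (𝓝 0) (𝓝 (t + 0)) := by
      exact (continuous_const.add continuous_id).tendsto 0
    exact this.eventually (lt_mem_nhds (by simpa using hst))
  filter_upwards [hev] with δ hδ
  have hI := ((((isItoIntegral_RH hB hH hδ.le).sub hB (isItoIntegral_RH hB hH hst.le)).const_mul
    hB δ⁻¹).sub hB (isItoIntegral_DRH hB hH hst))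
  have hI' := hI.congr (ψ := fun r _ ↦ cH H * ((fKernel H s (t + δ) r - fKernel H s t r) / δ -
      (H - 1 / 2) * (t - r) ^ (H - 3 / 2)))
    (Y := fun ω ↦ (RH B P H s (t + δ) ω - RH B P H s t ω) / δ - DRH B P H s t ω)
    (Eventually.of_forall fun p ↦ by ring) (Eventually.of_forall fun ω ↦ by ring)
  have hmeas : AEStronglyMeasurable (fun r ↦ cH H *
      ((fKernel H s (t + δ) r - fKernel H s t r) / δ - (H - 1 / 2) * (t - r) ^ (H - 3 / 2)))
      (volume.restrict (Iic s)) :=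
    (((((measurable_fKernel _ _ _).sub (measurable_fKernel _ _ _)).div_const _).sub
      ((measurable_sub_rpow _ _).const_mul _)).const_mul _).aestronglyMeasurable
  calc _ ≤ _ := eLpNorm_le_eLpNorm_of_exponent_le one_le_two hI'.memLp_integral.1
    _ = _ := hI'.eLpNorm_eq_deterministic hB hmeas
    _ = _ := eLpNorm_const_smul (cH H) _ _ _

lemma integral_DRH_sq (hB : IsTwoSidedBrownian B P) (hH : H ∈ Ioo (1 / 2 : ℝ) 1)
    (hst : s < t) : ∫ ω, DRH B P H s t ω ^ 2 ∂P =
      cH H ^ 2 * ((H - 1 / 2) ^ 2 / (2 - 2 * H)) * (t - s) ^ (2 * H - 2) := by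
  have hI := isItoIntegral_DRH hB hH hst
  have hg := (memLp_rpow_sub_Iic (p := H - 3 / 2) (by linarith [hH.2]) hst).const_mul
    (cH H * (H - 1 / 2))
  have h := hI.eLpNorm_eq_deterministic hB hg.1
  rw [eLpNorm_two_eq hI.memLp_integral, eLpNorm_two_eq hg,
    ENNReal.ofReal_eq_ofReal_iff (Real.sqrt_nonneg _) (Real.sqrt_nonneg _),
    Real.sqrt_inj (integral_nonneg fun _ ↦ sq_nonneg _)
      (integral_nonneg fun _ ↦ sq_nonneg _)] at h
  rw [h]
  simp_rw [mul_pow]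
  rw [integral_const_mul, integral_rpow_sub_sq_Iic hH hst]
  ring

/-- Summable `L²` distances force almost sure convergence. -/
lemma ae_tendsto_of_eLpNorm_sub_le {P : Measure Ω} [IsProbabilityMeasure P]
    {Z : ℕ → Ω → ℝ} {Y : Ω → ℝ}
    (hZ : ∀ n, AEStronglyMeasurable (Z n) P)
    (hY : AEStronglyMeasurable Y P) {C : ℝ≥0∞} (hC : C ≠ ∞)
    (h : ∀ n, eLpNorm (fun ω ↦ Z n ω - Y ω) 2 P ≤ C * 2⁻¹ ^ n) :
    ∀ᵐ ω ∂P, Tendsto (fun n ↦ Z n ω) atTop (𝓝 (Y ω)) := by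
  have h1 : ∀ n, ∫⁻ ω, ‖Z n ω - Y ω‖ₑ ∂P ≤ C * 2⁻¹ ^ n := fun n ↦ by
    rw [← eLpNorm_one_eq_lintegral_enorm]
    exact (eLpNorm_le_eLpNorm_of_exponent_le one_le_two ((hZ n).sub hY)).trans (h n)
  have hm : ∀ n, AEMeasurable (fun ω ↦ ‖Z n ω - Y ω‖ₑ) P := fun n ↦ ((hZ n).sub hY).enorm
  have h2 : ∫⁻ ω, ∑' n, ‖Z n ω - Y ω‖ₑ ∂P ≠ ∞ := by
    rw [lintegral_tsum hm]
    refine ((ENNReal.tsum_le_tsum h1).trans_lt ?_).ne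
    rw [ENNReal.tsum_mul_left, ENNReal.tsum_geometric]
    exact ENNReal.mul_lt_top hC.lt_top (by simp)
  filter_upwards [ae_lt_top' (AEMeasurable.tsum hm) h2] with ω hω
  rw [tendsto_iff_edist_tendsto_0]
  simpa only [edist_eq_enorm_sub] using ENNReal.tendsto_atTop_zero_of_tsum_ne_top hω.ne

/-- The discretization `(⌊2ⁿ t⌋ + 1) / 2ⁿ` of time, which approaches `t` from above. -/
noncomputable def dyadicAbove (n : ℕ) (t : ℝ) : ℝ := (⌊2 ^ n * t⌋ + 1) / 2 ^ n

lemma lt_dyadicAbove (n : ℕ) (t : ℝ) : t < dyadicAbove n t := by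
  rw [dyadicAbove, lt_div_iff₀ (by positivity), mul_comm]
  exact Int.lt_floor_add_one _

lemma dyadicAbove_sub_le (n : ℕ) (t : ℝ) : dyadicAbove n t - t ≤ 2⁻¹ ^ n := by
  have h2 : (0 : ℝ) < 2 ^ n := by positivity
  rw [dyadicAbove, inv_pow, inv_eq_one_div, sub_le_iff_le_add, div_le_iff₀ h2, add_mul,
    div_mul_cancel₀ _ h2.ne']
  linarith [Int.floor_le (2 ^ n * t), mul_comm t (2 ^ n)]

/-- A process that is locally Lipschitz from the right as a map into `L²` has a jointly measurable
version, the pointwise limit superior of its dyadic discretizations. -/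
lemma exists_measurable_version {P : Measure Ω} [IsProbabilityMeasure P] {Z : ℝ → Ω → ℝ}
    (hZm : ∀ t, s < t → Measurable (Z t))
    (hZ : ∀ t, s < t → ∃ C : ℝ≥0∞, C ≠ ∞ ∧ ∀ u, t ≤ u →
      eLpNorm (fun ω ↦ Z u ω - Z t ω) 2 P ≤ C * ENNReal.ofReal (u - t)) :
    ∃ D : ℝ → Ω → ℝ, Measurable (fun p : ℝ × Ω ↦ D p.1 p.2) ∧ ∀ t, s < t → D t =ᵐ[P] Z t := by
  classical
  let Z' : ℝ → Ω → ℝ := fun t ↦ if s < t then Z t else 0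
  have hZ'm : ∀ t, Measurable (Z' t) := fun t ↦ by
    by_cases h : s < t
    · simpa [Z', h] using hZm t h
    · simpa [Z', h] using measurable_zero
  refine ⟨fun t ω ↦ limsup (fun n ↦ Z' (dyadicAbove n t) ω) atTop, ?_, fun t ht ↦ ?_⟩
  · refine Measurable.limsup fun n ↦ ?_
    have h1 : Measurable fun q : ℤ × Ω ↦ Z' ((q.1 + 1) / 2 ^ n) q.2 :=
      measurable_from_prod_countable_right fun k ↦ hZ'm ((k + 1) / 2 ^ n)
    have h2 : Measurable fun p : ℝ × Ω ↦ ((⌊2 ^ n * p.1⌋ : ℤ), p.2) :=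
      (Int.measurable_floor.comp (measurable_fst.const_mul _)).prodMk measurable_snd
    exact h1.comp h2
  · obtain ⟨C, hC, hle⟩ := hZ t ht
    have hlim := ae_tendsto_of_eLpNorm_sub_le (P := P) (Z := fun n ↦ Z' (dyadicAbove n t))
      (Y := Z t) (fun n ↦ (hZ'm _).aestronglyMeasurable) (hZm t ht).aestronglyMeasurable hC
      fun n ↦ ?_
    · filter_upwards [hlim] with ω hω using hω.limsup_eq
    · have hlt := lt_dyadicAbove n t
      simp only [Z', if_pos (ht.trans hlt)]
      refine (hle _ hlt.le).trans (mul_le_mul' le_rfl ?_)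
      refine (ENNReal.ofReal_le_ofReal (dyadicAbove_sub_le n t)).trans_eq ?_
      rw [ENNReal.ofReal_pow (by norm_num), ENNReal.ofReal_inv_of_pos zero_lt_two]
      simp

lemma exists_measurable_version_DRH (hB : IsTwoSidedBrownian B P)
    (hH : H ∈ Ioo (1 / 2 : ℝ) 1) :
    ∃ D : ℝ → Ω → ℝ, Measurable (fun p : ℝ × Ω ↦ D p.1 p.2) ∧
      ∀ t, s < t → D t =ᵐ[P] DRH B P H s t := by
  refine exists_measurable_version (fun t ht ↦ ?_) fun t ht ↦ ?_
  · exact ((isItoIntegral_DRH hB hH ht).measurable_history hB subset_rfl).mono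
      (hB.history_le s) le_rfl
  · obtain ⟨C, hC, hle⟩ := eLpNorm_rpow_sub_sub_le hH ht
    refine ⟨‖cH H * (H - 1 / 2)‖ₑ * C, ENNReal.mul_ne_top enorm_ne_top hC, fun u hu ↦ ?_⟩
    have hI := ((isItoIntegral_DRH hB hH (ht.trans_le hu)).sub hB
      (isItoIntegral_DRH hB hH ht)).congr (ψ := fun r _ ↦ cH H * (H - 1 / 2) *
        ((u - r) ^ (H - 3 / 2) - (t - r) ^ (H - 3 / 2)))
        (Eventually.of_forall fun p ↦ by ring) ae_eq_rfl
    rw [hI.eLpNorm_eq_deterministic hB (((measurable_sub_rpow _ _).sub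
      (measurable_sub_rpow _ _)).const_mul _).aestronglyMeasurable, mul_assoc]
    refine (eLpNorm_const_smul (cH H * (H - 1 / 2)) _ _ _).trans_le ?_
    exact mul_le_mul' le_rfl (hle u hu)

/-- The energy of every jointly measurable version of `𝒟R_H`. -/
lemma energy_DRH (hB : IsTwoSidedBrownian B P) (hH : H ∈ Ioo (1 / 2 : ℝ) 1) {D : ℝ → Ω → ℝ}
    (hD : AEStronglyMeasurable (fun p : ℝ × Ω ↦ D p.1 p.2) ((volume.restrict (Ioi s)).prod P))
    (hDe : ∀ t, s < t → D t =ᵐ[P] DRH B P H s t) (hst : s < t) :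
    Integrable (fun p : ℝ × Ω ↦ D p.1 p.2 ^ 2) ((volume.restrict (Ioc s t)).prod P) ∧
      ∫ ω, (∫ r in s..t, D r ω ^ 2) ∂P =
        cH H ^ 2 * (H - 1 / 2) / (2 * (2 - 2 * H)) * (t - s) ^ (2 * H - 1) := by
  have hexp : -1 < 2 * H - 2 := by linarith [hH.1]
  have hac : (volume.restrict (Ioc s t)).prod P ≪ (volume.restrict (Ioi s)).prod P :=
    (Measure.absolutelyContinuous_of_le
      (Measure.restrict_mono Ioc_subset_Ioi_self le_rfl)).prod Measure.AbsolutelyContinuous.rfl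
  have hm : AEStronglyMeasurable (fun p : ℝ × Ω ↦ D p.1 p.2 ^ 2)
      ((volume.restrict (Ioc s t)).prod P) := (hD.mono_ac hac).pow 2
  have hpow : IntervalIntegrable (fun r ↦ (r - s) ^ (2 * H - 2)) volume s t := by
    have := (intervalIntegral.intervalIntegrable_rpow' (a := s - s) (b := t - s)
      hexp).comp_sub_right s
    simpa using this
  have hinner : ∀ r, s < r → ∫ ω, D r ω ^ 2 ∂P =
      cH H ^ 2 * ((H - 1 / 2) ^ 2 / (2 - 2 * H)) * (r - s) ^ (2 * H - 2) := fun r hr ↦ by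
    rw [← integral_DRH_sq hB hH hr]
    refine integral_congr_ae ?_
    filter_upwards [hDe r hr] with ω hω
    rw [hω]
  have hint : Integrable (fun p : ℝ × Ω ↦ D p.1 p.2 ^ 2) ((volume.restrict (Ioc s t)).prod P) := by
    rw [integrable_prod_iff hm]
    constructor
    · filter_upwards [ae_restrict_mem measurableSet_Ioc] with r hr
      exact ((isItoIntegral_DRH hB hH hr.1).memLp_integral.ae_eq (hDe r hr.1).symm).integrable_sq
    · have h1 := (intervalIntegrable_iff_integrableOn_Ioc_of_le hst.le).1
        (hpow.const_mul (cH H ^ 2 * ((H - 1 / 2) ^ 2 / (2 - 2 * H))))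
      refine h1.congr ?_
      filter_upwards [ae_restrict_mem measurableSet_Ioc] with r hr
      rw [← hinner r hr.1]
      simp
  refine ⟨hint, ?_⟩
  simp_rw [intervalIntegral.integral_of_le hst.le]
  rw [← integral_integral_swap (f := fun r ω ↦ D r ω ^ 2) hint,
    setIntegral_congr_fun measurableSet_Ioc fun r hr ↦ hinner r hr.1,
    ← intervalIntegral.integral_of_le hst.le, intervalIntegral.integral_const_mul,
    intervalIntegral.integral_comp_sub_right (fun u ↦ u ^ (2 * H - 2)) s,
    integral_rpow (Or.inl hexp), sub_self, show 2 * H - 2 + 1 = 2 * H - 1 by ring,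
    Real.zero_rpow (by linarith [hH.1])]
  have h1 : 2 * H - 1 ≠ 0 := by linarith [hH.1]
  have h2 : 2 - 2 * H ≠ 0 := by linarith [hH.2]
  field_simp
  ring

end MeanDerivative

end FBM

theorem proposition1 {Ω : Type*} [mΩ : MeasurableSpace Ω]
    (P : Measure Ω) [IsProbabilityMeasure P] [P.IsComplete]
    (B : ℝ → Ω → ℝ) (hB : FBM.IsTwoSidedBrownian B P)
    (H : ℝ) (hH : H ∈ Ioo (1 / 2 : ℝ) 1)
    (BH : ℝ → Ω → ℝ) (hBH : FBM.IsFractionalBrownian BH B P H)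
    (s T : ℝ) (hsT : s < T) :
    -- the integrals that define `W_H`, `R_H` and `𝒟R_H` exist
    (∀ t, s ≤ t → FBM.ItoIntegrable B P (Icc s t) (fun r _ ↦ (t - r) ^ (H - 1 / 2))) ∧
    (∀ t, s ≤ t → FBM.ItoIntegrable B P (Iic s) (fun r _ ↦ FBM.fKernel H s t r)) ∧
    (∀ t, s < t →
      FBM.ItoIntegrable B P (Iic s) (fun r _ ↦ deriv (fun u ↦ FBM.fKernel H s u r) t)) ∧
    -- the increment splits
    (∀ t, s ≤ t → ∀ᵐ ω ∂P, BH t ω - BH s ω = FBM.WH B P H s t ω + FBM.RH B P H s t ω) ∧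
    -- independent centred Gaussian adapted processes
    IndepFun (fun ω (t : Ioi s) ↦ FBM.WH B P H s t ω) (fun ω (t : Ioi s) ↦ FBM.RH B P H s t ω) P ∧
    IsGaussianProcess (fun t : Ioi s ↦ FBM.WH B P H s t) P ∧
    IsGaussianProcess (fun t : Ioi s ↦ FBM.RH B P H s t) P ∧
    (∀ t, s < t → ∫ ω, FBM.WH B P H s t ω ∂P = 0) ∧
    (∀ t, s < t → ∫ ω, FBM.RH B P H s t ω ∂P = 0) ∧
    (∀ t, s < t → Measurable[FBM.history B P t] (FBM.WH B P H s t)) ∧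
    (∀ t, s < t → Measurable[FBM.history B P t] (FBM.RH B P H s t)) ∧
    -- `W_H` is independent of `𝒢_s`
    Indep (MeasurableSpace.comap (fun ω (t : Ioi s) ↦ FBM.WH B P H s t ω) MeasurableSpace.pi)
      (FBM.history B P s) P ∧
    -- the integral of a `𝒢_s`-measurable process against `W_H`
    (∀ γ : ℝ → Ω → ℝ,
      AEStronglyMeasurable[(borel ℝ).prod (FBM.history B P s)] (fun p : ℝ × Ω ↦ γ p.1 p.2)
        ((volume.restrict (Icc s T)).prod P) →
      MemLp (fun p : ℝ × Ω ↦ γ p.1 p.2) 2 ((volume.restrict (Icc s T)).prod P) →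
      (∀ᵐ p ∂((volume.restrict (Icc s T)).prod P),
        IntervalIntegrable (fun t ↦ (t - p.1) ^ (H - 3 / 2) * γ t p.2) volume p.1 T) ∧
      FBM.ItoIntegrable B P (Icc s T) (fun τ ω ↦ FBM.GH H T (fun t ↦ γ t ω) τ) ∧
      FBM.StochIntegrable (FBM.WH B P H s) (fun _ ↦ FBM.history B P s) P (Icc s T) γ ∧
      FBM.stochIntegral (FBM.WH B P H s) (fun _ ↦ FBM.history B P s) P (Icc s T) γ =ᵐ[P]
        FBM.itoIntegral B P (Icc s T) (fun τ ω ↦ FBM.GH H T (fun t ↦ γ t ω) τ)) ∧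
    -- `R_H` is `𝒢_s`-measurable and differentiable in mean
    (∀ t, s < t → Measurable[FBM.history B P s] (FBM.RH B P H s t)) ∧
    (∀ t, s < t → Tendsto
      (fun δ : ℝ ↦ eLpNorm (fun ω ↦
        (FBM.RH B P H s (t + δ) ω - FBM.RH B P H s t ω) / δ - FBM.DRH B P H s t ω) 1 P)
      (𝓝[≠] 0) (𝓝 0)) ∧
    -- the mean derivative
    (∀ t, s < t → Measurable[FBM.history B P s] (FBM.DRH B P H s t)) ∧
    (∀ t, s < t → ∫ ω, FBM.DRH B P H s t ω ^ 2 ∂P =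
      FBM.cH H ^ 2 * ((H - 1 / 2) ^ 2 / (2 - 2 * H)) * (t - s) ^ (2 * H - 2)) ∧
    -- `𝒟R_H` has a jointly measurable version, and every such version has the stated energy
    (∃ D : ℝ → Ω → ℝ, Measurable (fun p : ℝ × Ω ↦ D p.1 p.2) ∧
      ∀ t, s < t → D t =ᵐ[P] FBM.DRH B P H s t) ∧
    (∀ D : ℝ → Ω → ℝ,
      AEStronglyMeasurable (fun p : ℝ × Ω ↦ D p.1 p.2) ((volume.restrict (Ioi s)).prod P) →
      (∀ t, s < t → D t =ᵐ[P] FBM.DRH B P H s t) →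
      ∀ t, s < t →
        Integrable (fun p : ℝ × Ω ↦ D p.1 p.2 ^ 2) ((volume.restrict (Ioc s t)).prod P) ∧
        ∫ ω, (∫ r in s..t, D r ω ^ 2) ∂P =
          FBM.cH H ^ 2 * (H - 1 / 2) / (2 * (2 - 2 * H)) * (t - s) ^ (2 * H - 1)) := by
  have hWind : Indep (MeasurableSpace.comap (fun ω (t : Ioi s) ↦ FBM.WH B P H s t ω)
      MeasurableSpace.pi) (FBM.history B P s) P := by
    refine indep_of_indep_of_le_left (hB.indep_history_future s).symm ?_
    refine (@measurable_iff_comap_le _ _ (FBM.future B P s) _ _).1 ?_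
    exact (@measurable_pi_iff _ _ _ (FBM.future B P s) _ _).2 fun t ↦
      FBM.measurable_future_WH hB hH s t
  have hRmeas : MeasurableSpace.comap (fun ω (t : Ioi s) ↦ FBM.RH B P H s t ω)
      MeasurableSpace.pi ≤ FBM.history B P s := by
    refine (@measurable_iff_comap_le _ _ (FBM.history B P s) _ _).1 ?_
    exact (@measurable_pi_iff _ _ _ (FBM.history B P s) _ _).2 fun t ↦
      FBM.measurable_history_RH hB hH (le_of_lt t.2)
  refine ⟨fun t _ ↦ FBM.itoIntegrable_WH hB hH s t, fun t ht ↦ FBM.itoIntegrable_RH hB hH ht,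
    fun t ht ↦ FBM.itoIntegrable_DRH hB hH ht,
    fun t ht ↦ FBM.fractional_increment_ae_eq hB hH hBH ht,
    (IndepFun_iff_Indep _ _ _).2 (indep_of_indep_of_le_right hWind hRmeas),
    FBM.isGaussianProcess_WH hB hH, FBM.isGaussianProcess_RH hB hH,
    fun t _ ↦ (FBM.isItoIntegral_WH hB hH s t).integral_eq_zero hB,
    fun t ht ↦ (FBM.isItoIntegral_RH hB hH ht.le).integral_eq_zero hB,
    fun t _ ↦ (FBM.isItoIntegral_WH hB hH s t).measurable_history hB Icc_subset_Iic_self,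
    fun t ht ↦ (FBM.measurable_history_RH hB hH ht.le).mono
      (FBM.history_mono B P ht.le) le_rfl,
    hWind, fun γ hγm hγ ↦ ?_, fun t ht ↦ FBM.measurable_history_RH hB hH ht.le,
    fun t ht ↦ FBM.tendsto_RH_slope hB hH ht,
    fun t ht ↦ (FBM.isItoIntegral_DRH hB hH ht).measurable_history hB subset_rfl,
    fun t ht ↦ FBM.integral_DRH_sq hB hH ht, FBM.exists_measurable_version_DRH hB hH,
    fun D hD hDe t ht ↦ FBM.energy_DRH hB hH hD hDe ht⟩
  have hI := FBM.isStochIntegral_WH hB hH hγm hγ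
  exact ⟨(FBM.GH_bound hH hγ).1, FBM.itoIntegrable_GH hB hH hγm hγ, ⟨_, hI⟩,
    FBM.IsStochIntegral.ae_eq (fun _ _ ↦ hB.history_le s) (FBM.memLp_WH H s)
      (FBM.StochIntegrable.isStochIntegral ⟨_, hI⟩) hI⟩
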